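/- Let $n\ge 1$, let $A_1,\dots,A_{2n},V\in C^\infty(\mathbb R^{2n};\mathbb R)$, and for $\hbar>0$ let $$H_\hbar=\sum_{j=1}^{2n}\Big(\frac{\hbar}{i}\frac{\partial}{\partial x_j}-A_j(x)\Big)^2+\hbar V(x).$$ Let $B_x=(B_{jk}(x))_{j,k}$ with $B_{jk}=\partial_{x_j}A_k-\partial_{x_k}A_j$, and assume that all $B_{jk}$ and $V$ are bounded on $\mathbb R^{2n}$ together with all their derivatives. Assume that $B_x$ has rank $2n$ for every $x\in\mathbb R^{2n}$ and that $\inf_{x}|B_x|>0$, where $|\cdot|$ is a matrix norm. Let $\pm i a_1(x),\dots,\pm i a_n(x)$, with $a_j(x)>0$, be the eigenvalues of $B_x$ counted with multiplicity, and put $$\Sigma_x=\Big\{\sum_{j=1}^n(2k_j+1)a_j(x)+V(x)\,:\,k_1,\dots,k_n\in\mathbb Z_{\ge 0}\Big\},\qquad \mathcal K_{[a,b]}=\{x\in\mathbb R^{2n}:\Sigma_x\cap[a,b]\ne\emptyset\}.$$ Assume that, for an interval $[a,b]\subset\mathbb R$, the set $\mathcal K_{[a,b]}$ is compact. Then for all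 $a_1>a$ and $b_1<b$ there exist $\hbar_0>0$ and $C,c>0$ such that, for every $\hbar\in(0,\hbar_0]$, every $\lambda_\hbar\in[\hbar a_1,\hbar b_1]$ and every $u_\hbar\in C^\infty(\mathbb R^{2n})\cap L^2(\mathbb R^{2n})$ with $H_\hbar u_\hbar=\lambda_\hbar u_\hbar$, $$\int_{\mathbb R^{2n}}e^{2c\,d(x,\mathcal K_{[a,b]})/\hbar^{1/2}}\,|u_\hbar(x)|^2\,dx\le C\,\|u_\hbar\|_{L^2}^2,$$ where $d(x,\mathcal K_{[a,b]})$ is the Euclidean distance from $x$ to $\mathcal K_{[a,b]}$, with $d(x,\emptyset)=+\infty$ (so that, if $\mathcal K_{[a,b]}=\emptyset$, the estimate says $u_\hbar=0$). -/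

import Mathlib

open scoped ContDiff ENNReal

noncomputable section

namespace MagneticSchrodinger

/-- The partial derivative `∂f/∂x_j` of a function on the Euclidean space `ℝ^d`. -/
def partialDeriv {d : ℕ} {F : Type*} [NormedAddCommGroup F] [NormedSpace ℝ F]
    (j : Fin d) (f : EuclideanSpace ℝ (Fin d) → F) (x : EuclideanSpace ℝ (Fin d)) : F :=
  fderiv ℝ f x (EuclideanSpace.single j 1)

/-- `f ∈ C^∞_b(ℝ^d)`: a smooth function, bounded together with all its derivatives. -/
def IsSmoothBounded {d : ℕ} (f : EuclideanSpace ℝ (Fin d) → ℝ) : Prop :=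
  ContDiff ℝ ∞ f ∧ ∀ k : ℕ, ∃ M : ℝ, ∀ x, ‖iteratedFDeriv ℝ k f x‖ ≤ M

/-- The magnetic field `B_{jk} = ∂A_k/∂x_j - ∂A_j/∂x_k` of the magnetic potential `A`. -/
def magneticField {d : ℕ} (A : Fin d → EuclideanSpace ℝ (Fin d) → ℝ)
    (x : EuclideanSpace ℝ (Fin d)) : Matrix (Fin d) (Fin d) ℝ :=
  Matrix.of fun j k => partialDeriv j (A k) x - partialDeriv k (A j) x

/-- The norm `|B_x|` of the magnetic field at `x` (Hilbert-Schmidt norm of the matrix). -/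
def fieldNorm {d : ℕ} (A : Fin d → EuclideanSpace ℝ (Fin d) → ℝ)
    (x : EuclideanSpace ℝ (Fin d)) : ℝ :=
  Real.sqrt (∑ j, ∑ k, magneticField A x j k ^ 2)

/-- The semiclassical covariant derivative `(ħ / i) ∂/∂x_j - A_j`. -/
def covariantDeriv {d : ℕ} (A : Fin d → EuclideanSpace ℝ (Fin d) → ℝ) (ħ : ℝ) (j : Fin d)
    (u : EuclideanSpace ℝ (Fin d) → ℂ) (x : EuclideanSpace ℝ (Fin d)) : ℂ :=
  ((ħ : ℂ) / Complex.I) * partialDeriv j u x - (A j x : ℂ) * u x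

/-- The magnetic Schrödinger operator
`H_ħ = ∑_j ((ħ / i) ∂/∂x_j - A_j)² + ħ V`, as a differential operator. -/
def schrodinger {d : ℕ} (A : Fin d → EuclideanSpace ℝ (Fin d) → ℝ)
    (V : EuclideanSpace ℝ (Fin d) → ℝ) (ħ : ℝ)
    (u : EuclideanSpace ℝ (Fin d) → ℂ) (x : EuclideanSpace ℝ (Fin d)) : ℂ :=
  ∑ j, covariantDeriv A ħ j (covariantDeriv A ħ j u) x + (ħ : ℂ) * (V x : ℂ) * u x

/-- `a_1, …, a_n > 0` are such that the eigenvalues of the real `2n × 2n` matrix `M`, counted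
with multiplicity, are `± i a_1, …, ± i a_n`. -/
def IsFrequencies {n : ℕ} (M : Matrix (Fin (2 * n)) (Fin (2 * n)) ℝ) (a : Fin n → ℝ) : Prop :=
  (∀ j, 0 < a j) ∧
    (M.map (algebraMap ℝ ℂ)).charpoly.roots =
      (Finset.univ.val.map fun j => Complex.I * (a j : ℂ)) +
        (Finset.univ.val.map fun j => -(Complex.I * (a j : ℂ)))

/-- `Σ_x`, the set of the numbers `Λ_k(x) = ∑_j (2 k_j + 1) a_j(x) + V(x)` with `k ∈ ℤ_+^n`, where
`± i a_j(x)` are the eigenvalues of `B_x`. The `a_j(x)` are unique up to order, on which the set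
does not depend. -/
def landauLevels {n : ℕ}
    (A : Fin (2 * n) → EuclideanSpace ℝ (Fin (2 * n)) → ℝ)
    (V : EuclideanSpace ℝ (Fin (2 * n)) → ℝ)
    (x : EuclideanSpace ℝ (Fin (2 * n))) : Set ℝ :=
  {Λ | ∃ a : Fin n → ℝ, IsFrequencies (magneticField A x) a ∧
    ∃ k : Fin n → ℕ, Λ = ∑ j, (2 * (k j : ℝ) + 1) * a j + V x}

/-- `K_{[a,b]}`, the set of the points `x` such that `Σ_x` meets `[a,b]`. -/
def resonantSet {n : ℕ}
    (A : Fin (2 * n) → EuclideanSpace ℝ (Fin (2 * n)) → ℝ)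
    (V : EuclideanSpace ℝ (Fin (2 * n)) → ℝ) (a b : ℝ) :
    Set (EuclideanSpace ℝ (Fin (2 * n))) :=
  {x | (landauLevels A V x ∩ Set.Icc a b).Nonempty}

/-- The weight `exp (2 c d(x, K) / ħ^{1/2})`, with values in `[0, ∞]`. The distance is the
extended one, `d(x, ∅) = ∞`. -/
def expWeight {d : ℕ} (c ħ : ℝ) (K : Set (EuclideanSpace ℝ (Fin d)))
    (x : EuclideanSpace ℝ (Fin d)) : ℝ≥0∞ :=
  EReal.exp (((2 * c / Real.sqrt ħ : ℝ) : EReal) * ((Metric.infEDist x K : ℝ≥0∞) : EReal))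

end MagneticSchrodinger

end

noncomputable section

namespace MagneticSchrodinger

/-! ### Abstract spectral gap from finite-dimensional invariant subspaces -/

section SpectralGap

/-! The decay is proved by a local comparison on the length scale ħ^{1/2}, followed by an averaging
argument; no exponential weight is ever commuted through the operator.

Local comparison. Fix a point z off the resonant set and rescale by s = ħ^{1/2} around z. The
operator becomes a magnetic Schrödinger operator with ħ = 1 whose field and electric potential have
gradients of size O(s). In the radial gauge its vector potential is the linear potential of the
constant field B_z plus a remainder that is quadratic in y with a small factor κ (`exists_gauge`).
Multiply the eigenfunction by a cutoff to a ball of radius R. The cutoff, the gauge remainder and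
the variation of V cost O(1/R) times the function and its covariant derivatives, provided κ = R⁻³.
Caccioppoli's inequality bounds these derivatives by the mass in the ball of radius 2R. On the other
side, the Landau operator with constant field B_z has no level within δ = min(a₁ - a, b - b₁) of the
energy, precisely because z is not resonant. Hence δ² times the mass in the ball of radius R/2 is at
most C R⁻² times the mass in the ball of radius 2R, and a large R makes the ratio any prescribed ε,
uniformly in z (`local_decay`, `semiclassical_decay`).

The gap of the model (`landau_gap`). On functions p exp(-⟨|B|x,x⟩/4) with p a polynomial, the
momenta act on p by first-order operators, and suitable complex combinations of them are
annihilation operators that lower the degree. The polynomials of degree at most m therefore form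
finite-dimensional invariant spaces, and the eigenvalues are found by lowering the degree until only
the ground energy is left. These functions are dense in L², because a function orthogonal to all of
them has, after multiplication by the Gaussian, vanishing moments and hence zero Fourier transform.
A duality argument (`spectralGap_of_dense`) then gives the lower bound for compactly supported
functions without discussing self-adjointness.

From local to global (`lintegral_weight_le`). Take a weight W that changes by at most a factor 2
over the larger balls and equals 1 on the resonant set. Multiply the local estimate by W(z) and
integrate over z. By Tonelli, both sides become the weighted mass up to constants, and ε is chosen
so that the right side carries only half of the left; centers z in the resonant set contribute an
unweighted mass. Truncating the distance keeps the weighted mass finite so that it can be absorbed,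
and monotone convergence removes the truncation. An empty resonant set is covered as well: the
truncated weights then tend to infinity everywhere. -/

/-- In an orthonormal eigenbasis `S - μ` is diagonal with entries of modulus at least `δ`; Parseval
does the rest. -/
theorem spectralGap_of_isSymmetric {E : Type*} [NormedAddCommGroup E] [InnerProductSpace ℂ E]
    [FiniteDimensional ℂ E] {S : E →ₗ[ℂ] E} (hS : S.IsSymmetric) {μ δ : ℝ} (hδ : 0 ≤ δ)
    (h : ∀ ν : ℝ, Module.End.HasEigenvalue S (ν : ℂ) → δ ≤ |ν - μ|) (x : E) :
    δ * ‖x‖ ≤ ‖S x - (μ : ℂ) • x‖ := by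
  have hn : Module.finrank ℂ E = Module.finrank ℂ E := rfl
  set b := hS.eigenvectorBasis hn
  have hrep : ∀ i, b.repr (S x - (μ : ℂ) • x) i = ((hS.eigenvalues hn i - μ : ℝ) : ℂ) * b.repr x i := by
    intro i
    have := hS.eigenvectorBasis_apply_self_apply hn x i
    simp only [map_sub, map_smul, PiLp.sub_apply, PiLp.smul_apply, smul_eq_mul]
    rw [this]
    push_cast
    simp only [b, Complex.coe_algebraMap]
    ring
  have hsq : (δ * ‖x‖) ^ 2 ≤ ‖S x - (μ : ℂ) • x‖ ^ 2 := by
    rw [mul_pow, ← b.repr.norm_map x, ← b.repr.norm_map (S x - _), EuclideanSpace.norm_sq_eq,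
      EuclideanSpace.norm_sq_eq, Finset.mul_sum]
    refine Finset.sum_le_sum fun i _ => ?_
    rw [hrep i, norm_mul, mul_pow, Complex.norm_real, Real.norm_eq_abs]
    have : δ ≤ |hS.eigenvalues hn i - μ| := h _ (hS.hasEigenvalue_eigenvalues hn i)
    gcongr
  exact (sq_le_sq₀ (by positivity) (norm_nonneg _)).1 hsq

variable {X H : Type*} [AddCommGroup X] [Module ℂ X] [NormedAddCommGroup H] [InnerProductSpace ℂ H]

/-- Lower bound for the formal adjoint of `T - μ`, where `T` is symmetric on a dense space which is
exhausted by finite-dimensional invariant subspaces, and its eigenvalues keep a distance `δ`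
from `μ`. -/
theorem spectralGap_of_dense (Φ : X →ₗ[ℂ] H) (hΦ : Function.Injective Φ)
    (hd : DenseRange Φ) (T : X →ₗ[ℂ] X)
    (hT : ∀ x y, inner ℂ (Φ (T x)) (Φ y) = inner ℂ (Φ x) (Φ (T y)))
    (F : ℕ → Submodule ℂ X) (hF : ∀ m, FiniteDimensional ℂ (F m))
    (hTF : ∀ m, ∀ x ∈ F m, T x ∈ F m) (hFex : ∀ x, ∃ m, x ∈ F m)
    {μ δ : ℝ} (hδ : 0 < δ)
    (hev : ∀ ν : ℝ, ∀ x, x ≠ 0 → T x = (ν : ℂ) • x → δ ≤ |ν - μ|)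
    (v g : H) (hvg : ∀ x, inner ℂ (Φ x) g = inner ℂ (Φ (T x) - (μ : ℂ) • Φ x) v) :
    δ * ‖v‖ ≤ ‖g‖ := by
  -- Solve `(T - μ) h = f` inside an invariant `F m` containing `f`. Transporting `T` to the image
  -- of `F m` in `H` gives a symmetric endomorphism of a finite-dimensional inner product space; the
  -- gap makes it injective after subtracting `μ`, hence surjective, with inverse bounded by `1 /
  -- δ`.
  have key : ∀ f : X, ∃ h : X, T h - (μ : ℂ) • h = f ∧ δ * ‖Φ h‖ ≤ ‖Φ f‖ := by
    intro f
    obtain ⟨m, hm⟩ := hFex f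
    have := hF m
    let Ψ : F m →ₗ[ℂ] H := Φ ∘ₗ (F m).subtype
    have hΨ : Function.Injective Ψ := hΦ.comp (F m).injective_subtype
    let e : F m ≃ₗ[ℂ] LinearMap.range Ψ := LinearEquiv.ofInjective Ψ hΨ
    have he : ∀ x, (e x : H) = Φ x := fun x => rfl
    let T' : F m →ₗ[ℂ] F m := T.restrict (hTF m)
    have hT' : ∀ x, (T' x : X) = T x := fun x => rfl
    let S : LinearMap.range Ψ →ₗ[ℂ] LinearMap.range Ψ := e.toLinearMap ∘ₗ T' ∘ₗ e.symm.toLinearMap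
    have hS : S.IsSymmetric := by
      intro x y
      obtain ⟨x, rfl⟩ := e.surjective x
      obtain ⟨y, rfl⟩ := e.surjective y
      simp only [S, LinearMap.comp_apply, LinearEquiv.coe_coe, LinearEquiv.symm_apply_apply,
        Submodule.coe_inner, he, hT']
      exact hT _ _
    have hgap := spectralGap_of_isSymmetric hS hδ.le (μ := μ) (by
      intro ν hν
      obtain ⟨x, hx⟩ := hν.exists_hasEigenvector
      obtain ⟨y, rfl⟩ := e.surjective x
      have h1 := hx.apply_eq_smul
      simp only [S, LinearMap.comp_apply, LinearEquiv.coe_coe, LinearEquiv.symm_apply_apply,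
        ← map_smul] at h1
      have h2 := congrArg Subtype.val (e.injective h1)
      refine hev ν y ?_ h2
      intro h0
      apply hx.2
      have : y = 0 := Subtype.ext h0
      simp [this])
    let R : LinearMap.range Ψ →ₗ[ℂ] LinearMap.range Ψ := S - (μ : ℂ) • LinearMap.id
    have hRinj : Function.Injective R := by
      rw [← LinearMap.ker_eq_bot, LinearMap.ker_eq_bot']
      intro x hx
      have := hgap x
      have hx' : S x - (μ : ℂ) • x = 0 := hx
      rw [hx', norm_zero] at this
      have : ‖x‖ ≤ 0 := by
        by_contra hc
        push Not at hc
        nlinarith [mul_pos hδ hc]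
      exact norm_le_zero_iff.1 this
    obtain ⟨y, hy⟩ := (LinearMap.injective_iff_surjective.1 hRinj) (e ⟨f, hm⟩)
    obtain ⟨h, rfl⟩ := e.surjective y
    have hy' : S (e h) - (μ : ℂ) • e h = e ⟨f, hm⟩ := hy
    refine ⟨h, ?_, ?_⟩
    · simp only [S, LinearMap.comp_apply, LinearEquiv.coe_coe, LinearEquiv.symm_apply_apply,
        ← map_smul, ← map_sub] at hy'
      exact congrArg Subtype.val (e.injective hy')
    · have := hgap (e h)
      rw [hy'] at this
      simpa only [Submodule.coe_norm, he] using this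
  -- Duality: with `f = (T - μ) h` the pairing of `Φ f` with `v` equals that of `Φ h` with `g`.
  have bound : ∀ f : X, ‖inner ℂ (Φ f) v‖ * δ ≤ ‖Φ f‖ * ‖g‖ := by
    intro f
    obtain ⟨h, rfl, hh⟩ := key f
    have h1 : inner ℂ (Φ (T h - (μ : ℂ) • h)) v = inner ℂ (Φ h) g := by
      rw [hvg, map_sub, map_smul]
    rw [h1]
    have h2 := norm_inner_le_norm (𝕜 := ℂ) (Φ h) g
    calc _ ≤ ‖Φ h‖ * ‖g‖ * δ := by gcongr
      _ = δ * ‖Φ h‖ * ‖g‖ := by ring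
      _ ≤ _ := by gcongr
  have bound' : ∀ y : H, ‖inner ℂ y v‖ * δ ≤ ‖y‖ * ‖g‖ := by
    intro y
    refine hd.induction_on (p := fun y : H => ‖inner ℂ y v‖ * δ ≤ ‖y‖ * ‖g‖) y ?_ bound
    exact isClosed_le (by fun_prop) (by fun_prop)
  -- By density the functional bound holds at every vector, in particular at `v` itself.
  have hv := bound' v
  rw [inner_self_eq_norm_sq_to_K] at hv
  by_cases hv0 : ‖v‖ = 0
  · rw [hv0, mul_zero]; exact norm_nonneg _
  have hpos : 0 < ‖v‖ := lt_of_le_of_ne (norm_nonneg _) (Ne.symm hv0)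
  simp only [Complex.coe_algebraMap, norm_pow, Complex.norm_real, norm_norm] at hv
  have : ‖v‖ * (δ * ‖v‖) ≤ ‖v‖ * ‖g‖ := by nlinarith
  exact le_of_mul_le_mul_left this hpos

end SpectralGap


/-! ### Ladder operators for momenta with constant commutators -/

section Ladder

variable {σ X : Type*} [Fintype σ] [AddCommGroup X] [Module ℂ X]

/-- The combination `∑ w_j π_j` of momenta. -/
def ladder (π : σ → Module.End ℂ X) (w : σ → ℂ) : Module.End ℂ X := ∑ j, w j • π j

/-- The kinetic energy `∑ π_j²`. -/
def kinetic (π : σ → Module.End ℂ X) : Module.End ℂ X := ∑ j, π j * π j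

variable {π : σ → Module.End ℂ X} {b : Matrix σ σ ℂ}
  (hπ : ∀ j k, π j * π k = π k * π j + (Complex.I * b j k) • 1)

-- Commuting `π_j²` past `π_k` produces a multiple of `π_j` because the commutators are scalars. If
-- `b w = iβ w`, this reads `[T, L_w] = -2β L_w`: the operator `L_w` shifts energies by `-2β`.
include hπ in
theorem kinetic_mul_ladder (w : σ → ℂ) :
    kinetic π * ladder π w = ladder π w * kinetic π
      + (2 * Complex.I) • ladder π (b.mulVec w) := by
  have h1 : ∀ j k, π j * π j * π k = π k * (π j * π j) + (2 * Complex.I * b j k) • π j := by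
    intro j k
    rw [mul_assoc, hπ j k, mul_add, ← mul_assoc, hπ j k, add_mul, mul_smul_comm, smul_mul_assoc,
      mul_one, one_mul, mul_assoc, add_assoc, ← add_smul]
    congr 2
    ring
  simp only [kinetic, ladder, Finset.sum_mul, Finset.mul_sum, mul_smul_comm, smul_mul_assoc, h1,
    smul_add, Finset.sum_add_distrib, Finset.smul_sum, Matrix.mulVec, dotProduct, Finset.sum_smul,
    smul_smul]
  congr 1
  · rw [Finset.sum_comm]
  · rw [Finset.sum_comm]
    refine Finset.sum_congr rfl fun j _ => Finset.sum_congr rfl fun k _ => ?_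
    congr 1
    ring

include hπ in
theorem ladder_mul_ladder (u w : σ → ℂ) :
    ladder π u * ladder π w = ladder π w * ladder π u
      + (Complex.I * ∑ j, u j * b.mulVec w j) • 1 := by
  have h1 : ∀ j k, (u j * w k) • (π j * π k) = (w k * u j) • (π k * π j)
      + (Complex.I * (u j * (b j k * w k))) • 1 := by
    intro j k
    rw [hπ j k, smul_add, smul_smul, mul_comm (u j)]
    congr 2
    ring
  have h2 : ladder π u * ladder π w = ∑ j, ∑ k, (u j * w k) • (π j * π k) := by
    simp only [ladder, Finset.sum_mul, Finset.mul_sum, mul_smul_comm, smul_mul_assoc,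
      Finset.smul_sum, smul_smul]
    rw [Finset.sum_comm]
    simp only [mul_comm (w _)]
  have h3 : ladder π w * ladder π u = ∑ j, ∑ k, (w k * u j) • (π k * π j) := by
    simp only [ladder, Finset.sum_mul, Finset.mul_sum, mul_smul_comm, smul_mul_assoc,
      Finset.smul_sum, smul_smul, mul_comm (w _)]
  rw [h2, h3]
  simp only [h1, Finset.sum_add_distrib, Matrix.mulVec, dotProduct, Finset.mul_sum,
    Finset.sum_smul]

theorem kinetic_eq_sum_ladder [DecidableEq σ] {κ : Type*} [Fintype κ] {u w : κ → σ → ℂ}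
    (huw : ∀ j k, ∑ i, u i j * w i k = if j = k then 1 else 0) :
    kinetic π = ∑ i, ladder π (u i) * ladder π (w i) := by
  simp only [ladder, kinetic, Finset.sum_mul, Finset.mul_sum, mul_smul_comm, smul_mul_assoc,
    Finset.smul_sum, smul_smul]
  rw [Finset.sum_comm]
  have : ∀ k, (∑ i, ∑ j, (w i k * u i j) • (π j * π k)) = π k * π k := by
    intro k
    rw [Finset.sum_comm]
    simp only [← Finset.sum_smul, mul_comm (w _ k), huw]
    simp
  simp only [← this]

/-- The ladder structure of the Landau Hamiltonian with field `b` and frequencies `|β_i|`, with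
respect to a filtration `F` which is lowered by the annihilation operators. -/
structure LadderSystem [DecidableEq σ] (π : σ → Module.End ℂ X) (b : Matrix σ σ ℂ)
    (β : σ → ℝ) (u w : σ → σ → ℂ) (F : ℕ → Submodule ℂ X) : Prop where
  comm : ∀ j k, π j * π k = π k * π j + (Complex.I * b j k) • 1
  complete : ∀ j k, ∑ i, u i j * w i k = if j = k then 1 else 0
  ne_zero : ∀ i, β i ≠ 0
  eigen : ∀ i, b.mulVec (w i) = (Complex.I * β i) • w i
  normalized : ∀ i, ∑ j, u i j * w i j = 1
  raise : ∀ j m, ∀ p ∈ F m, π j p ∈ F (m + 1)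
  lower_pos : ∀ i, 0 < β i → (∀ p ∈ F 0, ladder π (w i) p = 0) ∧
    ∀ m, ∀ p ∈ F (m + 1), ladder π (w i) p ∈ F m
  lower_neg : ∀ i, β i < 0 → (∀ p ∈ F 0, ladder π (u i) p = 0) ∧
    ∀ m, ∀ p ∈ F (m + 1), ladder π (u i) p ∈ F m

namespace LadderSystem

variable [DecidableEq σ] {β : σ → ℝ} {u w : σ → σ → ℂ} {F : ℕ → Submodule ℂ X}
  (h : LadderSystem π b β u w F)

include h

theorem ladder_mem (c : σ → ℂ) {m : ℕ} {p : X} (hp : p ∈ F m) : ladder π c p ∈ F (m + 1) := by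
  simp only [ladder, LinearMap.sum_apply, LinearMap.smul_apply]
  exact Submodule.sum_mem _ fun j _ => Submodule.smul_mem _ _ (h.raise j m p hp)

theorem commutator (i : σ) :
    ladder π (u i) * ladder π (w i) = ladder π (w i) * ladder π (u i) + (-(β i : ℂ)) • 1 := by
  rw [ladder_mul_ladder h.comm, h.eigen]
  congr 2
  have : ∑ j, u i j * ((Complex.I * β i) • w i) j = Complex.I * β i * ∑ j, u i j * w i j := by
    rw [Finset.mul_sum]
    refine Finset.sum_congr rfl fun j _ => ?_
    simp only [Pi.smul_apply, smul_eq_mul]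
    ring
  rw [this, h.normalized, mul_one, ← mul_assoc, Complex.I_mul_I]
  ring

/-- A product that first lowers and then raises preserves the filtration. For `β i < 0` it is the
`u`-combination that lowers, so the factors are exchanged first, at the price of a scalar. -/
theorem ladder_ladder_mem (i : σ) {m : ℕ} {p : X} (hp : p ∈ F m) :
    (ladder π (u i) * ladder π (w i)) p ∈ F m := by
  rcases lt_or_gt_of_ne (h.ne_zero i) with hi | hi
  · rw [h.commutator]
    simp only [LinearMap.add_apply, Module.End.mul_apply, LinearMap.smul_apply, Module.End.one_apply]
    refine Submodule.add_mem _ ?_ (Submodule.smul_mem _ _ hp)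
    cases m with
    | zero => rw [(h.lower_neg i hi).1 p hp, map_zero]; exact Submodule.zero_mem _
    | succ m => exact h.ladder_mem _ ((h.lower_neg i hi).2 m p hp)
  · rw [Module.End.mul_apply]
    cases m with
    | zero => rw [(h.lower_pos i hi).1 p hp, map_zero]; exact Submodule.zero_mem _
    | succ m => exact h.ladder_mem _ ((h.lower_pos i hi).2 m p hp)

theorem kinetic_mem {m : ℕ} {p : X} (hp : p ∈ F m) : kinetic π p ∈ F m := by
  rw [kinetic_eq_sum_ladder h.complete, LinearMap.sum_apply]
  exact Submodule.sum_mem _ fun i _ => h.ladder_ladder_mem i hp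

/-- `hpair` says that the adjoint of a creation operator is an annihilation operator. -/
theorem kinetic_eq_of_annihilated
    (hpair : ∀ i, β i < 0 → ∀ p, (∀ i', 0 < β i' → ladder π (w i') p = 0) → ladder π (u i) p = 0)
    {p : X} (hp : ∀ i, 0 < β i → ladder π (w i) p = 0) :
    kinetic π p = ((∑ i, if 0 < β i then 0 else -β i : ℝ) : ℂ) • p := by
  rw [kinetic_eq_sum_ladder h.complete, LinearMap.sum_apply]
  push_cast
  rw [Finset.sum_smul]
  refine Finset.sum_congr rfl fun i _ => ?_
  rcases lt_or_gt_of_ne (h.ne_zero i) with hi | hi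
  · rw [h.commutator, if_neg (by linarith)]
    simp [Module.End.mul_apply, hpair i hi p hp]
  · rw [if_pos hi, Module.End.mul_apply, hp i hi]
    simp

/-- Induction on the filtration: an eigenvector is either killed by all annihilation operators, and
then has the ground energy, or one of them maps it to a nonzero eigenvector one level down, with
eigenvalue smaller by `2 β i`. -/
theorem eigenvalue_kinetic
    (hpair : ∀ i, β i < 0 → ∀ p, (∀ i', 0 < β i' → ladder π (w i') p = 0) → ladder π (u i) p = 0)
    (m : ℕ) : ∀ p ∈ F m, p ≠ 0 → ∀ ν : ℝ, kinetic π p = (ν : ℂ) • p →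
      ∃ k : σ → ℕ, ν = (∑ i, if 0 < β i then 0 else -β i)
        + ∑ i, if 0 < β i then 2 * k i * β i else 0 := by
  have base : ∀ p : X, p ≠ 0 → (∀ i, 0 < β i → ladder π (w i) p = 0) → ∀ ν : ℝ,
      kinetic π p = (ν : ℂ) • p → ∃ k : σ → ℕ, ν = (∑ i, if 0 < β i then 0 else -β i)
        + ∑ i, if 0 < β i then 2 * k i * β i else 0 := by
    intro p hp0 hp ν hν
    refine ⟨fun _ => 0, ?_⟩
    rw [h.kinetic_eq_of_annihilated hpair hp] at hν
    have := smul_left_injective ℂ hp0 hν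
    simp [← Complex.ofReal_inj.1 this]
  induction m with
  | zero =>
    intro p hp hp0
    exact base p hp0 fun i hi => (h.lower_pos i hi).1 p hp
  | succ m ih =>
    intro p hp hp0 ν hν
    by_cases hall : ∀ i, 0 < β i → ladder π (w i) p = 0
    · exact base p hp0 hall ν hν
    · push Not at hall
      obtain ⟨i, hi, hne⟩ := hall
      have hT : kinetic π (ladder π (w i) p) = ((ν - 2 * β i : ℝ) : ℂ) • ladder π (w i) p := by
        have := congrArg (fun f => f p) (kinetic_mul_ladder h.comm (w i))
        simp only [Module.End.mul_apply, LinearMap.add_apply, LinearMap.smul_apply, hν,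
          map_smul, h.eigen] at this
        have hl : ladder π ((Complex.I * β i) • w i) p
            = (Complex.I * β i) • ladder π (w i) p := by
          simp [ladder, Finset.smul_sum, smul_smul]
        rw [this, hl, smul_smul, ← add_smul]
        congr 1
        push_cast
        linear_combination (2 * (β i : ℂ)) * Complex.I_mul_I
      obtain ⟨k, hk⟩ := ih _ ((h.lower_pos i hi).2 m p hp) hne _ hT
      refine ⟨Function.update k i (k i + 1), ?_⟩
      have hs : ∑ i', (if 0 < β i' then 2 * (Function.update k i (k i + 1) i' : ℝ) * β i' else 0)
          = (∑ i', if 0 < β i' then 2 * (k i' : ℝ) * β i' else 0) + 2 * β i := by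
        have : ∀ i', (if 0 < β i' then 2 * (Function.update k i (k i + 1) i' : ℝ) * β i' else 0)
            = (if 0 < β i' then 2 * (k i' : ℝ) * β i' else 0)
              + (if i' = i then 2 * β i else 0) := by
          intro i'
          by_cases hii : i' = i
          · subst hii
            simp [hi]
            ring
          · simp [hii]
        rw [Finset.sum_congr rfl fun i' _ => this i', Finset.sum_add_distrib]
        simp
      rw [hs]
      linarith

end LadderSystem

end Ladder


/-! ### Spectral theory of the antisymmetric matrix B and of |B| -/

section HermitianField

open Matrix

variable {d : ℕ}

/-- Diagonalize by the spectral theorem; cyclic invariance of the characteristic polynomial removes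
the unitary factors. -/
theorem charpoly_smul_of_isHermitian {H : Matrix (Fin d) (Fin d) ℂ} (hH : H.IsHermitian) (c : ℂ) :
    (c • H).charpoly = ∏ i, (Polynomial.X - Polynomial.C (c * hH.eigenvalues i)) := by
  conv_lhs => rw [hH.spectral_theorem, Unitary.conjStarAlgAut_apply, ← smul_mul_assoc,
    ← mul_smul_comm, charpoly_mul_comm, ← mul_assoc]
  simp [charpoly_diagonal, ← diagonal_smul]

theorem roots_charpoly_smul_of_isHermitian {H : Matrix (Fin d) (Fin d) ℂ} (hH : H.IsHermitian)
    (c : ℂ) : (c • H).charpoly.roots = Finset.univ.val.map fun i => c * (hH.eigenvalues i : ℂ) := by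
  rw [charpoly_smul_of_isHermitian hH, Polynomial.roots_prod]
  · simp only [Polynomial.roots_X_sub_C, Multiset.bind_singleton]
  · exact Finset.prod_ne_zero_iff.2 fun i _ => Polynomial.X_sub_C_ne_zero _

/-- The Hermitian matrix `-i B`. -/
def hermitianField (B : Matrix (Fin d) (Fin d) ℝ) : Matrix (Fin d) (Fin d) ℂ :=
  (-Complex.I) • B.map Complex.ofReal

variable {B : Matrix (Fin d) (Fin d) ℝ} (hB : Bᵀ = -B)

include hB in
theorem isHermitian_hermitianField : (hermitianField B).IsHermitian := by
  ext j k
  have : B k j = - B j k := congrFun (congrFun hB j) k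
  simp [hermitianField, this]

/-- The real numbers `β_i` such that the eigenvalues of `B` are `i β_i`. -/
def fieldEigenvalue (i : Fin d) : ℝ := (isHermitian_hermitianField hB).eigenvalues i

/-- An orthonormal eigenbasis of `B`. -/
def fieldEigenvector (i : Fin d) : Fin d → ℂ :=
  ⇑((isHermitian_hermitianField hB).eigenvectorBasis i)

theorem mulVec_fieldEigenvector (i : Fin d) :
    (B.map Complex.ofReal) *ᵥ fieldEigenvector hB i
      = (Complex.I * fieldEigenvalue hB i) • fieldEigenvector hB i := by
  have h : hermitianField B *ᵥ fieldEigenvector hB i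
      = fieldEigenvalue hB i • fieldEigenvector hB i :=
    (isHermitian_hermitianField hB).mulVec_eigenvectorBasis i
  have h1 : hermitianField B *ᵥ fieldEigenvector hB i
      = (-Complex.I) • (B.map Complex.ofReal *ᵥ fieldEigenvector hB i) := smul_mulVec ..
  rw [h1] at h
  have h2 := congrArg (fun v => Complex.I • v) h
  simp only [smul_smul, mul_neg, Complex.I_mul_I, neg_neg, one_smul] at h2
  rw [h2]
  ext j
  simp
  ring

theorem mulVec_star_fieldEigenvector (i : Fin d) :
    (B.map Complex.ofReal) *ᵥ star (fieldEigenvector hB i)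
      = (-(Complex.I * fieldEigenvalue hB i)) • star (fieldEigenvector hB i) := by
  have h := congrArg star (mulVec_fieldEigenvector hB i)
  ext j
  have h2 := congrFun h j
  simp only [mulVec, dotProduct, Pi.star_apply, star_sum, Pi.smul_apply, smul_eq_mul,
    star_mul', map_apply, RCLike.star_def, Complex.conj_ofReal, Complex.conj_I] at h2 ⊢
  rw [h2]
  ring

theorem sum_star_fieldEigenvector_mul (j k : Fin d) :
    ∑ i, star (fieldEigenvector hB i) j * fieldEigenvector hB i k = if j = k then 1 else 0 := by
  have h := (isHermitian_hermitianField hB).eigenvectorUnitary.2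
  have h2 := congrArg (fun M : Matrix (Fin d) (Fin d) ℂ => M k j) (Unitary.mul_star_self_of_mem h)
  simp only [mul_apply, star_apply, IsHermitian.eigenvectorUnitary_apply, one_apply] at h2
  simp only [fieldEigenvector, Pi.star_apply, mul_comm (star _)]
  rw [h2]
  simp [eq_comm]

theorem sum_star_fieldEigenvector_mul_self (i l : Fin d) :
    ∑ j, star (fieldEigenvector hB i) j * fieldEigenvector hB l j = if i = l then 1 else 0 := by
  have h := (isHermitian_hermitianField hB).eigenvectorUnitary.2
  have h2 := congrArg (fun M : Matrix (Fin d) (Fin d) ℂ => M i l) (Unitary.star_mul_self_of_mem h)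
  simp only [mul_apply, star_apply, IsHermitian.eigenvectorUnitary_apply, one_apply] at h2
  exact h2

/-- The coordinate of `v` along the eigenvector. -/
def fieldCoord (v : Fin d → ℂ) (i : Fin d) : ℂ := ∑ j, star (fieldEigenvector hB i) j * v j

theorem sum_fieldCoord (v : Fin d → ℂ) (k : Fin d) :
    ∑ i, fieldCoord hB v i * fieldEigenvector hB i k = v k := by
  simp only [fieldCoord, Finset.sum_mul]
  rw [Finset.sum_comm]
  have : ∀ j, ∑ i, star (fieldEigenvector hB i) j * v j * fieldEigenvector hB i k
      = v j * if j = k then 1 else 0 := by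
    intro j
    rw [← sum_star_fieldEigenvector_mul hB, Finset.mul_sum]
    exact Finset.sum_congr rfl fun i _ => by ring
  simp only [this, mul_ite, mul_one, mul_zero, Finset.sum_ite_eq', Finset.mem_univ, if_true]

/-- Eigenvectors of the skew-Hermitian matrix `B` with different eigenvalues are orthogonal. -/
theorem fieldCoord_eq_zero {v : Fin d → ℂ} {t : ℝ}
    (hv : (B.map Complex.ofReal) *ᵥ v = (Complex.I * t) • v) {i : Fin d}
    (hi : fieldEigenvalue hB i ≠ t) : fieldCoord hB v i = 0 := by
  have h1 : ∑ j, star (fieldEigenvector hB i) j * ((B.map Complex.ofReal) *ᵥ v) j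
      = Complex.I * t * fieldCoord hB v i := by
    rw [hv, fieldCoord, Finset.mul_sum]
    refine Finset.sum_congr rfl fun j _ => ?_
    simp only [Pi.smul_apply, smul_eq_mul]
    ring
  have h2 : ∑ j, star (fieldEigenvector hB i) j * ((B.map Complex.ofReal) *ᵥ v) j
      = Complex.I * fieldEigenvalue hB i * fieldCoord hB v i := by
    have : ∀ k, ∑ j, star (fieldEigenvector hB i) j * (B j k : ℂ)
        = Complex.I * fieldEigenvalue hB i * star (fieldEigenvector hB i) k := by
      intro k
      have h3 := congrFun (mulVec_star_fieldEigenvector hB i) k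
      simp only [mulVec, dotProduct, map_apply, Pi.smul_apply, smul_eq_mul] at h3
      rw [← neg_inj, ← neg_mul, ← h3, ← Finset.sum_neg_distrib]
      refine Finset.sum_congr rfl fun j _ => ?_
      have : B k j = - B j k := congrFun (congrFun hB j) k
      rw [this]
      push_cast
      ring
    simp only [mulVec, dotProduct, map_apply, Finset.mul_sum]
    rw [Finset.sum_comm]
    rw [fieldCoord, Finset.mul_sum]
    refine Finset.sum_congr rfl fun k _ => ?_
    rw [← mul_assoc, ← this, Finset.sum_mul]
    exact Finset.sum_congr rfl fun j _ => by ring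
  rw [h1] at h2
  have h3 : ((fieldEigenvalue hB i - t : ℝ) : ℂ) * fieldCoord hB v i = 0 := by
    have := mul_left_cancel₀ Complex.I_ne_zero (by linear_combination h2 :
      Complex.I * (t * fieldCoord hB v i) = Complex.I * (fieldEigenvalue hB i * fieldCoord hB v i))
    push_cast
    linear_combination -this
  rcases mul_eq_zero.1 h3 with h | h
  · exact absurd (sub_eq_zero.1 (Complex.ofReal_eq_zero.1 h)) hi
  · exact h

/-- The complex form of `|B|`. -/
def absFieldC : Matrix (Fin d) (Fin d) ℂ := Matrix.of fun j k =>
  ∑ i, ((|fieldEigenvalue hB i| : ℝ) : ℂ) * fieldEigenvector hB i j * star (fieldEigenvector hB i) k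

/-- An eigenvector has coordinates only along basis vectors with the same eigenvalue. This
generality matters for the conjugates of the basis vectors: they are eigenvectors but need not
belong to the basis. -/
theorem absFieldC_mulVec {v : Fin d → ℂ} {t : ℝ}
    (hv : (B.map Complex.ofReal) *ᵥ v = (Complex.I * t) • v) :
    absFieldC hB *ᵥ v = ((|t| : ℝ) : ℂ) • v := by
  ext j
  have h1 : (absFieldC hB *ᵥ v) j
      = ∑ i, ((|fieldEigenvalue hB i| : ℝ) : ℂ) * fieldCoord hB v i * fieldEigenvector hB i j := by
    simp only [absFieldC, mulVec, dotProduct, of_apply, Finset.sum_mul, fieldCoord, Finset.mul_sum]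
    rw [Finset.sum_comm]
    exact Finset.sum_congr rfl fun i _ => Finset.sum_congr rfl fun k _ => by ring
  rw [h1, Pi.smul_apply, smul_eq_mul]
  conv_rhs => rw [← sum_fieldCoord hB v j, Finset.mul_sum]
  refine Finset.sum_congr rfl fun i _ => ?_
  by_cases hi : fieldEigenvalue hB i = t
  · rw [hi]; ring
  · rw [fieldCoord_eq_zero hB hv hi]; ring

/-- Since `B` is real, conjugation exchanges the eigenvalues `iβ` and `-iβ`, on which `|B|` takes
the same value; so `|B|` and its entrywise conjugate agree on the eigenbasis. -/
theorem star_absFieldC (j k : Fin d) : star (absFieldC hB j k) = absFieldC hB j k := by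
  have hw : ∀ i l, ∑ m, star (absFieldC hB l m) * fieldEigenvector hB i m
      = ∑ m, absFieldC hB l m * fieldEigenvector hB i m := by
    intro i l
    have h1 := congrFun (absFieldC_mulVec hB (mulVec_fieldEigenvector hB i)) l
    have h2 := congrFun (absFieldC_mulVec hB (v := star (fieldEigenvector hB i))
      (t := -fieldEigenvalue hB i) (by rw [mulVec_star_fieldEigenvector]; push_cast; ring_nf)) l
    simp only [mulVec, dotProduct, Pi.smul_apply, smul_eq_mul, Pi.star_apply] at h1 h2
    rw [h1]
    have h3 := congrArg star h2
    simp only [star_sum, star_mul', star_star] at h3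
    rw [h3]
    simp
  have h : ∀ F : Fin d → ℂ, F k = ∑ i, (∑ m, F m * fieldEigenvector hB i m)
      * star (fieldEigenvector hB i) k := by
    intro F
    simp only [Finset.sum_mul]
    rw [Finset.sum_comm]
    have : ∀ m, ∑ i, F m * fieldEigenvector hB i m * star (fieldEigenvector hB i) k
        = F m * if k = m then 1 else 0 := by
      intro m
      rw [← sum_star_fieldEigenvector_mul hB, Finset.mul_sum]
      exact Finset.sum_congr rfl fun i _ => by ring
    simp only [this, mul_ite, mul_one, mul_zero, Finset.sum_ite_eq, Finset.mem_univ, if_true]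
  rw [h fun m => star (absFieldC hB j m), h fun m => absFieldC hB j m]
  simp only [hw]

/-- The symmetric matrix `|B| = (Bᵀ B)^{1/2}`. -/
def absField : Matrix (Fin d) (Fin d) ℝ := Matrix.of fun j k => (absFieldC hB j k).re

theorem ofReal_absField (j k : Fin d) : (absField hB j k : ℂ) = absFieldC hB j k :=
  Complex.conj_eq_iff_re.1 (star_absFieldC hB j k)

theorem absField_symm (j k : Fin d) : absField hB j k = absField hB k j := by
  apply Complex.ofReal_injective
  rw [ofReal_absField, ofReal_absField, ← star_absFieldC]
  simp only [absFieldC, of_apply, star_sum, star_mul']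
  refine Finset.sum_congr rfl fun i _ => ?_
  simp
  ring

theorem absField_mulVec {v : Fin d → ℂ} {t : ℝ}
    (hv : (B.map Complex.ofReal) *ᵥ v = (Complex.I * t) • v) (j : Fin d) :
    ∑ k, (absField hB j k : ℂ) * v k = (|t| : ℝ) * v j := by
  have := congrFun (absFieldC_mulVec hB hv) j
  simp only [ofReal_absField]
  exact this

theorem absField_quadratic (x : Fin d → ℝ) :
    ∑ j, ∑ k, absField hB j k * x j * x k
      = ∑ i, |fieldEigenvalue hB i| * ‖fieldCoord hB (fun j => (x j : ℂ)) i‖ ^ 2 := by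
  apply Complex.ofReal_injective
  push_cast
  simp only [ofReal_absField, ← Complex.mul_conj', fieldCoord, map_sum, map_mul,
    Complex.conj_ofReal, Pi.star_apply, RCLike.star_def, Complex.conj_conj, absFieldC, of_apply,
    Finset.sum_mul, Finset.mul_sum]
  rw [Finset.sum_congr rfl fun j _ => Finset.sum_comm, Finset.sum_comm]
  refine Finset.sum_congr rfl fun i _ => ?_
  refine Finset.sum_congr rfl fun j _ => Finset.sum_congr rfl fun k _ => ?_
  ring

theorem sum_norm_fieldCoord_sq (x : Fin d → ℝ) :
    ∑ i, ‖fieldCoord hB (fun j => (x j : ℂ)) i‖ ^ 2 = ∑ j, x j ^ 2 := by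
  apply Complex.ofReal_injective
  push_cast
  have h1 : ∀ k, (x k : ℂ) ^ 2 = x k * ∑ i, fieldCoord hB (fun j => (x j : ℂ)) i
      * fieldEigenvector hB i k := by
    intro k
    rw [sum_fieldCoord hB fun j => (x j : ℂ), sq]
  simp only [h1, Finset.mul_sum]
  rw [Finset.sum_comm]
  refine Finset.sum_congr rfl fun i _ => ?_
  rw [← Complex.mul_conj']
  conv_lhs => rw [fieldCoord, map_sum, ← fieldCoord, Finset.mul_sum]
  refine Finset.sum_congr rfl fun j _ => ?_
  simp
  ring

theorem exists_absField_pos (hne : ∀ i, fieldEigenvalue hB i ≠ 0) :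
    ∃ γ : ℝ, 0 < γ ∧ ∀ x : Fin d → ℝ,
      γ * ∑ j, x j ^ 2 ≤ ∑ j, ∑ k, absField hB j k * x j * x k := by
  obtain ⟨γ, hγ, h⟩ : ∃ γ : ℝ, 0 < γ ∧ ∀ i, γ ≤ |fieldEigenvalue hB i| := by
    rcases isEmpty_or_nonempty (Fin d) with hd | hd
    -- In dimension zero there is no smallest `|β_i|`, and any positive constant serves.
    · exact ⟨1, one_pos, fun i => (hd.false i).elim⟩
    · obtain ⟨i, hi⟩ := Finite.exists_min fun i => |fieldEigenvalue hB i|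
      exact ⟨_, abs_pos.2 (hne i), hi⟩
  refine ⟨γ, hγ, fun x => ?_⟩
  rw [absField_quadratic, ← sum_norm_fieldCoord_sq hB, Finset.mul_sum]
  exact Finset.sum_le_sum fun i _ => by gcongr; exact h i

theorem fieldEigenvalue_ne_zero (hrank : B.rank = d) (i : Fin d) : fieldEigenvalue hB i ≠ 0 := by
  intro h0
  have h := mulVec_fieldEigenvector hB i
  rw [h0] at h
  have hdet : IsUnit (B.map Complex.ofReal) := by
    have h1 : IsUnit B := by
      rw [← Matrix.mulVec_injective_iff_isUnit]
      have h2 : Module.finrank ℝ (LinearMap.range B.mulVecLin) = d := hrank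
      have h3 : LinearMap.range B.mulVecLin = ⊤ :=
        Submodule.eq_top_of_finrank_eq (by rw [h2]; simp)
      exact LinearMap.injective_iff_surjective.2 (LinearMap.range_eq_top.1 h3)
    exact h1.map (RingHom.mapMatrix Complex.ofRealHom)
  have h2 := Matrix.mulVec_injective_iff_isUnit.2 hdet
  have h3 : fieldEigenvector hB i = 0 := h2 (by rw [h]; simp)
  have h4 := sum_star_fieldEigenvector_mul_self hB i i
  simp [h3] at h4

/-- Transposition negates `-iB` and preserves the characteristic polynomial, so the spectrum is
symmetric about zero. -/
theorem map_fieldEigenvalue_neg :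
    (Finset.univ.val.map fun i => -fieldEigenvalue hB i)
      = Finset.univ.val.map fun i => fieldEigenvalue hB i := by
  have hH := isHermitian_hermitianField hB
  have h1 := roots_charpoly_smul_of_isHermitian hH (-1)
  have h2 := roots_charpoly_smul_of_isHermitian hH 1
  have h3 : ((-1 : ℂ) • hermitianField B) = (hermitianField B)ᵀ := by
    ext j k
    have : B k j = - B j k := congrFun (congrFun hB j) k
    simp [hermitianField, this]
  rw [h3, charpoly_transpose] at h1
  rw [one_smul, h1] at h2
  apply Multiset.map_injective Complex.ofReal_injective
  simpa [Multiset.map_map, Function.comp_def, fieldEigenvalue] using h2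

theorem filter_neg_eq :
    ((Finset.univ.val.map fun i => fieldEigenvalue hB i).filter (· < 0))
      = ((Finset.univ.val.map fun i => fieldEigenvalue hB i).filter (0 < ·)).map Neg.neg := by
  conv_lhs => rw [← map_fieldEigenvalue_neg hB]
  rw [show (fun i => -fieldEigenvalue hB i) = Neg.neg ∘ fun i => fieldEigenvalue hB i from rfl,
    ← Multiset.map_map Neg.neg, Multiset.filter_map]
  congr 2
  ext x
  simp

theorem sum_neg_fieldEigenvalue :
    (∑ i, if 0 < fieldEigenvalue hB i then 0 else -fieldEigenvalue hB i)
      = ∑ i, if 0 < fieldEigenvalue hB i then fieldEigenvalue hB i else 0 := by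
  have h := congrArg (fun s => (s.map fun t : ℝ => if 0 < t then t else 0).sum)
    (map_fieldEigenvalue_neg hB)
  simp only [Multiset.map_map, Function.comp_def] at h
  refine Eq.trans (Finset.sum_congr rfl fun i _ => ?_) h
  rcases lt_trichotomy (fieldEigenvalue hB i) 0 with hi | hi | hi
  · simp [hi, hi.le]
  · simp [hi]
  · simp [hi, hi.le]

/-- The frequencies of a nondegenerate field are its positive `β_i`. -/
theorem exists_isFrequencies {n : ℕ} {B : Matrix (Fin (2 * n)) (Fin (2 * n)) ℝ} (hB : Bᵀ = -B)
    (hne : ∀ i, fieldEigenvalue hB i ≠ 0) :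
    ∃ e : Fin n ≃ {i // 0 < fieldEigenvalue hB i},
      IsFrequencies B fun j => fieldEigenvalue hB (e j) := by
  classical
  set β := fieldEigenvalue hB with hβ
  set s : Multiset ℝ := Finset.univ.val.map β with hs
  have hsplit : s = s.filter (0 < ·) + (s.filter (0 < ·)).map Neg.neg := by
    rw [hs, hβ, ← filter_neg_eq hB]
    conv_lhs => rw [← Multiset.filter_add_not (fun x : ℝ => 0 < x) (Finset.univ.val.map _)]
    congr 1
    refine Multiset.filter_congr fun x hx => ?_
    obtain ⟨i, -, rfl⟩ := Multiset.mem_map.1 hx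
    exact ⟨fun h => lt_of_le_of_ne (not_lt.1 h) (hne i), fun h => not_lt.2 h.le⟩
  -- The `2n` eigenvalues split into the positive ones and their negatives, so exactly `n` are
  -- positive.
  have hcard : Fintype.card {i // 0 < β i} = n := by
    have h1 := congrArg Multiset.card hsplit
    rw [Multiset.card_add, Multiset.card_map (f := Neg.neg)] at h1
    have h2 : Multiset.card (s.filter (0 < ·)) = Fintype.card {i // 0 < β i} := by
      rw [hs, Multiset.filter_map, Multiset.card_map, Fintype.card_subtype]
      rfl
    have h3 : Multiset.card s = 2 * n := by simp [hs]
    omega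
  let e : Fin n ≃ {i // 0 < β i} := (Fintype.equivFinOfCardEq hcard).symm
  refine ⟨e, fun j => (e j).2, ?_⟩
  have h1 : (B.map (algebraMap ℝ ℂ)) = Complex.I • hermitianField B := by
    ext j k
    simp only [hermitianField, Matrix.map_apply, Matrix.smul_apply, smul_eq_mul,
      Complex.coe_algebraMap]
    linear_combination (B j k : ℂ) * Complex.I_mul_I
  rw [h1, roots_charpoly_smul_of_isHermitian (isHermitian_hermitianField hB)]
  have h2 : s.filter (0 < ·) = Finset.univ.val.map fun j => β (e j) := by
    have h3 : (Finset.univ.val.map fun j : Fin n => β (e j))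
        = (Finset.univ.val.map e).map fun i : {i // 0 < β i} => β i := by
      rw [Multiset.map_map]; rfl
    rw [h3, hs, Multiset.filter_map]
    have h4 : Finset.univ.val.map e = (Finset.univ : Finset {i // 0 < β i}).val := by
      simp
    rw [h4]
    have h5 : (Finset.univ : Finset {i // 0 < β i}).val.map
        (fun i : {i // 0 < β i} => (i : Fin (2 * n)))
        = (Finset.univ.filter fun i => 0 < β i).val := by
      have := congrArg Finset.val (Finset.subtype_map (s := Finset.univ) (fun i => 0 < β i))
      simpa using this
    have h6 : ((Finset.univ : Finset {i // 0 < β i}).val.map fun i : {i // 0 < β i} => β i)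
        = ((Finset.univ : Finset {i // 0 < β i}).val.map
          fun i : {i // 0 < β i} => (i : Fin (2 * n))).map β := by
      rw [Multiset.map_map]; rfl
    rw [h6, h5]
    rfl
  have h7 := congrArg (fun t => t.map fun r : ℝ => Complex.I * (r : ℂ)) hsplit
  rw [h2] at h7
  simp only [hs, Multiset.map_add, Multiset.map_map, Function.comp_def] at h7
  rw [show (fun i => Complex.I * ((isHermitian_hermitianField hB).eigenvalues i : ℂ))
    = fun i => Complex.I * (β i : ℂ) from rfl, h7]
  simp

theorem transpose_magneticField (A : Fin d → EuclideanSpace ℝ (Fin d) → ℝ)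
    (x : EuclideanSpace ℝ (Fin d)) : (magneticField A x)ᵀ = -magneticField A x := by
  ext j k
  simp [magneticField]

end HermitianField


/-! ### The Landau operator on polynomials -/

section PolynomialMomentum

open MvPolynomial

variable {d : ℕ}

/-- The linear form `∑_k C_{jk} X_k`. -/
def linearForm (C : Matrix (Fin d) (Fin d) ℂ) (j : Fin d) : MvPolynomial (Fin d) ℂ :=
  ∑ k, C j k • X k

/-- The operator `-i ∂_j + ∑_k C_{jk} x_k` on polynomials. -/
def polyMomentum (C : Matrix (Fin d) (Fin d) ℂ) (j : Fin d) :
    Module.End ℂ (MvPolynomial (Fin d) ℂ) :=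
  (-Complex.I) • (pderiv j).toLinearMap + LinearMap.mulLeft ℂ (linearForm C j)

theorem polyMomentum_apply (C : Matrix (Fin d) (Fin d) ℂ) (j : Fin d) (p : MvPolynomial (Fin d) ℂ) :
    polyMomentum C j p = (-Complex.I) • pderiv j p + linearForm C j * p := rfl

theorem pderiv_linearForm (C : Matrix (Fin d) (Fin d) ℂ) (j k : Fin d) :
    pderiv j (linearForm C k) = MvPolynomial.C (C k j) := by
  simp only [linearForm, map_sum, Derivation.map_smul, pderiv_X, Pi.single_apply, smul_ite,
    smul_zero, Finset.sum_ite_eq', Finset.mem_univ, if_true]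
  simp [MvPolynomial.smul_eq_C_mul]

theorem pderiv_comm (j k : Fin d) (p : MvPolynomial (Fin d) ℂ) :
    pderiv j (pderiv k p) = pderiv k (pderiv j p) := by
  have h : ⁅(pderiv j : Derivation ℂ (MvPolynomial (Fin d) ℂ) (MvPolynomial (Fin d) ℂ)),
      (pderiv k : Derivation ℂ (MvPolynomial (Fin d) ℂ) (MvPolynomial (Fin d) ℂ))⁆ = 0 := by
    refine MvPolynomial.derivation_ext fun i => ?_
    rw [Derivation.commutator_apply]
    simp only [pderiv_X, Derivation.coe_zero, Pi.zero_apply]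
    by_cases h1 : k = i <;> by_cases h2 : j = i <;> simp [h1, h2]
  have h2 := congrArg (fun D : Derivation ℂ (MvPolynomial (Fin d) ℂ) (MvPolynomial (Fin d) ℂ) =>
    D p) h
  simp only [Derivation.commutator_apply, Derivation.coe_zero, Pi.zero_apply] at h2
  exact sub_eq_zero.1 h2

theorem polyMomentum_comm (C : Matrix (Fin d) (Fin d) ℂ) (j k : Fin d) :
    polyMomentum C j * polyMomentum C k
      = polyMomentum C k * polyMomentum C j + (Complex.I * (C j k - C k j)) • 1 := by
  refine LinearMap.ext fun p => ?_
  simp only [Module.End.mul_apply, LinearMap.add_apply, LinearMap.smul_apply, Module.End.one_apply,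
    polyMomentum_apply, map_add, Derivation.leibniz, pderiv_linearForm,
    pderiv_comm j k, smul_eq_mul, pderiv_C, MvPolynomial.smul_eq_C_mul, map_sub, map_mul, map_neg]
  ring

theorem totalDegree_pderiv_le {m : ℕ} {p : MvPolynomial (Fin d) ℂ} (hp : p.totalDegree ≤ m + 1)
    (i : Fin d) : (pderiv i p).totalDegree ≤ m := by
  rw [totalDegree, Finset.sup_le_iff]
  intro s hs
  have h1 : s + Finsupp.single i 1 ∈ p.support := by
    rw [MvPolynomial.mem_support_iff] at hs ⊢
    rw [coeff_pderiv] at hs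
    exact left_ne_zero_of_mul hs
  have h2 := (le_totalDegree h1).trans hp
  rw [Finsupp.sum_add_index' (by simp) (by simp)] at h2
  simpa using h2

theorem linearForm_totalDegree (C : Matrix (Fin d) (Fin d) ℂ) (j : Fin d) :
    (linearForm C j).totalDegree ≤ 1 := by
  refine totalDegree_finsetSum_le fun k _ => ?_
  exact (totalDegree_smul_le _ _).trans (totalDegree_X k).le

/-- When `v` annihilates `C` from the left, the multiplication parts cancel and a
constant-coefficient derivative remains; such an operator lowers the degree. -/
theorem ladder_polyMomentum {C : Matrix (Fin d) (Fin d) ℂ} {v : Fin d → ℂ}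
    (hv : ∀ k, ∑ j, v j * C j k = 0) (p : MvPolynomial (Fin d) ℂ) :
    ladder (polyMomentum C) v p = ∑ j, (-Complex.I * v j) • pderiv j p := by
  have h1 : ∑ j, v j • linearForm C j = 0 := by
    simp only [linearForm, Finset.smul_sum, smul_smul]
    rw [Finset.sum_comm]
    simp only [← Finset.sum_smul, hv, zero_smul, Finset.sum_const_zero]
  have h2 : ∑ j, v j • (linearForm C j * p) = 0 := by
    simp only [← smul_mul_assoc, ← Finset.sum_mul, h1, zero_mul]
  simp only [ladder, LinearMap.sum_apply, LinearMap.smul_apply, polyMomentum_apply, smul_add,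
    Finset.sum_add_distrib, h2, add_zero, smul_smul]
  exact Finset.sum_congr rfl fun j _ => by ring_nf

theorem ladder_polyMomentum_lowers {C : Matrix (Fin d) (Fin d) ℂ} {v : Fin d → ℂ}
    (hv : ∀ k, ∑ j, v j * C j k = 0) :
    (∀ p ∈ restrictTotalDegree (Fin d) ℂ 0, ladder (polyMomentum C) v p = 0) ∧
    ∀ m, ∀ p ∈ restrictTotalDegree (Fin d) ℂ (m + 1),
      ladder (polyMomentum C) v p ∈ restrictTotalDegree (Fin d) ℂ m := by
  constructor
  · intro p hp
    rw [mem_restrictTotalDegree, Nat.le_zero, totalDegree_eq_zero_iff_eq_C] at hp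
    rw [ladder_polyMomentum hv, hp]
    simp
  · intro m p hp
    rw [mem_restrictTotalDegree] at hp
    rw [ladder_polyMomentum hv]
    refine Submodule.sum_mem _ fun j _ => Submodule.smul_mem _ _ ?_
    rw [mem_restrictTotalDegree]
    exact totalDegree_pderiv_le hp j

variable {B : Matrix (Fin d) (Fin d) ℝ} (hB : B.transpose = -B)

/-- The matrix `(i |B| + B) / 2`. -/
def landauMatrix : Matrix (Fin d) (Fin d) ℂ := Matrix.of fun j k =>
  (1 / 2) * (Complex.I * absField hB j k + B j k)

/-- From `|B| v = t v` and `Bᵀ v = -i t v` the two halves of the matrix contribute `it v` and `-it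
v`. For negative `t` they would add up instead, so it is the eigenvectors with `t > 0` that give
annihilation operators. -/
theorem landauMatrix_annihilates {v : Fin d → ℂ} {t : ℝ} (ht : 0 < t)
    (hv : (B.map Complex.ofReal).mulVec v = (Complex.I * t) • v) (k : Fin d) :
    ∑ j, v j * landauMatrix hB j k = 0 := by
  have h1 := absField_mulVec hB hv k
  have h2 := congrFun hv k
  simp only [Matrix.mulVec, dotProduct, Matrix.map_apply, Pi.smul_apply, smul_eq_mul] at h2
  rw [abs_of_pos ht] at h1
  have h3 : ∑ j, v j * landauMatrix hB j k
      = (1 / 2) * (Complex.I * ∑ j, (absField hB k j : ℂ) * v j - ∑ j, (B k j : ℂ) * v j) := by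
    rw [Finset.mul_sum, ← Finset.sum_sub_distrib, Finset.mul_sum]
    refine Finset.sum_congr rfl fun j _ => ?_
    have h4 : B j k = - B k j := congrFun (congrFun hB k) j
    rw [landauMatrix, Matrix.of_apply, absField_symm, h4]
    push_cast
    ring
  rw [h3, h1, h2]
  ring

theorem ladderSystem_polyMomentum (hne : ∀ i, fieldEigenvalue hB i ≠ 0) :
    LadderSystem (polyMomentum (landauMatrix hB)) (B.map Complex.ofReal) (fieldEigenvalue hB)
      (fun i => star (fieldEigenvector hB i)) (fieldEigenvector hB)
      (restrictTotalDegree (Fin d) ℂ) where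
  comm j k := by
    rw [polyMomentum_comm]
    congr 3
    have h4 : B k j = - B j k := congrFun (congrFun hB j) k
    rw [landauMatrix, Matrix.of_apply, Matrix.of_apply, absField_symm hB k j, h4, Matrix.map_apply]
    push_cast
    ring
  complete := sum_star_fieldEigenvector_mul hB
  ne_zero := hne
  eigen := mulVec_fieldEigenvector hB
  normalized i := by rw [sum_star_fieldEigenvector_mul_self, if_pos rfl]
  raise j m p hp := by
    rw [mem_restrictTotalDegree] at hp
    rw [polyMomentum_apply]
    refine Submodule.add_mem _ (Submodule.smul_mem _ _ ?_) ?_ <;> rw [mem_restrictTotalDegree]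
    · exact (totalDegree_pderiv_le (hp.trans (Nat.le_succ m)) j).trans (Nat.le_succ m)
    · refine (totalDegree_mul _ _).trans ?_
      have := linearForm_totalDegree (landauMatrix hB) j
      omega
  lower_pos i hi := ladder_polyMomentum_lowers
    (landauMatrix_annihilates hB hi (mulVec_fieldEigenvector hB i))
  lower_neg i hi := ladder_polyMomentum_lowers
    (landauMatrix_annihilates hB (neg_pos.2 hi) (by
      rw [mulVec_star_fieldEigenvector]; push_cast; ring_nf))

theorem eigenvalue_kinetic_polyMomentum (hne : ∀ i, fieldEigenvalue hB i ≠ 0)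
    {p : MvPolynomial (Fin d) ℂ} (hp : p ≠ 0) {ν : ℝ}
    (hν : kinetic (polyMomentum (landauMatrix hB)) p = (ν : ℂ) • p) :
    ∃ k : Fin d → ℕ, ν = ∑ i, if 0 < fieldEigenvalue hB i
      then (2 * (k i : ℝ) + 1) * fieldEigenvalue hB i else 0 := by
  obtain ⟨k, hk⟩ := (ladderSystem_polyMomentum hB hne).eigenvalue_kinetic (by
    -- The conjugate of an eigenvector with `β_i < 0` has eigenvalue parameter `-β_i > 0`, so it is
    -- a combination of the basis vectors whose ladder operators are assumed to kill `p`.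
    intro i hi p hp
    have h1 : ∀ j, star (fieldEigenvector hB i) j = ∑ l, fieldCoord hB
        (star (fieldEigenvector hB i)) l * fieldEigenvector hB l j :=
      fun j => (sum_fieldCoord hB _ j).symm
    have h2 : ladder (polyMomentum (landauMatrix hB)) (star (fieldEigenvector hB i))
        = ∑ l, fieldCoord hB (star (fieldEigenvector hB i)) l
          • ladder (polyMomentum (landauMatrix hB)) (fieldEigenvector hB l) := by
      simp only [ladder, Finset.smul_sum, smul_smul]
      rw [Finset.sum_comm]
      refine Finset.sum_congr rfl fun j _ => ?_
      rw [← Finset.sum_smul, ← h1]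
    rw [h2, LinearMap.sum_apply]
    refine Finset.sum_eq_zero fun l _ => ?_
    rw [LinearMap.smul_apply]
    by_cases hl : fieldEigenvalue hB l = -fieldEigenvalue hB i
    · rw [hp l (by linarith), smul_zero]
    · rw [fieldCoord_eq_zero hB (t := -fieldEigenvalue hB i)
        (by rw [mulVec_star_fieldEigenvector]; push_cast; ring_nf) hl, zero_smul])
    p.totalDegree p ((mem_restrictTotalDegree _ _ _).2 le_rfl) hp ν hν
  refine ⟨k, ?_⟩
  -- The zero-point energy was collected over the negative `β_i`; by symmetry of the spectrum it is
  -- the sum of the positive ones, which supplies the `+ 1` in `2 k + 1`.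
  rw [hk, sum_neg_fieldEigenvalue, ← Finset.sum_add_distrib]
  refine Finset.sum_congr rfl fun i _ => ?_
  split_ifs <;> ring

/-- The Landau levels of the constant field `B` on `ℝ^{2n}`. -/
theorem eigenvalue_mem_landauLevels {n : ℕ} {B : Matrix (Fin (2 * n)) (Fin (2 * n)) ℝ}
    (hB : B.transpose = -B) (hne : ∀ i, fieldEigenvalue hB i ≠ 0)
    {p : MvPolynomial (Fin (2 * n)) ℂ} (hp : p ≠ 0) {ν : ℝ}
    (hν : kinetic (polyMomentum (landauMatrix hB)) p = (ν : ℂ) • p) :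
    ∃ a : Fin n → ℝ, IsFrequencies B a ∧ ∃ k : Fin n → ℕ, ν = ∑ j, (2 * (k j : ℝ) + 1) * a j := by
  obtain ⟨k, hk⟩ := eigenvalue_kinetic_polyMomentum hB hne hp hν
  obtain ⟨e, he⟩ := exists_isFrequencies hB hne
  refine ⟨_, he, fun j => k (e j), ?_⟩
  rw [hk, ← Finset.sum_filter, ← Finset.sum_subtype_eq_sum_filter, Finset.subtype_univ]
  exact (e.sum_comp fun i => (2 * (k i : ℝ) + 1) * fieldEigenvalue hB i).symm

end PolynomialMomentum


/-! ### Determinacy by moments under exponential decay -/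

section FourierMoments

open MeasureTheory FourierTransform

variable {d : ℕ}

/-- Every test function is the Fourier transform of a Schwartz function, and the transform can be
moved onto `f` in the pairing. -/
theorem ae_eq_zero_of_fourier_eq_zero {f : EuclideanSpace ℝ (Fin d) → ℂ} (hf : Integrable f)
    (h : ∀ ξ, 𝓕 f ξ = 0) : f =ᵐ[volume] 0 := by
  refine ae_eq_zero_of_integral_contDiff_smul_eq_zero hf.locallyIntegrable ?_
  intro g g_smooth g_cpt
  have hg₁ : HasCompactSupport (Complex.ofRealCLM ∘ g) := g_cpt.comp_left rfl
  have hg₂ : ContDiff ℝ ∞ (Complex.ofRealCLM ∘ g) := by fun_prop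
  set φ : SchwartzMap (EuclideanSpace ℝ (Fin d)) ℂ := hg₁.toSchwartzMap hg₂ with hφ
  have hφg : ∀ x, φ x = (g x : ℂ) := fun x => by simp [hφ]
  set ψ : SchwartzMap (EuclideanSpace ℝ (Fin d)) ℂ := 𝓕⁻ φ
  have h1 : ∀ x, 𝓕 (ψ : EuclideanSpace ℝ (Fin d) → ℂ) x = φ x := by
    intro x
    rw [← SchwartzMap.fourier_coe, FourierTransform.fourier_fourierInv_eq]
  have h2 := VectorFourier.integral_fourierIntegral_smul_eq_flip
    (L := innerₗ (EuclideanSpace ℝ (Fin d))) (μ := volume) (ν := volume)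
    (f := (ψ : EuclideanSpace ℝ (Fin d) → ℂ)) (g := f)
    Real.continuous_fourierChar continuous_inner ψ.integrable hf
  have h3 : ∀ x, VectorFourier.fourierIntegral Real.fourierChar volume
      (innerₗ (EuclideanSpace ℝ (Fin d))) (ψ : EuclideanSpace ℝ (Fin d) → ℂ) x = φ x := h1
  have h4 : ∀ x, VectorFourier.fourierIntegral Real.fourierChar volume
      (innerₗ (EuclideanSpace ℝ (Fin d))).flip f x = 0 := by
    intro x
    rw [flip_innerₗ]
    exact h x
  simp only [h3, h4, smul_zero, integral_zero] at h2
  rw [← h2]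
  refine integral_congr_ae (Filter.Eventually.of_forall fun x => ?_)
  simp [hφg]

/-- Expand the character in its power series and integrate term by term. The exponential moments of
`f` provide the dominating function, and every term is a vanishing moment. -/
theorem ae_eq_zero_of_moments_eq_zero {f : EuclideanSpace ℝ (Fin d) → ℂ}
    (hf : ∀ t : ℝ, Integrable fun x => Real.exp (t * ‖x‖) * ‖f x‖)
    (hfm : AEStronglyMeasurable f volume)
    (h : ∀ ξ : EuclideanSpace ℝ (Fin d), ∀ k : ℕ, ∫ x, (inner ℝ x ξ : ℂ) ^ k * f x = 0) :
    f =ᵐ[volume] 0 := by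
  have hfi : Integrable f := by
    have := hf 0
    simp only [zero_mul, Real.exp_zero, one_mul] at this
    exact (integrable_norm_iff hfm).1 this
  refine ae_eq_zero_of_fourier_eq_zero hfi fun ξ => ?_
  rw [Real.fourier_eq]
  set c : ℂ := -(2 * Real.pi * Complex.I)
  have hsum : HasSum (fun k : ℕ => ∫ x, (c ^ k / k.factorial) * ((inner ℝ x ξ : ℂ) ^ k * f x))
      (∫ x, Complex.exp (c * inner ℝ x ξ) * f x) := by
    refine hasSum_integral_of_dominated_convergence
      (fun k x => (‖c‖ * ‖ξ‖ * ‖x‖) ^ k / k.factorial * ‖f x‖) (fun k => ?_) (fun k => ?_) ?_ ?_ ?_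
    · have : Continuous fun x : EuclideanSpace ℝ (Fin d) =>
          (c ^ k / k.factorial) * (inner ℝ x ξ : ℂ) ^ k := by fun_prop
      have := this.aestronglyMeasurable (μ := volume) |>.mul hfm
      refine this.congr (Filter.Eventually.of_forall fun x => ?_)
      simp only [Pi.mul_apply]
      ring
    · refine Filter.Eventually.of_forall fun x => ?_
      have h1 : |inner ℝ x ξ| ≤ ‖ξ‖ * ‖x‖ := by
        rw [mul_comm]; exact abs_real_inner_le_norm x ξ
      rw [← mul_assoc, norm_mul]
      refine mul_le_mul_of_nonneg_right ?_ (norm_nonneg _)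
      rw [norm_mul, norm_div, norm_pow, norm_pow, Complex.norm_real, Real.norm_eq_abs, mul_assoc,
        mul_pow, div_mul_eq_mul_div]
      have h2 : ‖(k.factorial : ℂ)‖ = k.factorial := by simp
      rw [h2]
      gcongr
    · exact Filter.Eventually.of_forall fun x =>
        (Real.summable_pow_div_factorial _).mul_right _
    · refine (hf (‖c‖ * ‖ξ‖)).congr (Filter.Eventually.of_forall fun x => ?_)
      simp only
      rw [tsum_mul_right, Real.exp_eq_exp_ℝ, NormedSpace.exp_eq_tsum_div]
    · refine Filter.Eventually.of_forall fun x => ?_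
      have := (NormedSpace.expSeries_div_hasSum_exp (c * (inner ℝ x ξ : ℂ))).mul_right (f x)
      rw [← Complex.exp_eq_exp_ℂ] at this
      refine this.congr_fun fun k => ?_
      rw [mul_pow]
      ring
  have h0 : (fun k : ℕ => ∫ x, (c ^ k / k.factorial) * ((inner ℝ x ξ : ℂ) ^ k * f x))
      = fun _ => 0 := by
    ext k
    rw [integral_const_mul, h, mul_zero]
  rw [h0] at hsum
  rw [← hsum.unique hasSum_zero]
  refine integral_congr_ae (Filter.Eventually.of_forall fun x => ?_)
  simp only [Circle.smul_def, Real.fourierChar_apply, smul_eq_mul, c]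
  congr 2
  push_cast
  ring

end FourierMoments

/-! ### Density of polynomials times a Gaussian in L² -/

section PolynomialGaussian

open MeasureTheory MvPolynomial

variable {d : ℕ}

/-- Completing the square bounds the exponent by `t² / (2a) - (a / 2) ‖x‖²`. -/
theorem integrable_exp_norm_sub_sq {a : ℝ} (ha : 0 < a) (t : ℝ) :
    Integrable fun x : EuclideanSpace ℝ (Fin d) => Real.exp (t * ‖x‖ - a * ‖x‖ ^ 2) := by
  have h1 := (GaussianFourier.integrable_cexp_neg_mul_sq_norm_add (V := EuclideanSpace ℝ (Fin d))
    (b := ((a / 2 : ℝ) : ℂ)) (by simpa using ha) 0 0).norm.const_mul (Real.exp (t ^ 2 / (2 * a)))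
  refine h1.mono' (by fun_prop) (Filter.Eventually.of_forall fun x => ?_)
  rw [Real.norm_eq_abs, Real.abs_exp, Complex.norm_exp, ← Real.exp_add]
  refine Real.exp_le_exp.2 ?_
  have h2 : ((-((a / 2 : ℝ) : ℂ) * (‖x‖ : ℂ) ^ 2
      + 0 * ((inner ℝ (0 : EuclideanSpace ℝ (Fin d)) x : ℝ) : ℂ))).re = -(a / 2) * ‖x‖ ^ 2 := by
    rw [zero_mul, add_zero, ← Complex.ofReal_neg, ← Complex.ofReal_pow, ← Complex.ofReal_mul,
      Complex.ofReal_re]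
  rw [h2]
  have h3 : t ^ 2 / (2 * a) + -(a / 2) * ‖x‖ ^ 2 - (t * ‖x‖ - a * ‖x‖ ^ 2)
      = (t - a * ‖x‖) ^ 2 / (2 * a) := by field_simp; ring
  have h4 : 0 ≤ (t - a * ‖x‖) ^ 2 / (2 * a) := by positivity
  linarith

/-- The value of a complex polynomial at a real point. -/
def evalReal (p : MvPolynomial (Fin d) ℂ) (x : EuclideanSpace ℝ (Fin d)) : ℂ :=
  eval (fun j => (x j : ℂ)) p

theorem hasFDerivAt_evalReal (p : MvPolynomial (Fin d) ℂ) (x : EuclideanSpace ℝ (Fin d)) :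
    HasFDerivAt (evalReal p)
      (∑ j, (evalReal (pderiv j p) x) • (Complex.ofRealCLM.comp (EuclideanSpace.proj (𝕜 := ℝ) j)))
      x := by
  induction p using MvPolynomial.induction_on with
  | C a =>
    have : evalReal (MvPolynomial.C a : MvPolynomial (Fin d) ℂ) = fun _ => a := by
      ext x; simp [evalReal]
    rw [this]
    refine (hasFDerivAt_const a x).congr_fderiv ?_
    ext v
    simp [evalReal]
  | add p q hp hq =>
    have : evalReal (p + q) = evalReal p + evalReal q := by ext x; simp [evalReal]
    rw [this]
    refine (hp.add hq).congr_fderiv ?_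
    rw [← Finset.sum_add_distrib]
    refine Finset.sum_congr rfl fun j _ => ?_
    rw [← add_smul]
    simp [evalReal]
  | mul_X p i hp =>
    have : evalReal (p * X i) = fun x => evalReal p x * (x i : ℂ) := by ext x; simp [evalReal]
    rw [this]
    have h2 : HasFDerivAt (fun x : EuclideanSpace ℝ (Fin d) => (x i : ℂ))
        (Complex.ofRealCLM.comp (EuclideanSpace.proj (𝕜 := ℝ) i)) x :=
      (Complex.ofRealCLM.comp (EuclideanSpace.proj (𝕜 := ℝ) i)).hasFDerivAt
    refine (hp.mul h2).congr_fderiv ?_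
    ext v
    simp only [evalReal, Derivation.leibniz, pderiv_X, Pi.single_apply, smul_eq_mul, map_add,
      map_mul, eval_X, mul_ite, mul_one, mul_zero, apply_ite (eval _), map_zero]
    simp [Finset.mul_sum, mul_assoc, add_mul, Finset.sum_add_distrib]

theorem continuous_evalReal (p : MvPolynomial (Fin d) ℂ) : Continuous (evalReal p) :=
  continuous_iff_continuousAt.2 fun x => (hasFDerivAt_evalReal p x).continuousAt

/-- The rate `t` is quantified inside the induction: multiplication by a coordinate spends half of
the exponent on the polynomial already treated and half on the new factor. -/
theorem exists_evalReal_le (p : MvPolynomial (Fin d) ℂ) :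
    ∀ t : ℝ, 0 < t → ∃ M : ℝ, 0 ≤ M ∧ ∀ x, ‖evalReal p x‖ ≤ M * Real.exp (t * ‖x‖) := by
  induction p using MvPolynomial.induction_on with
  | C a =>
    intro t ht
    refine ⟨‖a‖, norm_nonneg _, fun x => ?_⟩
    simp only [evalReal, eval_C]
    refine le_mul_of_one_le_right (norm_nonneg _) (Real.one_le_exp (by positivity))
  | add p q hp hq =>
    intro t ht
    obtain ⟨M, hM, h1⟩ := hp t ht
    obtain ⟨M', hM', h2⟩ := hq t ht
    refine ⟨M + M', by positivity, fun x => ?_⟩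
    simp only [evalReal, map_add] at h1 h2 ⊢
    refine (norm_add_le _ _).trans ?_
    rw [add_mul]
    exact add_le_add (h1 x) (h2 x)
  | mul_X p i hp =>
    intro t ht
    obtain ⟨M, hM, h1⟩ := hp (t / 2) (by positivity)
    refine ⟨M * (2 / t), by positivity, fun x => ?_⟩
    simp only [evalReal, map_mul, eval_X] at h1 ⊢
    rw [norm_mul]
    have h2 : ‖(x i : ℂ)‖ ≤ ‖x‖ := by
      rw [Complex.norm_real]; exact PiLp.norm_apply_le x i
    have h3 : ‖x‖ ≤ 2 / t * Real.exp (t / 2 * ‖x‖) := by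
      have := Real.add_one_le_exp (t / 2 * ‖x‖)
      calc ‖x‖ = 2 / t * (t / 2 * ‖x‖) := by field_simp
        _ ≤ _ := by gcongr; linarith
    calc _ ≤ (M * Real.exp (t / 2 * ‖x‖)) * (2 / t * Real.exp (t / 2 * ‖x‖)) := by
          gcongr
          · exact h1 x
          · exact h2.trans h3
      _ = M * (2 / t) * (Real.exp (t / 2 * ‖x‖) * Real.exp (t / 2 * ‖x‖)) := by ring
      _ = _ := by rw [← Real.exp_add]; ring_nf

/-- The Gaussian `exp (-⟨Q x, x⟩ / 4)`. -/
def gaussian (Q : Matrix (Fin d) (Fin d) ℝ) (x : EuclideanSpace ℝ (Fin d)) : ℝ :=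
  Real.exp (-(1 / 4) * ∑ j, ∑ k, Q j k * x j * x k)

/-- A polynomial times a Gaussian. -/
def polyGauss (Q : Matrix (Fin d) (Fin d) ℝ) (p : MvPolynomial (Fin d) ℂ)
    (x : EuclideanSpace ℝ (Fin d)) : ℂ := gaussian Q x * evalReal p x

variable {Q : Matrix (Fin d) (Fin d) ℝ}

theorem gaussian_pos (x : EuclideanSpace ℝ (Fin d)) : 0 < gaussian Q x := Real.exp_pos _

theorem continuous_gaussian : Continuous (gaussian Q) := by
  unfold gaussian; fun_prop

theorem continuous_polyGauss (p : MvPolynomial (Fin d) ℂ) : Continuous (polyGauss Q p) :=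
  (Complex.continuous_ofReal.comp continuous_gaussian).mul (continuous_evalReal p)

theorem gaussian_le {γ : ℝ}
    (hQ : ∀ x : Fin d → ℝ, γ * ∑ j, x j ^ 2 ≤ ∑ j, ∑ k, Q j k * x j * x k)
    (x : EuclideanSpace ℝ (Fin d)) : gaussian Q x ≤ Real.exp (-(γ / 4) * ‖x‖ ^ 2) := by
  refine Real.exp_le_exp.2 ?_
  rw [EuclideanSpace.real_norm_sq_eq]
  have := hQ x
  linarith

theorem memLp_polyGauss {γ : ℝ} (hγ : 0 < γ)
    (hQ : ∀ x : Fin d → ℝ, γ * ∑ j, x j ^ 2 ≤ ∑ j, ∑ k, Q j k * x j * x k)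
    (p : MvPolynomial (Fin d) ℂ) : MemLp (polyGauss Q p) 2 volume := by
  rw [memLp_two_iff_integrable_sq_norm (continuous_polyGauss p).aestronglyMeasurable]
  obtain ⟨M, hM, h⟩ := exists_evalReal_le p 1 one_pos
  refine ((integrable_exp_norm_sub_sq (d := d) (half_pos hγ) 2).const_mul (M ^ 2)).mono'
    ((continuous_polyGauss p).norm.pow 2).aestronglyMeasurable
    (Filter.Eventually.of_forall fun x => ?_)
  have h1 : ‖polyGauss Q p x‖ ≤ Real.exp (-(γ / 4) * ‖x‖ ^ 2) * (M * Real.exp (1 * ‖x‖)) := by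
    rw [polyGauss, norm_mul, Complex.norm_real, Real.norm_eq_abs, abs_of_pos (gaussian_pos x)]
    exact mul_le_mul (gaussian_le hQ x) (h x) (norm_nonneg _) (Real.exp_pos _).le
  rw [Real.norm_eq_abs, abs_of_nonneg (by positivity)]
  calc _ ≤ (Real.exp (-(γ / 4) * ‖x‖ ^ 2) * (M * Real.exp (1 * ‖x‖))) ^ 2 := by gcongr
    _ = M ^ 2 * (Real.exp (-(γ / 4) * ‖x‖ ^ 2) * Real.exp (1 * ‖x‖)) ^ 2 := by ring
    _ = _ := by
      rw [← Real.exp_add, ← Real.exp_nat_mul]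
      congr 2
      push_cast
      ring

theorem evalReal_injective {p : MvPolynomial (Fin d) ℂ}
    (h : ∀ x : EuclideanSpace ℝ (Fin d), evalReal p x = 0) : p = 0 := by
  refine MvPolynomial.funext_set (s := fun _ => Set.range Complex.ofReal)
    (fun _ => Set.infinite_range_of_injective Complex.ofReal_injective) ?_
  intro x hx
  choose y hy using fun j => hx j (Set.mem_univ j)
  have := h (WithLp.toLp 2 y)
  rw [map_zero, ← this, evalReal]
  simp only [hy]

/-- `p ↦ p G` as a linear map to `L²`. -/
def polyGaussLp {γ : ℝ} (hγ : 0 < γ)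
    (hQ : ∀ x : Fin d → ℝ, γ * ∑ j, x j ^ 2 ≤ ∑ j, ∑ k, Q j k * x j * x k) :
    MvPolynomial (Fin d) ℂ →ₗ[ℂ] Lp ℂ 2 (volume : Measure (EuclideanSpace ℝ (Fin d))) where
  toFun p := (memLp_polyGauss hγ hQ p).toLp
  map_add' p q := by
    rw [← MemLp.toLp_add]
    congr 1
    ext x
    simp [polyGauss, evalReal, mul_add]
  map_smul' c p := by
    rw [RingHom.id_apply, ← MemLp.toLp_const_smul]
    congr 1
    ext x
    simp [polyGauss, evalReal, mul_left_comm, MvPolynomial.smul_eval]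

variable {γ : ℝ} (hγ : 0 < γ)
    (hQ : ∀ x : Fin d → ℝ, γ * ∑ j, x j ^ 2 ≤ ∑ j, ∑ k, Q j k * x j * x k)

theorem coeFn_polyGaussLp (p : MvPolynomial (Fin d) ℂ) :
    polyGaussLp hγ hQ p =ᵐ[volume] polyGauss Q p :=
  MemLp.coeFn_toLp (memLp_polyGauss hγ hQ p)

theorem injective_polyGaussLp : Function.Injective (polyGaussLp hγ hQ) := by
  rw [← LinearMap.ker_eq_bot, LinearMap.ker_eq_bot']
  intro p hp
  have h1 : polyGauss Q p =ᵐ[volume] fun _ => 0 := by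
    have h2 := coeFn_polyGaussLp hγ hQ p
    rw [hp] at h2
    exact h2.symm.trans (Lp.coeFn_zero ..)
  have h2 := (continuous_polyGauss (Q := Q) p).ae_eq_iff_eq volume continuous_const |>.1 h1
  refine evalReal_injective fun x => ?_
  have h3 := congrFun h2 x
  simpa [polyGauss, (gaussian_pos x).ne'] using h3

/-- If `f` is orthogonal to the range, testing with powers of `⟨x, ξ⟩` shows that all moments of the
Gaussian times `f` vanish. That product has exponential moments of every rate, by Cauchy–Schwarz, so
it is zero, and the Gaussian has no zeros. -/
theorem denseRange_polyGaussLp : DenseRange (polyGaussLp hγ hQ) := by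
  have : (LinearMap.range (polyGaussLp hγ hQ)).topologicalClosure = ⊤ := by
    rw [Submodule.topologicalClosure_eq_top_iff, Submodule.eq_bot_iff]
    intro f hf
    have horth : ∀ p, ∫ x, starRingEnd ℂ (polyGauss Q p x) * f x = 0 := by
      intro p
      have h1 := (Submodule.mem_orthogonal _ _).1 hf _ (LinearMap.mem_range_self _ p)
      rw [L2.inner_def] at h1
      rw [← h1]
      refine integral_congr_ae ?_
      filter_upwards [coeFn_polyGaussLp hγ hQ p] with x hx
      rw [hx, RCLike.inner_apply, mul_comm]
    have hf2 : MemLp f 2 volume := Lp.memLp f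
    have h1 : (fun x => (gaussian Q x : ℂ) * f x) =ᵐ[volume] 0 := by
      refine ae_eq_zero_of_moments_eq_zero (fun t => ?_) ?_ fun ξ k => ?_
      · have hexp : MemLp (fun x : EuclideanSpace ℝ (Fin d) =>
            Real.exp (t * ‖x‖ - (γ / 4) * ‖x‖ ^ 2)) 2 volume := by
          rw [memLp_two_iff_integrable_sq_norm (by fun_prop)]
          refine (integrable_exp_norm_sub_sq (d := d) (half_pos hγ) (2 * t)).congr
            (Filter.Eventually.of_forall fun x => ?_)
          simp only [Real.norm_eq_abs, Real.abs_exp]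
          rw [← Real.exp_nat_mul]
          congr 1
          push_cast
          ring
        refine (hexp.integrable_mul hf2.norm).mono' ?_ (Filter.Eventually.of_forall fun x => ?_)
        · exact (Continuous.aestronglyMeasurable (by fun_prop)).mul
            (((Complex.continuous_ofReal.comp continuous_gaussian).aestronglyMeasurable.mul
              hf2.1).norm)
        · rw [Real.norm_eq_abs, abs_of_nonneg (by positivity), norm_mul, Complex.norm_real,
            Real.norm_eq_abs, abs_of_pos (gaussian_pos x), ← mul_assoc, Pi.mul_apply, sub_eq_add_neg,
            Real.exp_add, ← neg_mul]
          gcongr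
          exact gaussian_le hQ x
      · exact (Complex.continuous_ofReal.comp continuous_gaussian).aestronglyMeasurable.mul hf2.1
      · have h2 := horth ((∑ j, (ξ j : ℂ) • X j) ^ k)
        rw [← h2]
        refine integral_congr_ae (Filter.Eventually.of_forall fun x => ?_)
        simp only [polyGauss, evalReal, map_pow, map_sum, MvPolynomial.smul_eval, eval_X, map_mul,
          Complex.conj_ofReal, PiLp.inner_apply, RCLike.inner_apply, conj_trivial,
          Complex.ofReal_sum, Complex.ofReal_mul]
        ring
    rw [Lp.eq_zero_iff_ae_eq_zero]
    filter_upwards [h1] with x hx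
    simpa [(gaussian_pos x).ne'] using hx
  have h2 := (Submodule.dense_iff_topologicalClosure_eq_top).2 this
  exact h2

end PolynomialGaussian


/-! ### Symmetry of the covariant derivatives -/

section Momentum

open MeasureTheory

variable {d : ℕ}

/-- All local analysis is done at `ħ = 1`; the semiclassical parameter enters only through the
length scale in the rescaling. -/
theorem covariantDeriv_one (A : Fin d → EuclideanSpace ℝ (Fin d) → ℝ) (j : Fin d)
    (u : EuclideanSpace ℝ (Fin d) → ℂ) (x : EuclideanSpace ℝ (Fin d)) :
    covariantDeriv A 1 j u x = -Complex.I * partialDeriv j u x - (A j x : ℂ) * u x := by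
  rw [covariantDeriv, Complex.ofReal_one, one_div, Complex.inv_I]

theorem contDiff_partialDeriv {F : Type*} [NormedAddCommGroup F] [NormedSpace ℝ F]
    {u : EuclideanSpace ℝ (Fin d) → F} {m n : WithTop ℕ∞} (hu : ContDiff ℝ n u) (hmn : m + 1 ≤ n)
    (j : Fin d) : ContDiff ℝ m (partialDeriv j u) :=
  (hu.fderiv_right hmn).clm_apply contDiff_const

theorem hasCompactSupport_partialDeriv {F : Type*} [NormedAddCommGroup F] [NormedSpace ℝ F]
    {u : EuclideanSpace ℝ (Fin d) → F} (hu : HasCompactSupport u) (j : Fin d) :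
    HasCompactSupport (partialDeriv j u) :=
  (hu.fderiv (𝕜 := ℝ)).comp_left (g := fun L : EuclideanSpace ℝ (Fin d) →L[ℝ] F =>
    L (EuclideanSpace.single j 1)) rfl

theorem contDiff_covariantDeriv {A : Fin d → EuclideanSpace ℝ (Fin d) → ℝ}
    {u : EuclideanSpace ℝ (Fin d) → ℂ} {m n : WithTop ℕ∞} (hu : ContDiff ℝ n u) (hmn : m + 1 ≤ n)
    (j : Fin d) (hA : ContDiff ℝ m (A j)) : ContDiff ℝ m (covariantDeriv A 1 j u) := by
  have h1 := contDiff_partialDeriv hu hmn j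
  have h2 : ContDiff ℝ m u := hu.of_le (le_self_add.trans hmn)
  have h3 : ContDiff ℝ m fun x => (A j x : ℂ) := Complex.ofRealCLM.contDiff.comp hA
  rw [show covariantDeriv A 1 j u = fun x => -Complex.I * partialDeriv j u x - (A j x : ℂ) * u x
    from funext (covariantDeriv_one A j u)]
  exact (contDiff_const.mul h1).sub (h3.mul h2)

theorem hasCompactSupport_covariantDeriv {A : Fin d → EuclideanSpace ℝ (Fin d) → ℝ}
    {u : EuclideanSpace ℝ (Fin d) → ℂ} (hu : HasCompactSupport u) (j : Fin d) :
    HasCompactSupport (covariantDeriv A 1 j u) := by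
  rw [show covariantDeriv A 1 j u = fun x => -Complex.I * partialDeriv j u x - (A j x : ℂ) * u x
    from funext (covariantDeriv_one A j u)]
  exact ((hasCompactSupport_partialDeriv hu j).mul_left (f := fun _ => -Complex.I)).sub
    (hu.mul_left (f := fun x => (A j x : ℂ)))

theorem partialDeriv_conj {u : EuclideanSpace ℝ (Fin d) → ℂ} (j : Fin d)
    (x : EuclideanSpace ℝ (Fin d)) :
    partialDeriv j (fun y => starRingEnd ℂ (u y)) x = starRingEnd ℂ (partialDeriv j u x) := by
  have := (Complex.conjCLE.toContinuousLinearEquiv).comp_fderiv (f := u) (x := x)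
  have h2 := congrArg (fun L : EuclideanSpace ℝ (Fin d) →L[ℝ] ℂ =>
    L (EuclideanSpace.single j 1)) this
  exact h2

/-- The components of the momentum are symmetric. -/
theorem integral_conj_mul_covariantDeriv {A : Fin d → EuclideanSpace ℝ (Fin d) → ℝ}
    {f h : EuclideanSpace ℝ (Fin d) → ℂ} (j : Fin d)
    (hf : Differentiable ℝ f) (hh : Differentiable ℝ h)
    (hfh' : Integrable fun x => starRingEnd ℂ (f x) * partialDeriv j h x)
    (hf'h : Integrable fun x => starRingEnd ℂ (partialDeriv j f x) * h x)
    (hfh : Integrable fun x => starRingEnd ℂ (f x) * h x)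
    (hAfh : Integrable fun x => (A j x : ℂ) * (starRingEnd ℂ (f x) * h x)) :
    ∫ x, starRingEnd ℂ (f x) * covariantDeriv A 1 j h x
      = ∫ x, starRingEnd ℂ (covariantDeriv A 1 j f x) * h x := by
  have hconj : Differentiable ℝ fun y => starRingEnd ℂ (f y) :=
    Complex.conjCLE.toContinuousLinearEquiv.differentiable.comp hf
  have key := integral_mul_fderiv_eq_neg_fderiv_mul_of_integrable (μ := volume)
    (f := fun y => starRingEnd ℂ (f y)) (g := h) (v := EuclideanSpace.single j (1 : ℝ))
    (hf'h.congr (Filter.Eventually.of_forall fun x => by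
      simp only; rw [← partialDeriv_conj]; rfl)) hfh' hfh
    (fun x _ => hconj x) (fun x _ => hh x)
  have h1 : ∫ x, starRingEnd ℂ (f x) * covariantDeriv A 1 j h x
      = -Complex.I * (∫ x, starRingEnd ℂ (f x) * partialDeriv j h x)
        - ∫ x, (A j x : ℂ) * (starRingEnd ℂ (f x) * h x) := by
    rw [← integral_const_mul, ← integral_sub (hfh'.const_mul _) hAfh]
    refine integral_congr_ae (Filter.Eventually.of_forall fun x => ?_)
    simp only [covariantDeriv_one]
    ring
  have h2 : ∫ x, starRingEnd ℂ (covariantDeriv A 1 j f x) * h x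
      = Complex.I * (∫ x, starRingEnd ℂ (partialDeriv j f x) * h x)
        - ∫ x, (A j x : ℂ) * (starRingEnd ℂ (f x) * h x) := by
    rw [← integral_const_mul, ← integral_sub (hf'h.const_mul _) hAfh]
    refine integral_congr_ae (Filter.Eventually.of_forall fun x => ?_)
    simp only [covariantDeriv_one, map_sub, map_mul, map_neg, Complex.conj_I, Complex.conj_ofReal]
    ring
  have h3 : ∫ x, starRingEnd ℂ (f x) * partialDeriv j h x
      = -∫ x, starRingEnd ℂ (partialDeriv j f x) * h x := by
    refine Eq.trans key (congrArg Neg.neg (integral_congr_ae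
      (Filter.Eventually.of_forall fun x => ?_)))
    simp only
    rw [← partialDeriv_conj]
    rfl
  rw [h1, h2, h3]
  ring

theorem integral_conj_mul_covariantDeriv_of_memLp {A : Fin d → EuclideanSpace ℝ (Fin d) → ℝ}
    {f h : EuclideanSpace ℝ (Fin d) → ℂ} (j : Fin d)
    (hf : Differentiable ℝ f) (hh : Differentiable ℝ h)
    (hf2 : MemLp f 2 volume) (hh2 : MemLp h 2 volume)
    (hf' : MemLp (partialDeriv j f) 2 volume) (hh' : MemLp (partialDeriv j h) 2 volume)
    (hAf : MemLp (fun x => (A j x : ℂ) * f x) 2 volume) :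
    ∫ x, starRingEnd ℂ (f x) * covariantDeriv A 1 j h x
      = ∫ x, starRingEnd ℂ (covariantDeriv A 1 j f x) * h x := by
  refine integral_conj_mul_covariantDeriv j hf hh (hf2.star.integrable_mul hh')
    (hf'.star.integrable_mul hh2) (hf2.star.integrable_mul hh2) ?_
  refine (hAf.star.integrable_mul hh2).congr (Filter.Eventually.of_forall fun x => ?_)
  simp only [Pi.mul_apply, Pi.star_apply, RCLike.star_def, map_mul, Complex.conj_ofReal]
  ring

theorem integral_conj_mul_covariantDeriv_of_hasCompactSupport
    {A : Fin d → EuclideanSpace ℝ (Fin d) → ℝ}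
    {f h : EuclideanSpace ℝ (Fin d) → ℂ} (j : Fin d) (hA : Continuous (A j))
    (hf : ContDiff ℝ 1 f) (hh : ContDiff ℝ 1 h) (hc : HasCompactSupport h) :
    ∫ x, starRingEnd ℂ (f x) * covariantDeriv A 1 j h x
      = ∫ x, starRingEnd ℂ (covariantDeriv A 1 j f x) * h x := by
  have h0 : (0 : WithTop ℕ∞) + 1 ≤ 1 := by simp
  have hfc : Continuous fun x => starRingEnd ℂ (f x) := Complex.continuous_conj.comp hf.continuous
  refine integral_conj_mul_covariantDeriv j (hf.differentiable (by simp))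
    (hh.differentiable (by simp)) ?_ ?_ ?_ ?_
  · exact (hfc.mul (contDiff_partialDeriv hh h0 j).continuous).integrable_of_hasCompactSupport
      (hasCompactSupport_partialDeriv hc j).mul_left
  · exact ((Complex.continuous_conj.comp (contDiff_partialDeriv hf h0 j).continuous).mul
      hh.continuous).integrable_of_hasCompactSupport hc.mul_left
  · exact (hfc.mul hh.continuous).integrable_of_hasCompactSupport hc.mul_left
  · exact ((Complex.continuous_ofReal.comp hA).mul
      (hfc.mul hh.continuous)).integrable_of_hasCompactSupport hc.mul_left.mul_left

/-- The magnetic Laplacian `∑_j (-i ∂_j - A_j)²`. -/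
def magneticLaplacian (A : Fin d → EuclideanSpace ℝ (Fin d) → ℝ)
    (u : EuclideanSpace ℝ (Fin d) → ℂ) (x : EuclideanSpace ℝ (Fin d)) : ℂ :=
  ∑ j, covariantDeriv A 1 j (covariantDeriv A 1 j u) x

end Momentum

/-! ### The Landau operator with constant field on L² -/

section ConstantField

open MeasureTheory MvPolynomial

variable {d : ℕ}

/-- The linear potential of the constant field `B`. -/
def linearPotential (B : Matrix (Fin d) (Fin d) ℝ) (k : Fin d) (x : EuclideanSpace ℝ (Fin d)) : ℝ :=
  (1 / 2) * ∑ j, B j k * x j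

theorem contDiff_linearPotential (B : Matrix (Fin d) (Fin d) ℝ) (k : Fin d) {n : WithTop ℕ∞} :
    ContDiff ℝ n (linearPotential B k) := by
  unfold linearPotential; fun_prop

theorem evalReal_linearForm (C : Matrix (Fin d) (Fin d) ℂ) (j : Fin d)
    (x : EuclideanSpace ℝ (Fin d)) : evalReal (linearForm C j) x = ∑ k, C j k * x k := by
  simp [evalReal, linearForm, MvPolynomial.smul_eval]

theorem proj_apply' (j : Fin d) (x : EuclideanSpace ℝ (Fin d)) :
    (EuclideanSpace.proj (𝕜 := ℝ) j : EuclideanSpace ℝ (Fin d) →L[ℝ] ℝ) x = x j := rfl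

theorem hasFDerivAt_gaussian {Q : Matrix (Fin d) (Fin d) ℝ} (hQ : ∀ j k, Q j k = Q k j)
    (x : EuclideanSpace ℝ (Fin d)) :
    HasFDerivAt (gaussian Q) (∑ j, (-(1 / 2) * (∑ k, Q j k * x k) * gaussian Q x) •
      (EuclideanSpace.proj (𝕜 := ℝ) j : EuclideanSpace ℝ (Fin d) →L[ℝ] ℝ)) x := by
  have hp : ∀ j, HasFDerivAt (fun x : EuclideanSpace ℝ (Fin d) => x j)
      (EuclideanSpace.proj (𝕜 := ℝ) j : EuclideanSpace ℝ (Fin d) →L[ℝ] ℝ) x :=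
    fun j => (EuclideanSpace.proj (𝕜 := ℝ) j : EuclideanSpace ℝ (Fin d) →L[ℝ] ℝ).hasFDerivAt
  have hq : ∀ j k, HasFDerivAt (fun x : EuclideanSpace ℝ (Fin d) => Q j k * x j * x k) _ x :=
    fun j k => ((hp j).const_mul (Q j k)).mul (hp k)
  have h1 := ((HasFDerivAt.fun_sum (u := Finset.univ) fun j _ =>
    HasFDerivAt.fun_sum (u := Finset.univ) fun k _ => hq j k).const_mul (-(1 / 4) : ℝ)).exp
  refine h1.congr_fderiv ?_
  ext v
  have h3 : ∑ j, ∑ k, v j * (Q j k * x k) = ∑ j, ∑ k, v k * (Q j k * x j) := by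
    rw [Finset.sum_comm]
    exact Finset.sum_congr rfl fun j _ => Finset.sum_congr rfl fun k _ => by rw [hQ]
  have h4 : ∑ j, (-(1 / 2) * (∑ k, Q j k * x k) * gaussian Q x) * v j
      = -(1 / 2) * gaussian Q x * ∑ j, ∑ k, v j * (Q j k * x k) := by
    rw [Finset.mul_sum]
    refine Finset.sum_congr rfl fun j _ => ?_
    rw [← Finset.mul_sum]
    ring
  have h5 : ∑ j, ∑ k, (Q j k * x j * v k + x k * (Q j k * v j))
      = ∑ j, ∑ k, v k * (Q j k * x j) + ∑ j, ∑ k, v j * (Q j k * x k) := by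
    simp only [← Finset.sum_add_distrib]
    exact Finset.sum_congr rfl fun j _ => Finset.sum_congr rfl fun k _ => by ring
  have h6 : gaussian Q x = Real.exp (-(1 / 4) * ∑ j, ∑ k, Q j k * x j * x k) := rfl
  simp only [smul_apply, sum_apply,
    add_apply, smul_eq_mul, proj_apply']
  rw [h4, h5, ← h3, ← h6]
  ring

theorem hasFDerivAt_polyGauss {Q : Matrix (Fin d) (Fin d) ℝ} (hQ : ∀ j k, Q j k = Q k j)
    (p : MvPolynomial (Fin d) ℂ) (x : EuclideanSpace ℝ (Fin d)) :
    HasFDerivAt (polyGauss Q p) (∑ j, (polyGauss Q (pderiv j p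
      - linearForm (fun j k => (1 / 2) * (Q j k : ℂ)) j * p) x) •
        (Complex.ofRealCLM.comp (EuclideanSpace.proj (𝕜 := ℝ) j))) x := by
  have h1 : HasFDerivAt (fun x => (gaussian Q x : ℂ)) _ x :=
    Complex.ofRealCLM.hasFDerivAt.comp x (hasFDerivAt_gaussian hQ x)
  refine (h1.mul (hasFDerivAt_evalReal p x)).congr_fderiv ?_
  ext v
  simp only [add_apply, smul_apply,
    sum_apply, ContinuousLinearMap.comp_apply, smul_eq_mul,
    proj_apply', Complex.ofRealCLM_apply]
  push_cast
  rw [Finset.mul_sum, Finset.mul_sum, ← Finset.sum_add_distrib]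
  refine Finset.sum_congr rfl fun j _ => ?_
  have h2 : evalReal (pderiv j p - linearForm (fun j k => (1 / 2) * (Q j k : ℂ)) j * p) x
      = evalReal (pderiv j p) x
        - (∑ k, (1 / 2) * (Q j k : ℂ) * x k) * evalReal p x := by
    rw [← evalReal_linearForm (fun j k => (1 / 2) * (Q j k : ℂ))]
    simp [evalReal]
  rw [polyGauss, h2]
  simp only [mul_assoc, ← Finset.mul_sum]
  ring

theorem partialDeriv_polyGauss {Q : Matrix (Fin d) (Fin d) ℝ} (hQ : ∀ j k, Q j k = Q k j)
    (p : MvPolynomial (Fin d) ℂ) (j : Fin d) :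
    partialDeriv j (polyGauss Q p)
      = polyGauss Q (pderiv j p - linearForm (fun j k => (1 / 2) * (Q j k : ℂ)) j * p) := by
  ext x
  rw [partialDeriv, (hasFDerivAt_polyGauss hQ p x).fderiv]
  simp only [smul_apply, sum_apply, ContinuousLinearMap.comp_apply, smul_eq_mul, proj_apply',
    Complex.ofRealCLM_apply, PiLp.single_apply]
  rw [Finset.sum_eq_single j (fun k _ hk => by rw [if_neg hk]; simp) (by simp)]
  simp

theorem linearPotential_mul_polyGauss {B : Matrix (Fin d) (Fin d) ℝ} (hB : B.transpose = -B)
    {Q : Matrix (Fin d) (Fin d) ℝ} (p : MvPolynomial (Fin d) ℂ) (j : Fin d) :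
    (fun x => (linearPotential B j x : ℂ) * polyGauss Q p x)
      = polyGauss Q (linearForm (fun j k => -(1 / 2) * (B j k : ℂ)) j * p) := by
  ext x
  have h1 : evalReal (linearForm (fun j k => -(1 / 2) * (B j k : ℂ)) j * p) x
      = (∑ k, -(1 / 2) * (B j k : ℂ) * x k) * evalReal p x := by
    rw [← evalReal_linearForm (fun j k => -(1 / 2) * (B j k : ℂ))]
    simp [evalReal]
  have h2 : (linearPotential B j x : ℂ) = ∑ k, -(1 / 2) * (B j k : ℂ) * x k := by
    rw [linearPotential, Finset.mul_sum]
    push_cast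
    refine Finset.sum_congr rfl fun k _ => ?_
    have h4 : B k j = - B j k := congrFun (congrFun hB j) k
    rw [h4]
    push_cast
    ring
  rw [polyGauss, polyGauss, h1, h2]
  ring

variable {B : Matrix (Fin d) (Fin d) ℝ} (hB : B.transpose = -B)

/-- The derivative of the Gaussian contributes `(i / 2) |B| x` and the potential, by antisymmetry,
`(1 / 2) B x`; together they are the linear form of `landauMatrix`. -/
theorem covariantDeriv_polyGauss (p : MvPolynomial (Fin d) ℂ) (j : Fin d) :
    covariantDeriv (linearPotential B) 1 j (polyGauss (absField hB) p)
      = polyGauss (absField hB) (polyMomentum (landauMatrix hB) j p) := by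
  ext x
  have h1 := congrFun (linearPotential_mul_polyGauss hB (Q := absField hB) p j) x
  rw [covariantDeriv_one, partialDeriv_polyGauss (absField_symm hB), h1]
  have h2 : linearForm (landauMatrix hB) j
      = Complex.I • linearForm (fun j k => (1 / 2) * (absField hB j k : ℂ)) j
        - linearForm (fun j k => -(1 / 2) * (B j k : ℂ)) j := by
    simp only [linearForm, Finset.smul_sum, smul_smul, ← Finset.sum_sub_distrib, ← sub_smul]
    refine Finset.sum_congr rfl fun k _ => ?_
    congr 1
    rw [landauMatrix, Matrix.of_apply]
    ring
  simp only [polyGauss, polyMomentum_apply, h2, evalReal, map_add, map_sub, map_mul,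
    MvPolynomial.smul_eval]
  ring

theorem inner_toLp {f g : EuclideanSpace ℝ (Fin d) → ℂ} (hf : MemLp f 2 volume)
    (hg : MemLp g 2 volume) :
    inner ℂ (hf.toLp f) (hg.toLp g) = ∫ x, starRingEnd ℂ (f x) * g x := by
  rw [L2.inner_def]
  refine integral_congr_ae ?_
  filter_upwards [hf.coeFn_toLp, hg.coeFn_toLp] with x h1 h2
  rw [h1, h2, RCLike.inner_apply, mul_comm]

theorem norm_toLp_sq {f : EuclideanSpace ℝ (Fin d) → ℂ} (hf : MemLp f 2 volume) :
    ‖hf.toLp f‖ ^ 2 = ∫ x, ‖f x‖ ^ 2 := by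
  apply Complex.ofReal_injective
  have h1 := inner_self_eq_norm_sq_to_K (𝕜 := ℂ) (hf.toLp f)
  rw [inner_toLp] at h1
  rw [← integral_complex_ofReal, Complex.ofReal_pow]
  refine Eq.trans h1.symm (integral_congr_ae (Filter.Eventually.of_forall fun x => ?_))
  simp only
  rw [mul_comm, Complex.mul_conj', Complex.ofReal_pow]

/-- Spectral gaps of the Landau Hamiltonian with constant nondegenerate field. -/
theorem landau_gap (hne : ∀ i, fieldEigenvalue hB i ≠ 0) {μ δ : ℝ} (hδ : 0 < δ)
    (hgap : ∀ ν : ℝ, ∀ p : MvPolynomial (Fin d) ℂ, p ≠ 0 →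
      kinetic (polyMomentum (landauMatrix hB)) p = (ν : ℂ) • p → δ ≤ |ν - μ|)
    {v : EuclideanSpace ℝ (Fin d) → ℂ} (hv : ContDiff ℝ 2 v) (hc : HasCompactSupport v) :
    δ ^ 2 * ∫ x, ‖v x‖ ^ 2
      ≤ ∫ x, ‖magneticLaplacian (linearPotential B) v x - μ * v x‖ ^ 2 := by
  obtain ⟨γ, hγ, hQ⟩ := exists_absField_pos hB hne
  set Q := absField hB with hQdef
  set P := polyMomentum (landauMatrix hB) with hP
  set D := covariantDeriv (linearPotential B) 1 with hD
  have hsymm := absField_symm hB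
  have hdiff : ∀ p, Differentiable ℝ (polyGauss Q p) := fun p x =>
    (hasFDerivAt_polyGauss hsymm p x).differentiableAt
  have hmem := memLp_polyGauss hγ hQ
  have hmem' : ∀ p j, MemLp (partialDeriv j (polyGauss Q p)) 2 volume := by
    intro p j
    rw [partialDeriv_polyGauss hsymm]
    exact hmem _
  have hmemA : ∀ p j, MemLp (fun x => (linearPotential B j x : ℂ) * polyGauss Q p x) 2 volume := by
    intro p j
    rw [linearPotential_mul_polyGauss hB]
    exact hmem _
  have h10 : (1 : WithTop ℕ∞) + 1 ≤ 2 := by norm_num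
  have h00 : (0 : WithTop ℕ∞) + 1 ≤ 1 := by simp
  have hcc : ∀ {w : EuclideanSpace ℝ (Fin d) → ℂ}, Continuous w → HasCompactSupport w →
      MemLp w 2 volume := fun h1 h2 => h1.memLp_of_hasCompactSupport h2
  have hD1 : ∀ j, ContDiff ℝ 1 (D j v) := fun j =>
    contDiff_covariantDeriv hv h10 j (contDiff_linearPotential B j)
  have hDc : ∀ j, HasCompactSupport (D j v) := fun j => hasCompactSupport_covariantDeriv hc j
  have hDD : ∀ j, MemLp (D j (D j v)) 2 volume := fun j =>
    hcc (contDiff_covariantDeriv (hD1 j) h00 j (contDiff_linearPotential B j)).continuous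
      (hasCompactSupport_covariantDeriv (hDc j) j)
  have hv2 : MemLp v 2 volume := hcc hv.continuous hc
  have hTv : MemLp (magneticLaplacian (linearPotential B) v) 2 volume := by
    have := memLp_finsetSum' Finset.univ fun j _ => hDD j
    convert this using 1
    ext x
    simp [magneticLaplacian, hD]
  have hg : MemLp (fun x => magneticLaplacian (linearPotential B) v x - μ * v x) 2 volume :=
    hTv.sub (hv2.const_mul (μ : ℂ))
  have hint : ∀ {f g : EuclideanSpace ℝ (Fin d) → ℂ}, MemLp f 2 volume → MemLp g 2 volume →
      Integrable fun x => starRingEnd ℂ (f x) * g x := fun h1 h2 => h1.star.integrable_mul h2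
  have ibp : ∀ p j (w : EuclideanSpace ℝ (Fin d) → ℂ), Differentiable ℝ w → MemLp w 2 volume →
      MemLp (partialDeriv j w) 2 volume →
      ∫ x, starRingEnd ℂ (polyGauss Q p x) * D j w x
        = ∫ x, starRingEnd ℂ (polyGauss Q (P j p) x) * w x := by
    intro p j w h1 h2 h3
    rw [integral_conj_mul_covariantDeriv_of_memLp j (hdiff p) h1 (hmem p) h2 (hmem' p j) h3
      (hmemA p j), covariantDeriv_polyGauss hB p j]
  -- The invariant spaces are the polynomials of bounded total degree, and the pair `(v, g)` is `v`
  -- with its image under the differential operator minus `μ`.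
  have key : δ * ‖hv2.toLp v‖ ≤ ‖hg.toLp _‖ := by
    refine spectralGap_of_dense (polyGaussLp hγ hQ) (injective_polyGaussLp hγ hQ)
      (denseRange_polyGaussLp hγ hQ) (kinetic P) ?_
      (restrictTotalDegree (Fin d) ℂ) (fun m => inferInstance)
      (fun m p hp => (ladderSystem_polyMomentum hB hne).kinetic_mem hp)
      (fun p => ⟨p.totalDegree, (mem_restrictTotalDegree _ _ _).2 le_rfl⟩) hδ
      (fun ν p hp h => hgap ν p hp h) _ _ ?_
    · have h1 : ∀ p q j, inner ℂ (polyGaussLp hγ hQ (P j p)) (polyGaussLp hγ hQ q)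
          = inner ℂ (polyGaussLp hγ hQ p) (polyGaussLp hγ hQ (P j q)) := by
        intro p q j
        refine (inner_toLp (hmem _) (hmem _)).trans (Eq.trans ?_ (inner_toLp (hmem _) (hmem _)).symm)
        rw [← ibp p j _ (hdiff q) (hmem q) (hmem' q j), hD, covariantDeriv_polyGauss hB]
      intro p q
      simp only [kinetic, LinearMap.sum_apply, map_sum, sum_inner, inner_sum, Module.End.mul_apply,
        h1]
    · intro p
      -- Two integrations by parts in each direction move the operator from `v` to the polynomial;
      -- one side is compactly supported, and the Gaussian side stays in L² after differentiation
      -- and multiplication by the potential.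
      have h1 : ∫ x, starRingEnd ℂ (polyGauss Q p x) * magneticLaplacian (linearPotential B) v x
          = ∫ x, starRingEnd ℂ (polyGauss Q (kinetic P p) x) * v x := by
        have h2 : ∀ x, starRingEnd ℂ (polyGauss Q p x) * magneticLaplacian (linearPotential B) v x
            = ∑ j, starRingEnd ℂ (polyGauss Q p x) * D j (D j v) x := by
          intro x; rw [magneticLaplacian, Finset.mul_sum]
        have h3 : ∀ x, starRingEnd ℂ (polyGauss Q (kinetic P p) x) * v x
            = ∑ j, starRingEnd ℂ (polyGauss Q (P j (P j p)) x) * v x := by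
          intro x
          simp only [polyGauss, kinetic, LinearMap.sum_apply, Module.End.mul_apply, evalReal,
            map_sum, Finset.mul_sum, Finset.sum_mul]
        simp only [h2, h3]
        rw [integral_finsetSum _ fun j _ => hint (hmem p) (hDD j),
          integral_finsetSum _ fun j _ => hint (hmem _) hv2]
        refine Finset.sum_congr rfl fun j _ => ?_
        rw [ibp p j _ ((hD1 j).differentiable (by simp)) (hcc (hD1 j).continuous (hDc j))
          (hcc (contDiff_partialDeriv (hD1 j) h00 j).continuous
            (hasCompactSupport_partialDeriv (hDc j) j)),
          ibp _ j _ (hv.differentiable (by simp)) hv2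
          (hcc (contDiff_partialDeriv hv h10 j).continuous
            (hasCompactSupport_partialDeriv hc j))]
      rw [inner_sub_left, inner_smul_left, Complex.conj_ofReal]
      have h4 : ∀ q, inner ℂ (polyGaussLp hγ hQ q) (hv2.toLp v)
          = ∫ x, starRingEnd ℂ (polyGauss Q q x) * v x := fun q => inner_toLp (hmem q) hv2
      rw [h4, h4, ← h1]
      refine (inner_toLp (hmem p) hg).trans ?_
      rw [← integral_const_mul, ← integral_sub (hint (hmem p) hTv)
        ((hint (hmem p) hv2).const_mul _)]
      refine integral_congr_ae (Filter.Eventually.of_forall fun x => ?_)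
      simp only
      ring
  have h1 := norm_toLp_sq hv2
  have h2 := norm_toLp_sq hg
  rw [← h1, ← h2, ← mul_pow]
  gcongr

/-- Spectral gaps of the Landau Hamiltonian on `ℝ^{2n}`, in terms of the frequencies. -/
theorem landau_gap_of_frequencies {n : ℕ} {B : Matrix (Fin (2 * n)) (Fin (2 * n)) ℝ}
    (hB : B.transpose = -B) (hrank : B.rank = 2 * n) {μ δ : ℝ} (hδ : 0 < δ)
    (hgap : ∀ a : Fin n → ℝ, IsFrequencies B a → ∀ k : Fin n → ℕ,
      δ ≤ |∑ j, (2 * (k j : ℝ) + 1) * a j - μ|)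
    {v : EuclideanSpace ℝ (Fin (2 * n)) → ℂ} (hv : ContDiff ℝ 2 v) (hc : HasCompactSupport v) :
    δ ^ 2 * ∫ x, ‖v x‖ ^ 2
      ≤ ∫ x, ‖magneticLaplacian (linearPotential B) v x - μ * v x‖ ^ 2 := by
  have hne := fieldEigenvalue_ne_zero hB hrank
  refine landau_gap hB hne hδ (fun ν p hp hν => ?_) hv hc
  obtain ⟨a, ha, k, rfl⟩ := eigenvalue_mem_landauLevels hB hne hp hν
  exact hgap a ha k

end ConstantField


/-! ### Radial gauge and its remainder -/

section Gauge

open MeasureTheory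

theorem hasFDerivAt_integral_unitInterval {E F : Type*} [NormedAddCommGroup E] [NormedSpace ℝ E]
    [FiniteDimensional ℝ E] [NormedAddCommGroup F] [NormedSpace ℝ F] [CompleteSpace F]
    {g : ℝ × E → F} (hg : ContDiff ℝ 1 g) (x : E) :
    HasFDerivAt (fun x => ∫ t in (0 : ℝ)..1, g (t, x))
      (∫ t in (0 : ℝ)..1, (fderiv ℝ g (t, x)).comp (ContinuousLinearMap.inr ℝ ℝ E)) x := by
  have hcont : Continuous fun p : ℝ × E =>
      (fderiv ℝ g p).comp (ContinuousLinearMap.inr ℝ ℝ E) :=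
    (hg.continuous_fderiv (by simp)).clm_comp continuous_const
  obtain ⟨M, hM⟩ := ((isCompact_Icc (a := (0 : ℝ)) (b := 1)).prod
    (isCompact_closedBall x 1)).exists_bound_of_continuousOn hcont.continuousOn
  refine (intervalIntegral.hasFDerivAt_integral_of_dominated_of_fderiv_le
    (F := fun x t => g (t, x)) (F' := fun x t => (fderiv ℝ g (t, x)).comp
      (ContinuousLinearMap.inr ℝ ℝ E)) (bound := fun _ => M) (Metric.closedBall_mem_nhds x one_pos)
    ?_ ?_ ?_ ?_ ?_ ?_)
  · exact Filter.Eventually.of_forall fun y =>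
      (hg.continuous.comp (by fun_prop : Continuous fun t : ℝ => (t, y))).aestronglyMeasurable
  · exact (hg.continuous.comp (by fun_prop : Continuous fun t : ℝ => (t, x))).intervalIntegrable _ _
  · exact (hcont.comp (by fun_prop : Continuous fun t : ℝ => (t, x))).aestronglyMeasurable
  · refine Filter.Eventually.of_forall fun t ht y hy => hM (t, y) ⟨?_, hy⟩
    rw [Set.uIoc_of_le zero_le_one] at ht
    exact ⟨ht.1.le, ht.2⟩
  · exact intervalIntegrable_const
  · refine Filter.Eventually.of_forall fun t ht y hy => ?_
    have h1 := (hg.differentiable (by simp) (t, y)).hasFDerivAt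
    exact h1.comp y (hasFDerivAt_prodMk_right t y)

theorem contDiff_one_integral_unitInterval {E F : Type*} [NormedAddCommGroup E] [NormedSpace ℝ E]
    [FiniteDimensional ℝ E] [NormedAddCommGroup F] [NormedSpace ℝ F] [CompleteSpace F]
    {g : ℝ × E → F} (hg : ContDiff ℝ 1 g) :
    ContDiff ℝ 1 (fun x => ∫ t in (0 : ℝ)..1, g (t, x)) := by
  rw [contDiff_one_iff_fderiv]
  refine ⟨fun x => (hasFDerivAt_integral_unitInterval hg x).differentiableAt, ?_⟩
  rw [show fderiv ℝ (fun x => ∫ t in (0 : ℝ)..1, g (t, x)) = _ from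
    funext fun x => (hasFDerivAt_integral_unitInterval hg x).fderiv]
  have hcont : Continuous fun p : E × ℝ =>
      (fderiv ℝ g (p.2, p.1)).comp (ContinuousLinearMap.inr ℝ ℝ E) :=
    ((hg.continuous_fderiv (by simp)).comp (by fun_prop : Continuous fun p : E × ℝ =>
      (p.2, p.1))).clm_comp continuous_const
  exact intervalIntegral.continuous_parametric_intervalIntegral_of_continuous' hcont 0 1

variable {d : ℕ}

theorem fderiv_eq_sum_partialDeriv {F : Type*} [NormedAddCommGroup F] [NormedSpace ℝ F]
    (f : EuclideanSpace ℝ (Fin d) → F) (x v : EuclideanSpace ℝ (Fin d)) :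
    fderiv ℝ f x v = ∑ j, v j • partialDeriv j f x := by
  conv_lhs => rw [← (EuclideanSpace.basisFun (Fin d) ℝ).sum_repr v, map_sum]
  simp [partialDeriv]

theorem partialDeriv_integral_unitInterval {F : Type*} [NormedAddCommGroup F] [NormedSpace ℝ F]
    [CompleteSpace F] {g : ℝ → EuclideanSpace ℝ (Fin d) → F}
    (hg : ContDiff ℝ 1 (fun p : ℝ × EuclideanSpace ℝ (Fin d) => g p.1 p.2)) (k : Fin d)
    (x : EuclideanSpace ℝ (Fin d)) :
    partialDeriv k (fun x => ∫ t in (0 : ℝ)..1, g t x) x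
      = ∫ t in (0 : ℝ)..1, partialDeriv k (g t) x := by
  rw [partialDeriv, (hasFDerivAt_integral_unitInterval hg x).fderiv]
  have hcont : Continuous fun t : ℝ =>
      (fderiv ℝ (fun p : ℝ × EuclideanSpace ℝ (Fin d) => g p.1 p.2) (t, x)).comp
        (ContinuousLinearMap.inr ℝ ℝ (EuclideanSpace ℝ (Fin d))) :=
    ((hg.continuous_fderiv (by simp)).comp
      (by fun_prop : Continuous fun t : ℝ => (t, x))).clm_comp continuous_const
  rw [ContinuousLinearMap.intervalIntegral_apply (hcont.intervalIntegrable 0 1)]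
  refine intervalIntegral.integral_congr fun t _ => ?_
  have h1 : HasFDerivAt (g t) _ x := (hg.differentiable (by simp) (t, x)).hasFDerivAt.comp x
    (hasFDerivAt_prodMk_right t x)
  simp only [partialDeriv, h1.fderiv]

theorem contDiff_partialDeriv_top {F : Type*} [NormedAddCommGroup F] [NormedSpace ℝ F]
    {u : EuclideanSpace ℝ (Fin d) → F} (hu : ContDiff ℝ ∞ u) (j : Fin d) :
    ContDiff ℝ ∞ (partialDeriv j u) := contDiff_partialDeriv hu (by simp) j

theorem contDiff_magneticField {A : Fin d → EuclideanSpace ℝ (Fin d) → ℝ}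
    (hA : ∀ j, ContDiff ℝ ∞ (A j)) (j k : Fin d) :
    ContDiff ℝ ∞ fun x => magneticField A x j k :=
  (contDiff_partialDeriv_top (hA k) j).sub (contDiff_partialDeriv_top (hA j) k)

theorem partialDeriv_comp_smul {F : Type*} [NormedAddCommGroup F] [NormedSpace ℝ F]
    (f : EuclideanSpace ℝ (Fin d) → F) (c : ℝ) (k : Fin d) (x : EuclideanSpace ℝ (Fin d)) :
    partialDeriv k (fun x => f (c • x)) x = c • partialDeriv k f (c • x) := by
  simp only [partialDeriv]
  have := fderiv_comp_smul (𝕜 := ℝ) (f := f) (x := x) c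
  rw [this]
  simp

theorem partialDeriv_coord (j k : Fin d) (x : EuclideanSpace ℝ (Fin d)) :
    partialDeriv k (fun x : EuclideanSpace ℝ (Fin d) => x j) x = if k = j then 1 else 0 := by
  have : HasFDerivAt (fun x : EuclideanSpace ℝ (Fin d) => x j)
      (EuclideanSpace.proj (𝕜 := ℝ) j : EuclideanSpace ℝ (Fin d) →L[ℝ] ℝ) x :=
    (EuclideanSpace.proj (𝕜 := ℝ) j : EuclideanSpace ℝ (Fin d) →L[ℝ] ℝ).hasFDerivAt
  rw [partialDeriv, this.fderiv, proj_apply', PiLp.single_apply]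
  simp [eq_comm]

theorem partialDeriv_sum {ι : Type*} {s : Finset ι} {f : ι → EuclideanSpace ℝ (Fin d) → ℝ}
    {x : EuclideanSpace ℝ (Fin d)} (hf : ∀ i ∈ s, DifferentiableAt ℝ (f i) x) (k : Fin d) :
    partialDeriv k (fun x => ∑ i ∈ s, f i x) x = ∑ i ∈ s, partialDeriv k (f i) x := by
  rw [partialDeriv, fderiv_fun_sum hf]
  simp [partialDeriv]

theorem partialDeriv_mul {𝔸 : Type*} [NormedCommRing 𝔸] [NormedAlgebra ℝ 𝔸]
    {f g : EuclideanSpace ℝ (Fin d) → 𝔸} {x : EuclideanSpace ℝ (Fin d)}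
    (hf : DifferentiableAt ℝ f x) (hg : DifferentiableAt ℝ g x) (k : Fin d) :
    partialDeriv k (fun x => f x * g x) x
      = f x * partialDeriv k g x + partialDeriv k f x * g x := by
  simp [partialDeriv, fderiv_fun_mul hf hg, mul_comm]

/-- The radial potential `∑_j A_j(t x) x_j`. -/
def radialPotential (A : Fin d → EuclideanSpace ℝ (Fin d) → ℝ) (t : ℝ)
    (x : EuclideanSpace ℝ (Fin d)) : ℝ := ∑ j, A j (t • x) * x j

/-- The integrand of the remainder of the potential in radial gauge. -/
def gaugeRemainder (A : Fin d → EuclideanSpace ℝ (Fin d) → ℝ) (k : Fin d) (t : ℝ)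
    (x : EuclideanSpace ℝ (Fin d)) : ℝ :=
  t * ∑ j, (magneticField A (t • x) j k - magneticField A 0 j k) * x j

variable {A : Fin d → EuclideanSpace ℝ (Fin d) → ℝ} (hA : ∀ j, ContDiff ℝ ∞ (A j))

include hA

theorem contDiff_radialPotential :
    ContDiff ℝ 1 fun p : ℝ × EuclideanSpace ℝ (Fin d) => radialPotential A p.1 p.2 := by
  unfold radialPotential
  refine ContDiff.sum fun j _ => ContDiff.mul ?_ (by fun_prop)
  exact ((hA j).of_le (by simp)).comp (contDiff_fst.smul contDiff_snd)

theorem contDiff_gaugeRemainder (k : Fin d) :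
    ContDiff ℝ 1 fun p : ℝ × EuclideanSpace ℝ (Fin d) => gaugeRemainder A k p.1 p.2 := by
  unfold gaugeRemainder
  refine contDiff_fst.mul (ContDiff.sum fun j _ => ContDiff.mul ?_ (by fun_prop))
  exact (((contDiff_magneticField hA j k).of_le (by simp)).comp
    (contDiff_fst.smul contDiff_snd)).sub contDiff_const

theorem partialDeriv_radialPotential (k : Fin d) (t : ℝ) (x : EuclideanSpace ℝ (Fin d)) :
    partialDeriv k (radialPotential A t) x
      = A k (t • x) + t * ∑ j, partialDeriv k (A j) (t • x) * x j := by
  have hd : ∀ j, DifferentiableAt ℝ (fun x => A j (t • x)) x := fun j =>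
    (((hA j).differentiable (by simp)) (t • x)).comp x (by fun_prop)
  have hc : ∀ j, DifferentiableAt ℝ (fun x : EuclideanSpace ℝ (Fin d) => x j) x :=
    fun j => by fun_prop
  unfold radialPotential
  rw [partialDeriv_sum fun j _ => (hd j).fun_mul (hc j)]
  simp only [partialDeriv_mul (hd _) (hc _), partialDeriv_coord, partialDeriv_comp_smul,
    Finset.sum_add_distrib, mul_ite, mul_one, mul_zero, Finset.sum_ite_eq, Finset.mem_univ, if_true,
    smul_eq_mul, Finset.mul_sum, mul_assoc]

/-- The integrand is the derivative of `t ↦ t A_k(t x)`. -/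
theorem integral_radial (k : Fin d) (x : EuclideanSpace ℝ (Fin d)) :
    ∫ t in (0 : ℝ)..1, (A k (t • x) + t * ∑ j, partialDeriv j (A k) (t • x) * x j) = A k x := by
  have h1 : ∀ t : ℝ, HasDerivAt (fun t : ℝ => t * A k (t • x))
      (A k (t • x) + t * ∑ j, partialDeriv j (A k) (t • x) * x j) t := by
    intro t
    have h2 : HasDerivAt (fun t : ℝ => A k (t • x)) (fderiv ℝ (A k) (t • x) ((1 : ℝ) • x)) t :=
      ((hA k).differentiable (by simp) (t • x)).hasFDerivAt.comp_hasDerivAt t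
        ((hasDerivAt_id t).smul_const x)
    rw [one_smul, fderiv_eq_sum_partialDeriv] at h2
    simpa [mul_comm] using (hasDerivAt_id' t).fun_mul h2
  rw [intervalIntegral.integral_eq_sub_of_hasDerivAt (fun t _ => h1 t)]
  · simp
  · refine Continuous.intervalIntegrable ?_ _ _
    have h3 : Continuous fun t : ℝ => t • x := by fun_prop
    refine ((hA k).continuous.comp h3).add (continuous_id.mul (continuous_finsetSum _ fun j _ => ?_))
    exact ((contDiff_partialDeriv_top (hA k) j).continuous.comp h3).mul continuous_const

/-- Comparing `integral_radial` with the derivative of the radial primitive leaves the integral of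
`t ∑_j B_{jk}(t x) x_j`. Freezing `B` at the origin gives the linear potential, whose factor `1 / 2`
is the integral of `t`; what is left over is the remainder. -/
theorem radial_gauge (k : Fin d) (x : EuclideanSpace ℝ (Fin d)) :
    A k x = partialDeriv k (fun x => ∫ t in (0 : ℝ)..1, radialPotential A t x) x
      + linearPotential (magneticField A 0) k x + ∫ t in (0 : ℝ)..1, gaugeRemainder A k t x := by
  rw [partialDeriv_integral_unitInterval (contDiff_radialPotential hA)]
  have h0 : linearPotential (magneticField A 0) k x
      = ∫ t in (0 : ℝ)..1, t * ∑ j, magneticField A 0 j k * x j := by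
    rw [intervalIntegral.integral_mul_const, integral_id, linearPotential]
    norm_num
  have hx : Continuous fun t : ℝ => t • x := by fun_prop
  rw [h0, ← intervalIntegral.integral_add, ← intervalIntegral.integral_add]
  · conv_lhs => rw [← integral_radial hA k x]
    refine intervalIntegral.integral_congr fun t _ => ?_
    simp only [partialDeriv_radialPotential hA, gaugeRemainder]
    rw [add_assoc, add_assoc, ← mul_add, ← mul_add, ← Finset.sum_add_distrib,
      ← Finset.sum_add_distrib]
    congr 2
    refine Finset.sum_congr rfl fun j _ => ?_
    have h9 : magneticField A (t • x) j k
        = partialDeriv j (A k) (t • x) - partialDeriv k (A j) (t • x) := rfl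
    rw [h9]
    ring
  · refine Continuous.intervalIntegrable ?_ _ _
    simp only [partialDeriv_radialPotential hA]
    refine Continuous.add (((hA k).continuous.comp hx).add (continuous_id.mul
      (continuous_finsetSum _ fun j _ => ?_))) (by fun_prop)
    exact ((contDiff_partialDeriv_top (hA j) k).continuous.comp hx).mul continuous_const
  · exact ((contDiff_gaugeRemainder hA k).continuous.comp
      (by fun_prop : Continuous fun t : ℝ => (t, x))).intervalIntegrable _ _
  · refine Continuous.intervalIntegrable ?_ _ _
    simp only [partialDeriv_radialPotential hA]
    refine ((hA k).continuous.comp hx).add (continuous_id.mul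
      (continuous_finsetSum _ fun j _ => ?_))
    exact ((contDiff_partialDeriv_top (hA j) k).continuous.comp hx).mul continuous_const
  · exact Continuous.intervalIntegrable (by fun_prop) _ _

theorem partialDeriv_gaugeRemainder (k m : Fin d) (t : ℝ) (x : EuclideanSpace ℝ (Fin d)) :
    partialDeriv m (gaugeRemainder A k t) x
      = t * (magneticField A (t • x) m k - magneticField A 0 m k
        + t * ∑ j, partialDeriv m (fun y => magneticField A y j k) (t • x) * x j) := by
  have hd' : ∀ j, DifferentiableAt ℝ (fun x => magneticField A (t • x) j k) x := fun j =>
    (((contDiff_magneticField hA j k).differentiable (by simp)) (t • x)).comp x (by fun_prop)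
  have hd : ∀ j, DifferentiableAt ℝ
      (fun x => magneticField A (t • x) j k - magneticField A 0 j k) x :=
    fun j => (hd' j).sub (differentiableAt_const _)
  have hc : ∀ j, DifferentiableAt ℝ (fun x : EuclideanSpace ℝ (Fin d) => x j) x :=
    fun j => by fun_prop
  have h1 : ∀ j, partialDeriv m (fun x => magneticField A (t • x) j k - magneticField A 0 j k) x
      = t * partialDeriv m (fun y => magneticField A y j k) (t • x) := by
    intro j
    have := partialDeriv_comp_smul (fun y => magneticField A y j k) t m x
    rw [partialDeriv, fderiv_sub_const]
    exact this
  unfold gaugeRemainder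
  rw [partialDeriv_mul (differentiableAt_const t) (DifferentiableAt.fun_sum fun j _ =>
    (hd j).fun_mul (hc j)), partialDeriv_sum fun j _ => (hd j).fun_mul (hc j)]
  have h2 : partialDeriv m (fun _ : EuclideanSpace ℝ (Fin d) => t) x = 0 := by
    simp [partialDeriv]
  rw [h2]
  simp only [partialDeriv_mul (hd _) (hc _), partialDeriv_coord, h1,
    Finset.sum_add_distrib, mul_ite, mul_one, mul_zero, Finset.sum_ite_eq, Finset.mem_univ, if_true,
    Finset.mul_sum, mul_assoc, zero_mul, Finset.sum_const_zero, add_zero]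

/-- Gauge transformation which turns the potential into the linear one with the field at the origin,
up to a remainder which is controlled by the variation of the field. -/
theorem exists_gauge {κ : ℝ} (hκ : 0 ≤ κ)
    (hB : ∀ j k x, ‖fderiv ℝ (fun y => magneticField A y j k) x‖ ≤ κ) :
    ∃ (φ : EuclideanSpace ℝ (Fin d) → ℝ) (r : Fin d → EuclideanSpace ℝ (Fin d) → ℝ),
      ContDiff ℝ 2 φ ∧ (∀ k, ContDiff ℝ 1 (r k)) ∧
      (∀ k x, A k x = partialDeriv k φ x + (linearPotential (magneticField A 0) k x + r k x)) ∧
      (∀ k x, |r k x| ≤ d * κ * ‖x‖ ^ 2) ∧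
      ∀ k x, |partialDeriv k (r k) x| ≤ (d + 1) * κ * ‖x‖ := by
  set φ : EuclideanSpace ℝ (Fin d) → ℝ := fun x => ∫ t in (0 : ℝ)..1, radialPotential A t x with hφ
  set r : Fin d → EuclideanSpace ℝ (Fin d) → ℝ :=
    fun k x => ∫ t in (0 : ℝ)..1, gaugeRemainder A k t x with hr
  have hφ1 : ContDiff ℝ 1 φ := contDiff_one_integral_unitInterval (contDiff_radialPotential hA)
  have hr1 : ∀ k, ContDiff ℝ 1 (r k) := fun k =>
    contDiff_one_integral_unitInterval (contDiff_gaugeRemainder hA k)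
  have hAk : ∀ k x, A k x
      = partialDeriv k φ x + (linearPotential (magneticField A 0) k x + r k x) := by
    intro k x
    rw [← add_assoc]
    exact radial_gauge hA k x
  have hlip : ∀ j k x, |magneticField A x j k - magneticField A 0 j k| ≤ κ * ‖x‖ := by
    intro j k x
    have := Convex.norm_image_sub_le_of_norm_fderiv_le (𝕜 := ℝ) (C := κ) (s := Set.univ)
      (f := fun y => magneticField A y j k) (x := 0) (y := x)
      (fun y _ => (contDiff_magneticField hA j k).differentiable (by simp) y)
      (fun y _ => hB j k y) convex_univ (Set.mem_univ _) (Set.mem_univ _)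
    simpa using this
  have hcoord : ∀ (x : EuclideanSpace ℝ (Fin d)) j, |x j| ≤ ‖x‖ := fun x j =>
    PiLp.norm_apply_le x j
  have hpart : ∀ m j k x, |partialDeriv m (fun y => magneticField A y j k) x| ≤ κ := by
    intro m j k x
    have := (fderiv ℝ (fun y => magneticField A y j k) x).le_opNorm (EuclideanSpace.single m 1)
    rw [PiLp.norm_single, norm_one, mul_one] at this
    exact this.trans (hB j k x)
  refine ⟨φ, r, ?_, hr1, hAk, ?_, ?_⟩
  -- Differentiation under the integral was only carried out once. The second derivative comes from
  -- the identity for `A_k`: the gradient of `φ` is a difference of `C¹` functions.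
  · rw [show (2 : WithTop ℕ∞) = 1 + 1 by norm_num, contDiff_succ_iff_fderiv]
    refine ⟨hφ1.differentiable (by simp), by simp, ?_⟩
    rw [contDiff_clm_apply_iff]
    intro v
    simp only [fderiv_eq_sum_partialDeriv]
    refine ContDiff.sum fun k _ => contDiff_const.fun_smul ?_
    rw [show partialDeriv k φ = fun x => A k x - (linearPotential (magneticField A 0) k x + r k x)
      from funext fun x => by rw [hAk]; ring]
    exact ((hA k).of_le (by simp)).sub ((contDiff_linearPotential _ k).add (hr1 k))
  · intro k x
    have h1 : ∀ t ∈ Set.uIoc (0 : ℝ) 1, ‖gaugeRemainder A k t x‖ ≤ d * κ * ‖x‖ ^ 2 := by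
      intro t ht
      rw [Set.uIoc_of_le zero_le_one] at ht
      rw [gaugeRemainder, norm_mul, Real.norm_eq_abs, abs_of_pos ht.1]
      have h2 : ‖∑ j, (magneticField A (t • x) j k - magneticField A 0 j k) * x j‖
          ≤ ∑ _j : Fin d, κ * ‖x‖ * ‖x‖ := by
        refine norm_sum_le_of_le _ fun j _ => ?_
        rw [norm_mul]
        refine mul_le_mul ((hlip j k _).trans ?_) (hcoord x j) (norm_nonneg _) (by positivity)
        rw [norm_smul, Real.norm_eq_abs, abs_of_pos ht.1]
        gcongr
        exact mul_le_of_le_one_left (norm_nonneg _) ht.2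
      calc _ ≤ 1 * ∑ _j : Fin d, κ * ‖x‖ * ‖x‖ :=
            mul_le_mul ht.2 h2 (norm_nonneg _) zero_le_one
        _ = _ := by simp; ring
    simpa using intervalIntegral.norm_integral_le_of_norm_le_const h1
  · intro k x
    rw [hr, partialDeriv_integral_unitInterval (contDiff_gaugeRemainder hA k)]
    have h1 : ∀ t ∈ Set.uIoc (0 : ℝ) 1,
        ‖partialDeriv k (gaugeRemainder A k t) x‖ ≤ (d + 1) * κ * ‖x‖ := by
      intro t ht
      rw [Set.uIoc_of_le zero_le_one] at ht
      rw [partialDeriv_gaugeRemainder hA, norm_mul, Real.norm_eq_abs, abs_of_pos ht.1]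
      have h2 : ‖∑ j, partialDeriv k (fun y => magneticField A y j k) (t • x) * x j‖
          ≤ ∑ _j : Fin d, κ * ‖x‖ := by
        refine norm_sum_le_of_le _ fun j _ => ?_
        rw [norm_mul]
        exact mul_le_mul (hpart k j k _) (hcoord x j) (norm_nonneg _) hκ
      have h3 : ‖magneticField A (t • x) k k - magneticField A 0 k k‖ ≤ κ * ‖x‖ := by
        refine (hlip k k _).trans ?_
        rw [norm_smul, Real.norm_eq_abs, abs_of_pos ht.1]
        gcongr
        exact mul_le_of_le_one_left (norm_nonneg _) ht.2
      have h4 : ‖t * ∑ j, partialDeriv k (fun y => magneticField A y j k) (t • x) * x j‖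
          ≤ 1 * ∑ _j : Fin d, κ * ‖x‖ := by
        rw [norm_mul, Real.norm_eq_abs, abs_of_pos ht.1]
        exact mul_le_mul ht.2 h2 (norm_nonneg _) zero_le_one
      calc _ ≤ 1 * (κ * ‖x‖ + 1 * ∑ _j : Fin d, κ * ‖x‖) :=
            mul_le_mul ht.2 (norm_add_le_of_le h3 h4) (norm_nonneg _) zero_le_one
        _ = _ := by simp; ring
    simpa using intervalIntegral.norm_integral_le_of_norm_le_const h1

end Gauge


/-! ### Cutoffs, change of gauge and Caccioppoli's inequality -/

section Localization

open MeasureTheory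

variable {d : ℕ}

theorem partialDeriv_ofReal {χ : EuclideanSpace ℝ (Fin d) → ℝ} {x : EuclideanSpace ℝ (Fin d)}
    (hχ : DifferentiableAt ℝ χ x) (j : Fin d) :
    partialDeriv j (fun y => (χ y : ℂ)) x = ((partialDeriv j χ x : ℝ) : ℂ) := by
  have h : HasFDerivAt (fun y => (χ y : ℂ)) _ x :=
    Complex.ofRealCLM.hasFDerivAt.comp x hχ.hasFDerivAt
  rw [partialDeriv, h.fderiv]
  rfl

theorem differentiableAt_ofReal {χ : EuclideanSpace ℝ (Fin d) → ℝ} {x : EuclideanSpace ℝ (Fin d)}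
    (hχ : DifferentiableAt ℝ χ x) : DifferentiableAt ℝ (fun y => (χ y : ℂ)) x :=
  (Complex.ofRealCLM.hasFDerivAt.comp x hχ.hasFDerivAt).differentiableAt

theorem covariantDeriv_ofReal_mul (A : Fin d → EuclideanSpace ℝ (Fin d) → ℝ)
    {χ : EuclideanSpace ℝ (Fin d) → ℝ} {w : EuclideanSpace ℝ (Fin d) → ℂ}
    {x : EuclideanSpace ℝ (Fin d)} (hχ : DifferentiableAt ℝ χ x) (hw : DifferentiableAt ℝ w x)
    (j : Fin d) :
    covariantDeriv A 1 j (fun y => (χ y : ℂ) * w y) x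
      = χ x * covariantDeriv A 1 j w x - Complex.I * partialDeriv j χ x * w x := by
  rw [covariantDeriv_one, covariantDeriv_one, partialDeriv_mul (differentiableAt_ofReal hχ) hw,
    partialDeriv_ofReal hχ]
  ring

theorem covariantDeriv_add (A : Fin d → EuclideanSpace ℝ (Fin d) → ℝ)
    {f g : EuclideanSpace ℝ (Fin d) → ℂ}
    {x : EuclideanSpace ℝ (Fin d)} (hf : DifferentiableAt ℝ f x) (hg : DifferentiableAt ℝ g x)
    (j : Fin d) :
    covariantDeriv A 1 j (fun y => f y + g y) x
      = covariantDeriv A 1 j f x + covariantDeriv A 1 j g x := by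
  simp only [covariantDeriv_one]
  have : partialDeriv j (fun y => f y + g y) x = partialDeriv j f x + partialDeriv j g x := by
    simp [partialDeriv, fderiv_fun_add hf hg]
  rw [this]
  ring

/-- Changing the gauge. -/
theorem covariantDeriv_gauge {A A' : Fin d → EuclideanSpace ℝ (Fin d) → ℝ}
    {φ : EuclideanSpace ℝ (Fin d) → ℝ} (hφ : Differentiable ℝ φ)
    (hA : ∀ j x, A j x = partialDeriv j φ x + A' j x)
    {u : EuclideanSpace ℝ (Fin d) → ℂ} (hu : Differentiable ℝ u) (j : Fin d) :
    covariantDeriv A' 1 j (fun x => Complex.exp (-Complex.I * φ x) * u x)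
      = fun x => Complex.exp (-Complex.I * φ x) * covariantDeriv A 1 j u x := by
  ext x
  have h1 : HasFDerivAt (fun y => Complex.exp (-Complex.I * φ y)) _ x :=
    ((Complex.ofRealCLM.hasFDerivAt.comp x (hφ x).hasFDerivAt).const_mul (-Complex.I)).cexp
  have h2 : partialDeriv j (fun y => Complex.exp (-Complex.I * φ y)) x
      = Complex.exp (-Complex.I * φ x) * (-Complex.I * partialDeriv j φ x) := by
    rw [partialDeriv, h1.fderiv]
    rfl
  rw [covariantDeriv_one, covariantDeriv_one, partialDeriv_mul h1.differentiableAt (hu x), h2, hA]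
  push_cast
  linear_combination (Complex.exp (-Complex.I * φ x) * ((partialDeriv j φ x : ℝ) : ℂ) * u x) * Complex.I_mul_I

/-- Commuting a cutoff through the magnetic Laplacian, and perturbing the potential. -/
theorem magneticLaplacian_ofReal_mul {a r : Fin d → EuclideanSpace ℝ (Fin d) → ℝ}
    (ha : ∀ j, ContDiff ℝ 1 (a j)) (hr : ∀ j, ContDiff ℝ 1 (r j))
    {χ : EuclideanSpace ℝ (Fin d) → ℝ} (hχ : ContDiff ℝ ∞ χ)
    {w : EuclideanSpace ℝ (Fin d) → ℂ} (hw : ContDiff ℝ 2 w) (x : EuclideanSpace ℝ (Fin d)) :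
    magneticLaplacian a (fun y => (χ y : ℂ) * w y) x
      = χ x * magneticLaplacian (fun k y => a k y + r k y) w x
        + ∑ j, (χ x * (2 * r j x * covariantDeriv (fun k y => a k y + r k y) 1 j w x
            + (r j x : ℂ) ^ 2 * w x - Complex.I * partialDeriv j (r j) x * w x)
          - 2 * Complex.I * partialDeriv j χ x
            * (covariantDeriv (fun k y => a k y + r k y) 1 j w x + r j x * w x)
          - partialDeriv j (partialDeriv j χ) x * w x) := by
  rw [magneticLaplacian, magneticLaplacian, Finset.mul_sum, ← Finset.sum_add_distrib]
  refine Finset.sum_congr rfl fun j _ => ?_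
  set D := covariantDeriv (fun k y => a k y + r k y) 1 j w with hD
  have h11 : (1 : WithTop ℕ∞) + 1 ≤ 2 := by norm_num
  have hD1 : ContDiff ℝ 1 D := contDiff_covariantDeriv hw h11 j ((ha j).add (hr j))
  have hDd : Differentiable ℝ D := hD1.differentiable (by simp)
  have hwd : Differentiable ℝ w := hw.differentiable (by simp)
  have hχd : Differentiable ℝ χ := hχ.differentiable (by simp)
  have hrd : Differentiable ℝ (r j) := (hr j).differentiable (by simp)
  have hχ'd : Differentiable ℝ (partialDeriv j χ) :=
    (contDiff_partialDeriv_top hχ j).differentiable (by simp)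
  have hrw : Differentiable ℝ fun y => (r j y : ℂ) * w y := fun y =>
    (differentiableAt_ofReal (hrd y)).fun_mul (hwd y)
  have hDr : Differentiable ℝ fun y => D y + r j y * w y := hDd.fun_add hrw
  -- Passing from the potential `a + r` to `a` adds `r` to the momentum, so its square produces the
  -- terms `2 r D`, `r²` and the derivative of `r_j` in its own direction; no other derivative of
  -- `r` is needed.
  have haD : ∀ y, covariantDeriv a 1 j w y = D y + r j y * w y := by
    intro y
    rw [hD, covariantDeriv_one, covariantDeriv_one]
    push_cast
    ring
  have haDD : ∀ y, covariantDeriv a 1 j D y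
      = covariantDeriv (fun k y => a k y + r k y) 1 j D y + r j y * D y := by
    intro y
    rw [covariantDeriv_one, covariantDeriv_one]
    push_cast
    ring
  have h1 : covariantDeriv a 1 j (fun y => (χ y : ℂ) * w y)
      = fun y => χ y * (D y + r j y * w y)
        + ((partialDeriv j χ y : ℝ) : ℂ) * (-Complex.I * w y) := by
    ext y
    rw [covariantDeriv_ofReal_mul a (hχd y) (hwd y), haD]
    ring
  have hIw : Differentiable ℝ fun y => -Complex.I * w y := fun y => (hwd y).const_mul _
  have hcI : covariantDeriv a 1 j (fun y => -Complex.I * w y) x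
      = -Complex.I * covariantDeriv a 1 j w x := by
    rw [covariantDeriv_one, covariantDeriv_one]
    have : partialDeriv j (fun y => -Complex.I * w y) x = -Complex.I * partialDeriv j w x := by
      simp [partialDeriv, fderiv_const_mul (hwd x)]
    rw [this]
    ring
  rw [h1, covariantDeriv_add a ((differentiableAt_ofReal (hχd x)).fun_mul (hDr x))
    ((differentiableAt_ofReal (hχ'd x)).fun_mul (hIw x)),
    covariantDeriv_ofReal_mul a (hχd x) (hDr x), covariantDeriv_ofReal_mul a (hχ'd x) (hIw x),
    covariantDeriv_add a (hDd x) (hrw x), covariantDeriv_ofReal_mul a (hrd x) (hwd x), hcI, haDD,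
    haD]
  linear_combination (((partialDeriv j (partialDeriv j χ) x : ℝ) : ℂ) * w x) * Complex.I_mul_I

/-- Caccioppoli's inequality for the magnetic Laplacian. -/
theorem caccioppoli {A : Fin d → EuclideanSpace ℝ (Fin d) → ℝ} (hA : ∀ j, ContDiff ℝ ∞ (A j))
    {q : EuclideanSpace ℝ (Fin d) → ℝ} {M : ℝ} (hqc : Continuous q)
    (hq : ∀ x, |q x| ≤ M) {u : EuclideanSpace ℝ (Fin d) → ℂ} (hu : ContDiff ℝ ∞ u)
    (heq : ∀ x, magneticLaplacian A u x = q x * u x)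
    {η : EuclideanSpace ℝ (Fin d) → ℝ} (hη : ContDiff ℝ ∞ η) (hηc : HasCompactSupport η) :
    ∫ x, η x ^ 2 * ∑ j, ‖covariantDeriv A 1 j u x‖ ^ 2
      ≤ ∫ x, (2 * M * η x ^ 2 + 4 * ∑ j, partialDeriv j η x ^ 2) * ‖u x‖ ^ 2 := by
  set D := fun j => covariantDeriv A 1 j u with hD
  have hDs : ∀ j, ContDiff ℝ ∞ (D j) := fun j => contDiff_covariantDeriv hu (by simp) j (hA j)
  have hηd : Differentiable ℝ η := hη.differentiable (by simp)
  have hud : Differentiable ℝ u := hu.differentiable (by simp)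
  -- The equation is tested against `η² u`.
  set h : EuclideanSpace ℝ (Fin d) → ℂ := fun x => ((η x ^ 2 : ℝ) : ℂ) * u x with hh
  have hη2 : ContDiff ℝ ∞ fun x => η x ^ 2 := hη.pow 2
  have hhs : ContDiff ℝ ∞ h := (Complex.ofRealCLM.contDiff.comp hη2).mul hu
  have hη2c : HasCompactSupport fun x => η x ^ 2 := by
    have := hηc.comp_left (g := fun t : ℝ => t ^ 2) (by simp)
    exact this
  have hhc : HasCompactSupport h := by
    have := (hη2c.comp_left (g := fun t : ℝ => (t : ℂ)) (by simp)).mul_right (f' := u)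
    exact this
  have hDh : ∀ j x, covariantDeriv A 1 j h x
      = (η x : ℂ) ^ 2 * D j x - 2 * Complex.I * η x * partialDeriv j η x * u x := by
    intro j x
    rw [hh, covariantDeriv_ofReal_mul A ((hηd x).fun_pow 2) (hud x)]
    have : partialDeriv j (fun y => η y ^ 2) x = 2 * η x * partialDeriv j η x := by
      simp only [sq]
      rw [partialDeriv_mul (hηd x) (hηd x)]
      ring
    rw [this]
    push_cast
    ring
  have hibp : ∫ x, ∑ j, starRingEnd ℂ (D j x) * covariantDeriv A 1 j h x
      = ∫ x, ((q x * η x ^ 2 * ‖u x‖ ^ 2 : ℝ) : ℂ) := by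
    rw [integral_finsetSum]
    · rw [Finset.sum_congr rfl fun j _ => integral_conj_mul_covariantDeriv_of_hasCompactSupport j
        (hA j).continuous ((hDs j).of_le (by simp)) (hhs.of_le (by simp)) hhc,
        ← integral_finsetSum]
      · refine integral_congr_ae (Filter.Eventually.of_forall fun x => ?_)
        simp only
        rw [← Finset.sum_mul, ← map_sum]
        have h1 : ∑ j, covariantDeriv A 1 j (D j) x = q x * u x := heq x
        rw [h1, hh, map_mul, Complex.conj_ofReal]
        have h2 := Complex.mul_conj' (u x)
        push_cast
        linear_combination ((q x : ℂ) * (η x : ℂ) ^ 2) * h2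
      · intro j _
        refine Continuous.integrable_of_hasCompactSupport ?_ hhc.mul_left
        exact (Complex.continuous_conj.comp (contDiff_covariantDeriv (m := ∞) (hDs j) (by simp) j
          (hA j)).continuous).mul hhs.continuous
    · intro j _
      refine Continuous.integrable_of_hasCompactSupport ?_
        (hasCompactSupport_covariantDeriv hhc j).mul_left
      exact (Complex.continuous_conj.comp (hDs j).continuous).mul
        (contDiff_covariantDeriv (m := ∞) hhs (by simp) j (hA j)).continuous
  set S : EuclideanSpace ℝ (Fin d) → ℂ :=
    fun x => ∑ j, starRingEnd ℂ (D j x) * covariantDeriv A 1 j h x with hS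
  have hSi : Integrable S := by
    refine integrable_finsetSum _ fun j _ => Continuous.integrable_of_hasCompactSupport ?_
        (hasCompactSupport_covariantDeriv hhc j).mul_left
    exact (Complex.continuous_conj.comp (hDs j).continuous).mul
        (contDiff_covariantDeriv (m := ∞) hhs (by simp) j (hA j)).continuous
  have hre : ∫ x, (S x).re = ∫ x, q x * η x ^ 2 * ‖u x‖ ^ 2 := by
    have h1 := congrArg Complex.re hibp
    rw [integral_complex_ofReal, Complex.ofReal_re] at h1
    rw [← h1]
    exact integral_re (𝕜 := ℂ) hSi
  -- The cross term is absorbed by `2 a b ≤ a² / 2 + 2 b²`, with `a = |η| ‖D_j u‖` and `b = |∂_j η|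
  -- ‖u‖`; half of the gradient term survives.
  have hlow : ∀ x, (1 / 2) * (η x ^ 2 * ∑ j, ‖D j x‖ ^ 2)
      ≤ (S x).re + 2 * (∑ j, partialDeriv j η x ^ 2) * ‖u x‖ ^ 2 := by
    intro x
    have h1 : (S x).re = ∑ j, (starRingEnd ℂ (D j x) * covariantDeriv A 1 j h x).re := by
      simp [hS]
    rw [h1, Finset.mul_sum, Finset.mul_sum, Finset.mul_sum, Finset.sum_mul,
      ← Finset.sum_add_distrib]
    refine Finset.sum_le_sum fun j _ => ?_
    have h2 : starRingEnd ℂ (D j x) * covariantDeriv A 1 j h x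
        = ((η x ^ 2 * ‖D j x‖ ^ 2 : ℝ) : ℂ)
          - ((2 * η x * partialDeriv j η x : ℝ) : ℂ) * (Complex.I * u x * starRingEnd ℂ (D j x)) := by
      rw [hDh]
      have := Complex.mul_conj' (D j x)
      push_cast
      linear_combination (η x : ℂ) ^ 2 * this
    rw [h2, Complex.sub_re, Complex.ofReal_re, Complex.re_ofReal_mul]
    have h3 : |(Complex.I * u x * starRingEnd ℂ (D j x)).re| ≤ ‖u x‖ * ‖D j x‖ := by
      refine (Complex.abs_re_le_norm _).trans ?_
      simp
    have h4 : 2 * η x * partialDeriv j η x * (Complex.I * u x * starRingEnd ℂ (D j x)).re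
        ≤ 2 * (|η x| * ‖D j x‖) * (|partialDeriv j η x| * ‖u x‖) := by
      refine (le_abs_self _).trans ?_
      rw [abs_mul, abs_mul, abs_mul, abs_two]
      calc _ ≤ 2 * |η x| * |partialDeriv j η x| * (‖u x‖ * ‖D j x‖) := by gcongr
        _ = _ := by ring
    have h5 := sq_nonneg (|η x| * ‖D j x‖ - 2 * (|partialDeriv j η x| * ‖u x‖))
    have h6 : (|η x| * ‖D j x‖) ^ 2 = η x ^ 2 * ‖D j x‖ ^ 2 := by rw [mul_pow, sq_abs]
    have h7 : (|partialDeriv j η x| * ‖u x‖) ^ 2 = partialDeriv j η x ^ 2 * ‖u x‖ ^ 2 := by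
      rw [mul_pow, sq_abs]
    nlinarith
  have hi1 : Integrable fun x => η x ^ 2 * ∑ j, ‖D j x‖ ^ 2 := by
    refine Continuous.integrable_of_hasCompactSupport ?_ hη2c.mul_right
    exact hη2.continuous.mul (continuous_finsetSum _ fun j _ => (hDs j).continuous.norm.pow 2)
  have hi2 : Integrable fun x => 2 * (∑ j, partialDeriv j η x ^ 2) * ‖u x‖ ^ 2 := by
    have : (fun x => 2 * (∑ j, partialDeriv j η x ^ 2) * ‖u x‖ ^ 2)
        = fun x => ∑ j, partialDeriv j η x * (2 * partialDeriv j η x * ‖u x‖ ^ 2) := by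
      ext x
      rw [Finset.mul_sum, Finset.sum_mul]
      exact Finset.sum_congr rfl fun j _ => by ring
    rw [this]
    refine integrable_finsetSum _ fun j _ => Continuous.integrable_of_hasCompactSupport ?_
      (hasCompactSupport_partialDeriv hηc j).mul_right
    have h1 := (contDiff_partialDeriv_top hη j).continuous
    exact h1.mul ((continuous_const.mul h1).mul (hu.continuous.norm.pow 2))
  have hi3 : Integrable fun x => M * (η x ^ 2 * ‖u x‖ ^ 2) := by
    refine Integrable.const_mul (Continuous.integrable_of_hasCompactSupport ?_ hη2c.mul_right) _
    exact hη2.continuous.mul (hu.continuous.norm.pow 2)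
  have hSre : Integrable fun x => (S x).re := hSi.re
  have hle : ∫ x, q x * η x ^ 2 * ‖u x‖ ^ 2 ≤ ∫ x, M * (η x ^ 2 * ‖u x‖ ^ 2) := by
    refine integral_mono (Continuous.integrable_of_hasCompactSupport ?_
      (hη2c.mul_left (f := q)).mul_right) hi3 fun x => ?_
    · exact (hqc.mul hη2.continuous).mul (hu.continuous.norm.pow 2)
    · simp only
      rw [mul_assoc]
      have := (abs_le.1 (hq x)).2
      gcongr
  have hmain : (1 / 2) * ∫ x, η x ^ 2 * ∑ j, ‖D j x‖ ^ 2
      ≤ (∫ x, (S x).re) + ∫ x, 2 * (∑ j, partialDeriv j η x ^ 2) * ‖u x‖ ^ 2 := by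
    rw [← integral_const_mul, ← integral_add hSre hi2]
    exact integral_mono (hi1.const_mul _) (hSre.add hi2) hlow
  have hsplit : ∫ x, (2 * M * η x ^ 2 + 4 * ∑ j, partialDeriv j η x ^ 2) * ‖u x‖ ^ 2
      = 2 * (∫ x, M * (η x ^ 2 * ‖u x‖ ^ 2))
        + 2 * ∫ x, 2 * (∑ j, partialDeriv j η x ^ 2) * ‖u x‖ ^ 2 := by
    rw [← integral_const_mul, ← integral_const_mul, ← integral_add (hi3.const_mul _)
      (hi2.const_mul _)]
    refine integral_congr_ae (Filter.Eventually.of_forall fun x => ?_)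
    simp only
    ring
  rw [hsplit]
  rw [hre] at hmain
  linarith

end Localization


/-! ### Smallness of eigenfunctions at nonresonant points, at unit scale -/

section LocalEstimate

open MeasureTheory

variable {d : ℕ}

theorem partialDeriv_eventually_eq_zero {f : EuclideanSpace ℝ (Fin d) → ℝ}
    {x : EuclideanSpace ℝ (Fin d)} (h : f =ᶠ[nhds x] 0) (j : Fin d) :
    partialDeriv j f =ᶠ[nhds x] 0 := by
  filter_upwards [h.eventuallyEq_nhds] with y hy
  rw [partialDeriv, hy.fderiv_eq]
  simp

/-- Cutoff functions at every scale `R`, with derivatives controlled by a common constant. -/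
theorem exists_cutoff (d : ℕ) : ∃ c : ℝ, 0 ≤ c ∧ ∀ R : ℝ, 0 < R →
    ∃ χ : EuclideanSpace ℝ (Fin d) → ℝ, ContDiff ℝ ∞ χ ∧ HasCompactSupport χ ∧
      (∀ x, 0 ≤ χ x) ∧ (∀ x, χ x ≤ 1) ∧ (∀ x, ‖x‖ ≤ R / 2 → χ x = 1) ∧
      (∀ x, R < ‖x‖ → χ x = 0 ∧ ∀ j, partialDeriv j χ x = 0 ∧
        partialDeriv j (partialDeriv j χ) x = 0) ∧
      (∀ j x, |partialDeriv j χ x| ≤ c / R) ∧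
      ∀ j x, |partialDeriv j (partialDeriv j χ) x| ≤ c / R ^ 2 := by
  -- All cutoffs are dilations of one bump, so the constant does not depend on `R` and `R` may later
  -- be chosen in terms of it.
  let f : ContDiffBump (0 : EuclideanSpace ℝ (Fin d)) := ⟨1 / 2, 1, by norm_num, by norm_num⟩
  have hf : ContDiff ℝ ∞ f := f.contDiff
  have hfc : HasCompactSupport f := f.hasCompactSupport
  have hb1 : ∀ j, ∃ C, ∀ x, ‖partialDeriv j f x‖ ≤ C := fun j =>
    (hasCompactSupport_partialDeriv hfc j).exists_bound_of_continuous
      (contDiff_partialDeriv_top hf j).continuous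
  have hb2 : ∀ j, ∃ C, ∀ x, ‖partialDeriv j (partialDeriv j f) x‖ ≤ C := fun j =>
    (hasCompactSupport_partialDeriv (hasCompactSupport_partialDeriv hfc j) j
      ).exists_bound_of_continuous
      (contDiff_partialDeriv_top (contDiff_partialDeriv_top hf j) j).continuous
  choose C1 hC1 using hb1
  choose C2 hC2 using hb2
  have hC1' : ∀ j, 0 ≤ C1 j := fun j => (norm_nonneg _).trans (hC1 j 0)
  have hC2' : ∀ j, 0 ≤ C2 j := fun j => (norm_nonneg _).trans (hC2 j 0)
  refine ⟨∑ j, (C1 j + C2 j), Finset.sum_nonneg fun j _ => add_nonneg (hC1' j) (hC2' j), ?_⟩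
  intro R hR
  have hle : ∀ j, C1 j + C2 j ≤ ∑ j, (C1 j + C2 j) := fun j =>
    Finset.single_le_sum (f := fun j => C1 j + C2 j)
      (fun j _ => add_nonneg (hC1' j) (hC2' j)) (Finset.mem_univ j)
  have hd1 : ∀ j, partialDeriv j (fun x => f (R⁻¹ • x))
      = fun x => R⁻¹ * partialDeriv j f (R⁻¹ • x) := fun j =>
    funext fun x => partialDeriv_comp_smul f R⁻¹ j x
  have hd2 : ∀ j, partialDeriv j (partialDeriv j (fun x => f (R⁻¹ • x)))
      = fun x => R⁻¹ * (R⁻¹ * partialDeriv j (partialDeriv j f) (R⁻¹ • x)) := by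
    intro j
    ext x
    have h1 := partialDeriv_comp_smul (partialDeriv j f) R⁻¹ j x
    have h2 : DifferentiableAt ℝ (fun x => partialDeriv j f (R⁻¹ • x)) x :=
      ((contDiff_partialDeriv_top hf j).differentiable (by simp) _).comp x (by fun_prop)
    rw [hd1, partialDeriv, fderiv_const_mul h2]
    exact congrArg (R⁻¹ * ·) h1
  refine ⟨fun x => f (R⁻¹ • x), hf.comp (by fun_prop), ?_, fun x => f.nonneg, fun x => f.le_one,
    ?_, ?_, ?_, ?_⟩
  · exact hfc.comp_homeomorph (Homeomorph.smulOfNeZero R⁻¹ (inv_ne_zero hR.ne'))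
  · intro x hx
    refine f.one_of_mem_closedBall ?_
    rw [mem_closedBall_zero_iff, norm_smul, norm_inv, Real.norm_eq_abs, abs_of_pos hR]
    change R⁻¹ * ‖x‖ ≤ 1 / 2
    rw [inv_mul_le_iff₀ hR]
    linarith
  · intro x hx
    have h1 : R⁻¹ • x ∉ tsupport f := by
      rw [f.tsupport_eq, mem_closedBall_zero_iff, norm_smul, norm_inv, Real.norm_eq_abs,
        abs_of_pos hR, not_le]
      change 1 < R⁻¹ * ‖x‖
      rw [lt_inv_mul_iff₀ hR]
      linarith
    have h2 := notMem_tsupport_iff_eventuallyEq.1 h1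
    have h3 := fun j => partialDeriv_eventually_eq_zero h2 j
    have h4 := fun j => partialDeriv_eventually_eq_zero (h3 j) j
    refine ⟨h2.eq_of_nhds, fun j => ⟨?_, ?_⟩⟩
    · rw [hd1]; simp [(h3 j).eq_of_nhds]
    · rw [hd2]; simp [(h4 j).eq_of_nhds]
  · intro j x
    rw [hd1]
    simp only
    rw [abs_mul, abs_of_pos (inv_pos.2 hR), inv_mul_eq_div]
    gcongr
    exact (hC1 j _).trans ((le_add_of_nonneg_right (hC2' j)).trans (hle j))
  · intro j x
    rw [hd2]
    simp only
    rw [abs_mul, abs_mul, abs_of_pos (inv_pos.2 hR), inv_mul_eq_div, inv_mul_eq_div, div_div, ← sq]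
    gcongr
    exact (hC2 j _).trans ((le_add_of_nonneg_left (hC1' j)).trans (hle j))

/-- Every coefficient of the localization error is `O(1 / R)`; `R ≥ 1` allows one factor of `r_j²`
to be replaced by `d`. The inner polynomial in `d` and `c` dominates the coefficients term by term,
while `(d + 1)²` and the factor `2` come from Cauchy–Schwarz and from squaring a sum. -/
theorem localized_error_bound {c R : ℝ} (hc : 0 ≤ c) (hR : 1 ≤ R) {P : Fin d → ℂ} {w χ : ℂ}
    {r r' χ' χ'' : Fin d → ℝ} {v : ℝ} (hχ : ‖χ‖ ≤ 1) (hr : ∀ j, |r j| ≤ d / R)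
    (hr' : ∀ j, |r' j| ≤ (d + 1) / R) (hχ' : ∀ j, |χ' j| ≤ c / R) (hχ'' : ∀ j, |χ'' j| ≤ c / R)
    (hv : |v| ≤ 1 / R) :
    ‖∑ j, (χ * (2 * r j * P j + (r j : ℂ) ^ 2 * w - Complex.I * r' j * w)
        - 2 * Complex.I * χ' j * (P j + r j * w) - χ'' j * w) + χ * v * w‖ ^ 2
      ≤ 2 * ((d + 1) * (d ^ 2 + 3 * d + 2 * c * d + 3 * c + 2)) ^ 2 / R ^ 2
        * (∑ j, ‖P j‖ ^ 2 + ‖w‖ ^ 2) := by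
  have hR0 : 0 < R := by linarith
  set K : ℝ := d ^ 2 + 3 * d + 2 * c * d + 3 * c + 2 with hK
  have hd : (0 : ℝ) ≤ d := Nat.cast_nonneg d
  have hK0 : 0 ≤ K := by positivity
  have hterm : ∀ j, ‖χ * (2 * r j * P j + (r j : ℂ) ^ 2 * w - Complex.I * r' j * w)
        - 2 * Complex.I * χ' j * (P j + r j * w) - χ'' j * w‖ ≤ K / R * (‖P j‖ + ‖w‖) := by
    intro j
    have hrd : |r j| ≤ d := (hr j).trans (div_le_self hd hR)
    have e1 : ‖χ * (2 * r j * P j + (r j : ℂ) ^ 2 * w - Complex.I * r' j * w)‖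
        ≤ 1 * (2 * (d / R) * ‖P j‖ + d / R * d * ‖w‖ + (d + 1) / R * ‖w‖) := by
      rw [norm_mul]
      refine mul_le_mul hχ ?_ (norm_nonneg _) zero_le_one
      refine (norm_sub_le _ _).trans (add_le_add ((norm_add_le _ _).trans (add_le_add ?_ ?_)) ?_)
      · rw [norm_mul, norm_mul, Complex.norm_real, Complex.norm_ofNat, Real.norm_eq_abs]
        gcongr
        exact hr j
      · rw [norm_mul, norm_pow, Complex.norm_real, Real.norm_eq_abs, sq]
        gcongr
        exact hr j
      · rw [norm_mul, norm_mul, Complex.norm_real, Complex.norm_I, one_mul, Real.norm_eq_abs]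
        gcongr
        exact hr' j
    have e2 : ‖2 * Complex.I * χ' j * (P j + r j * w)‖ ≤ 2 * (c / R) * (‖P j‖ + d * ‖w‖) := by
      rw [norm_mul, norm_mul, norm_mul, Complex.norm_real, Complex.norm_I, Complex.norm_ofNat,
        mul_one, Real.norm_eq_abs]
      gcongr
      · exact hχ' j
      · refine (norm_add_le _ _).trans ?_
        rw [norm_mul, Complex.norm_real, Real.norm_eq_abs]
        gcongr
    have e3 : ‖(χ'' j : ℂ) * w‖ ≤ c / R * ‖w‖ := by
      rw [norm_mul, Complex.norm_real, Real.norm_eq_abs]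
      gcongr
      exact hχ'' j
    refine (norm_sub_le _ _).trans ((add_le_add ((norm_sub_le _ _).trans (add_le_add e1 e2)) e3).trans
      ?_)
    have h1 : 1 * (2 * (d / R) * ‖P j‖ + d / R * d * ‖w‖ + (d + 1) / R * ‖w‖)
        + 2 * (c / R) * (‖P j‖ + d * ‖w‖) + c / R * ‖w‖
        = ((2 * d + 2 * c) * ‖P j‖ + (d ^ 2 + d + 1 + 2 * c * d + c) * ‖w‖) / R := by
      field_simp; ring
    rw [h1, div_mul_eq_mul_div]
    refine div_le_div_of_nonneg_right ?_ hR0.le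
    rw [mul_add]
    have hcd : 0 ≤ c * d := mul_nonneg hc hd
    have hd2 : (0 : ℝ) ≤ d ^ 2 := by positivity
    gcongr
    · rw [hK]; linarith
    · rw [hK]; linarith
  have hlast : ‖χ * v * w‖ ≤ K / R * ‖w‖ := by
    rw [norm_mul, norm_mul, Complex.norm_real, Real.norm_eq_abs]
    have : |v| ≤ K / R := hv.trans (by
      gcongr
      have hcd : 0 ≤ c * d := mul_nonneg hc hd
      have hd2 : (0 : ℝ) ≤ d ^ 2 := by positivity
      rw [hK]; linarith)
    calc _ ≤ 1 * (K / R) * ‖w‖ := by gcongr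
      _ = _ := by ring
  have hsum : ‖∑ j, (χ * (2 * r j * P j + (r j : ℂ) ^ 2 * w - Complex.I * r' j * w)
        - 2 * Complex.I * χ' j * (P j + r j * w) - χ'' j * w) + χ * v * w‖
      ≤ K / R * (∑ j, ‖P j‖ + (d + 1) * ‖w‖) := by
    refine (norm_add_le_of_le (norm_sum_le_of_le _ fun j _ => hterm j) hlast).trans (le_of_eq ?_)
    rw [← Finset.mul_sum, Finset.sum_add_distrib]
    simp
    ring
  have hcs : (∑ j, ‖P j‖) ^ 2 ≤ d * ∑ j, ‖P j‖ ^ 2 := by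
    have := sq_sum_le_card_mul_sum_sq (s := (Finset.univ : Finset (Fin d))) (f := fun j => ‖P j‖)
    simpa using this
  have hsq0 : 0 ≤ ∑ j, ‖P j‖ ^ 2 := Finset.sum_nonneg fun j _ => by positivity
  calc _ ≤ (K / R * (∑ j, ‖P j‖ + (d + 1) * ‖w‖)) ^ 2 := by gcongr
    _ = (K / R) ^ 2 * (∑ j, ‖P j‖ + (d + 1) * ‖w‖) ^ 2 := by ring
    _ ≤ (K / R) ^ 2 * (2 * (d + 1) ^ 2 * (∑ j, ‖P j‖ ^ 2 + ‖w‖ ^ 2)) := by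
      gcongr
      have h1 := sq_nonneg (∑ j, ‖P j‖ - (d + 1) * ‖w‖)
      have h2 : (d : ℝ) * ∑ j, ‖P j‖ ^ 2 ≤ (d + 1) ^ 2 * ∑ j, ‖P j‖ ^ 2 := by
        gcongr; nlinarith
      nlinarith
    _ = _ := by rw [hK]; field_simp

theorem integral_le_setIntegral_of_le_indicator {f g : EuclideanSpace ℝ (Fin d) → ℝ} {ρ : ℝ}
    (hf : ∀ x, 0 ≤ f x) (hg : Continuous g)
    (h : ∀ x, f x ≤ (Metric.closedBall 0 ρ).indicator g x) :
    ∫ x, f x ≤ ∫ x in Metric.closedBall 0 ρ, g x := by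
  rw [← integral_indicator measurableSet_closedBall]
  refine integral_mono_of_nonneg (Filter.Eventually.of_forall hf) ?_
    (Filter.Eventually.of_forall h)
  rw [integrable_indicator_iff measurableSet_closedBall]
  exact hg.continuousOn.integrableOn_compact (isCompact_closedBall 0 ρ)

theorem setIntegral_le_integral_of_le_on {f g : EuclideanSpace ℝ (Fin d) → ℝ} {ρ : ℝ}
    (hf : ∀ x, 0 ≤ f x) (hg : Continuous g) (hgc : HasCompactSupport g) (hg0 : ∀ x, 0 ≤ g x)
    (h : ∀ x, ‖x‖ ≤ ρ → f x ≤ g x) :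
    ∫ x in Metric.closedBall 0 ρ, f x ≤ ∫ x, g x := by
  rw [← integral_indicator measurableSet_closedBall]
  refine integral_mono_of_nonneg (Filter.Eventually.of_forall fun x =>
    Set.indicator_nonneg (fun y _ => hf y) x) (hg.integrable_of_hasCompactSupport hgc)
    (Filter.Eventually.of_forall fun x => ?_)
  by_cases hx : x ∈ Metric.closedBall (0 : EuclideanSpace ℝ (Fin d)) ρ
  · rw [Set.indicator_of_mem hx]
    exact h x (mem_closedBall_zero_iff.1 hx)
  · rw [Set.indicator_of_notMem hx]
    exact hg0 x

/-- The covariant derivatives of an eigenfunction are controlled by the eigenfunction on a larger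
ball. -/
theorem integral_covariantDeriv_closedBall_le {A : Fin d → EuclideanSpace ℝ (Fin d) → ℝ}
    (hA : ∀ j, ContDiff ℝ ∞ (A j)) {q : EuclideanSpace ℝ (Fin d) → ℝ} (hqc : Continuous q)
    {M : ℝ} (hM : 0 ≤ M) (hq : ∀ x, |q x| ≤ M) {u : EuclideanSpace ℝ (Fin d) → ℂ}
    (hu : ContDiff ℝ ∞ u) (heq : ∀ x, magneticLaplacian A u x = (q x : ℂ) * u x)
    {R c : ℝ} {η : EuclideanSpace ℝ (Fin d) → ℝ}
    (hη : ContDiff ℝ ∞ η) (hηc : HasCompactSupport η) (hη0 : ∀ x, 0 ≤ η x) (hη1 : ∀ x, η x ≤ 1)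
    (hηone : ∀ x, ‖x‖ ≤ R → η x = 1)
    (hηout : ∀ x, 2 * R < ‖x‖ → η x = 0 ∧ ∀ j, partialDeriv j η x = 0)
    (hη' : ∀ j x, |partialDeriv j η x| ≤ c) :
    ∫ x in Metric.closedBall 0 R, ∑ j, ‖covariantDeriv A 1 j u x‖ ^ 2
      ≤ (2 * M + 4 * d * c ^ 2) * ∫ x in Metric.closedBall 0 (2 * R), ‖u x‖ ^ 2 := by
  have hDcont : Continuous fun x => ∑ j, ‖covariantDeriv A 1 j u x‖ ^ 2 :=
    continuous_finsetSum _ fun j _ =>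
      (contDiff_covariantDeriv (n := ∞) hu (by simp) j (hA j)).continuous.norm.pow 2
  have hD0 : ∀ x, 0 ≤ ∑ j, ‖covariantDeriv A 1 j u x‖ ^ 2 := fun x =>
    Finset.sum_nonneg fun _ _ => by positivity
  have hI2 : ∫ x in Metric.closedBall 0 R, ∑ j, ‖covariantDeriv A 1 j u x‖ ^ 2
      ≤ ∫ x, η x ^ 2 * ∑ j, ‖covariantDeriv A 1 j u x‖ ^ 2 := by
    refine setIntegral_le_integral_of_le_on hD0 ((hη.continuous.pow 2).mul hDcont) ?_
      (fun x => mul_nonneg (sq_nonneg _) (hD0 x)) (fun x hx => ?_)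
    · have := (hηc.comp_left (g := fun t : ℝ => t ^ 2) (by simp)).mul_right
        (f' := fun x => ∑ j, ‖covariantDeriv A 1 j u x‖ ^ 2)
      exact this
    · rw [hηone x hx, one_pow, one_mul]
  have hcacc := caccioppoli hA hqc hq hu heq hη hηc
  refine hI2.trans (hcacc.trans ?_)
  rw [← integral_const_mul]
  refine integral_le_setIntegral_of_le_indicator (fun x => ?_)
    (continuous_const.mul (hu.continuous.norm.pow 2)) (fun x => ?_)
  · have : 0 ≤ ∑ j, partialDeriv j η x ^ 2 := Finset.sum_nonneg fun _ _ => by positivity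
    positivity
  · by_cases hx : ‖x‖ ≤ 2 * R
    · rw [Set.indicator_of_mem (mem_closedBall_zero_iff.2 hx)]
      have h1 : ∑ j, partialDeriv j η x ^ 2 ≤ d * c ^ 2 := by
        have h2 : ∀ j ∈ (Finset.univ : Finset (Fin d)), partialDeriv j η x ^ 2 ≤ c ^ 2 := by
          intro j _
          rw [← sq_abs (partialDeriv j η x)]
          have := hη' j x
          gcongr
        refine (Finset.sum_le_card_nsmul _ _ _ h2).trans (le_of_eq ?_)
        simp
      have h2 : η x ^ 2 ≤ 1 := pow_le_one₀ (hη0 x) (hη1 x)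
      refine mul_le_mul_of_nonneg_right ?_ (by positivity)
      nlinarith
    · rw [Set.indicator_of_notMem (by rwa [mem_closedBall_zero_iff])]
      obtain ⟨h1, h2⟩ := hηout x (not_le.1 hx)
      simp [h1, h2]

/-- An eigenfunction in the gauge adapted to the linear potential of the field at the origin. -/
theorem exists_gauge_transform {A : Fin d → EuclideanSpace ℝ (Fin d) → ℝ}
    (hA : ∀ j, ContDiff ℝ ∞ (A j)) {κ : ℝ} (hκ : 0 ≤ κ)
    (hB : ∀ j k x, ‖fderiv ℝ (fun y => magneticField A y j k) x‖ ≤ κ)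
    {u : EuclideanSpace ℝ (Fin d) → ℂ} (hu : ContDiff ℝ ∞ u)
    {q : EuclideanSpace ℝ (Fin d) → ℂ} (heq : ∀ x, magneticLaplacian A u x = q x * u x) :
    ∃ (r : Fin d → EuclideanSpace ℝ (Fin d) → ℝ) (w : EuclideanSpace ℝ (Fin d) → ℂ),
      ContDiff ℝ 2 w ∧ (∀ k, ContDiff ℝ 1 (r k)) ∧
      (∀ k x, |r k x| ≤ d * κ * ‖x‖ ^ 2) ∧
      (∀ k x, |partialDeriv k (r k) x| ≤ (d + 1) * κ * ‖x‖) ∧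
      (∀ x, ‖w x‖ = ‖u x‖) ∧
      (∀ j x, ‖covariantDeriv (fun k y => linearPotential (magneticField A 0) k y + r k y) 1 j w x‖
        = ‖covariantDeriv A 1 j u x‖) ∧
      ∀ x, magneticLaplacian (fun k y => linearPotential (magneticField A 0) k y + r k y) w x
        = q x * w x := by
  obtain ⟨φ, r, hφ, hr, hAφ, hr0, hr'⟩ := exists_gauge hA hκ hB
  have hφd : Differentiable ℝ φ := hφ.differentiable (by simp)
  have hgn : ∀ x, ‖Complex.exp (-Complex.I * φ x)‖ = 1 := by
    intro x
    rw [show -Complex.I * (φ x : ℂ) = ((-φ x : ℝ) : ℂ) * Complex.I by push_cast; ring,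
      Complex.norm_exp_ofReal_mul_I]
  have hgs : ContDiff ℝ 2 (fun x => Complex.exp (-Complex.I * φ x)) :=
    (contDiff_const.mul (Complex.ofRealCLM.contDiff.comp hφ)).cexp
  have hDs : ∀ j, ContDiff ℝ ∞ (covariantDeriv A 1 j u) := fun j =>
    contDiff_covariantDeriv hu (by simp) j (hA j)
  have hDw := covariantDeriv_gauge hφd hAφ (hu.differentiable (by simp))
  refine ⟨r, fun x => Complex.exp (-Complex.I * φ x) * u x, hgs.mul (contDiff_infty.1 hu 2), hr,
    hr0, hr', fun x => by rw [norm_mul, hgn, one_mul], fun j x => ?_, fun x => ?_⟩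
  · rw [hDw]
    simp only
    rw [norm_mul, hgn, one_mul]
  · have h1 : magneticLaplacian (fun k y => linearPotential (magneticField A 0) k y + r k y)
        (fun x => Complex.exp (-Complex.I * φ x) * u x) x
        = Complex.exp (-Complex.I * φ x) * magneticLaplacian A u x := by
      rw [magneticLaplacian, magneticLaplacian, Finset.mul_sum]
      refine Finset.sum_congr rfl fun j _ => ?_
      rw [hDw, covariantDeriv_gauge hφd hAφ ((hDs j).differentiable (by simp)) j]
    rw [h1, heq]
    ring

/-- The error made by localizing an eigenfunction to a ball of radius `R` and by replacing the
operator with the model operator. -/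
theorem norm_magneticLaplacian_cutoff_le {a r : Fin d → EuclideanSpace ℝ (Fin d) → ℝ}
    (ha : ∀ j, ContDiff ℝ 1 (a j)) (hr : ∀ j, ContDiff ℝ 1 (r j))
    {χ : EuclideanSpace ℝ (Fin d) → ℝ} (hχ : ContDiff ℝ ∞ χ)
    {w : EuclideanSpace ℝ (Fin d) → ℂ} (hw : ContDiff ℝ 2 w)
    {c R ν : ℝ} (hc : 0 ≤ c) (hR : 1 ≤ R) {q : EuclideanSpace ℝ (Fin d) → ℝ}
    (hr0 : ∀ j x, |r j x| ≤ d * (1 / R ^ 3) * ‖x‖ ^ 2)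
    (hr' : ∀ j x, |partialDeriv j (r j) x| ≤ (d + 1) * (1 / R ^ 3) * ‖x‖)
    (hq : ∀ x, |q x - ν| ≤ 1 / R ^ 3 * ‖x‖)
    (hχ0 : ∀ x, 0 ≤ χ x) (hχ1 : ∀ x, χ x ≤ 1)
    (hχout : ∀ x, R < ‖x‖ → χ x = 0 ∧ ∀ j, partialDeriv j χ x = 0 ∧
        partialDeriv j (partialDeriv j χ) x = 0)
    (hχ' : ∀ j x, |partialDeriv j χ x| ≤ c / R)
    (hχ'' : ∀ j x, |partialDeriv j (partialDeriv j χ) x| ≤ c / R ^ 2)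
    (heq : ∀ x, magneticLaplacian (fun k y => a k y + r k y) w x = (q x : ℂ) * w x)
    (x : EuclideanSpace ℝ (Fin d)) :
    ‖magneticLaplacian a (fun y => (χ y : ℂ) * w y) x - (ν : ℂ) * ((χ x : ℂ) * w x)‖ ^ 2
      ≤ (Metric.closedBall 0 R).indicator (fun x =>
        2 * ((d + 1) * (d ^ 2 + 3 * d + 2 * c * d + 3 * c + 2)) ^ 2 / R ^ 2 *
        (∑ j, ‖covariantDeriv (fun k y => a k y + r k y) 1 j w x‖ ^ 2 + ‖w x‖ ^ 2)) x := by
  have hR0 : 0 < R := by linarith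
  have hlap := magneticLaplacian_ofReal_mul ha hr hχ hw x
  by_cases hx : ‖x‖ ≤ R
  · rw [Set.indicator_of_mem (mem_closedBall_zero_iff.2 hx)]
    have hsplit : magneticLaplacian a (fun y => (χ y : ℂ) * w y) x - (ν : ℂ) * ((χ x : ℂ) * w x)
        = ∑ j, ((χ x : ℂ) * (2 * r j x * covariantDeriv (fun k y => a k y + r k y) 1 j w x
          + (r j x : ℂ) ^ 2 * w x - Complex.I * partialDeriv j (r j) x * w x)
        - 2 * Complex.I * partialDeriv j χ x
          * (covariantDeriv (fun k y => a k y + r k y) 1 j w x + r j x * w x)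
        - partialDeriv j (partialDeriv j χ) x * w x)
        + (χ x : ℂ) * ((q x - ν : ℝ) : ℂ) * w x := by
      rw [hlap, heq]
      push_cast
      ring
    rw [hsplit]
    have hRR : R ≤ R ^ 2 := by nlinarith
    refine localized_error_bound hc hR ?_ (fun j => ?_) (fun j => ?_) (fun j => hχ' j x)
      (fun j => ?_) ?_
    · rw [Complex.norm_real, Real.norm_eq_abs, abs_of_nonneg (hχ0 x)]
      exact hχ1 x
    -- The slow-variation constant `1 / R³` is calibrated here: the quadratic remainder on a ball of
    -- radius `R` has to be `O(1 / R)`.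
    · calc |r j x| ≤ d * (1 / R ^ 3) * ‖x‖ ^ 2 := hr0 j x
        _ ≤ d * (1 / R ^ 3) * R ^ 2 := by gcongr
        _ = d / R := by field_simp
    · calc |partialDeriv j (r j) x| ≤ (d + 1) * (1 / R ^ 3) * ‖x‖ := hr' j x
        _ ≤ (d + 1) * (1 / R ^ 3) * R ^ 2 := by gcongr; exact hx.trans hRR
        _ = (d + 1) / R := by field_simp
    · exact (hχ'' j x).trans (by gcongr)
    · calc |q x - ν| ≤ 1 / R ^ 3 * ‖x‖ := hq x
        _ ≤ 1 / R ^ 3 * R ^ 2 := by gcongr; exact hx.trans hRR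
        _ = 1 / R := by field_simp
  · rw [Set.indicator_of_notMem (by rwa [mem_closedBall_zero_iff])]
    obtain ⟨h1, h2⟩ := hχout x (not_le.1 hx)
    have h3 : magneticLaplacian a (fun y => (χ y : ℂ) * w y) x = 0 := by
      rw [hlap]
      simp [h1, h2]
    rw [h3]
    simp [h1]

theorem integrableOn_closedBall {f : EuclideanSpace ℝ (Fin d) → ℝ} (hf : Continuous f) (ρ : ℝ) :
    IntegrableOn f (Metric.closedBall 0 ρ) :=
  hf.continuousOn.integrableOn_compact (isCompact_closedBall 0 ρ)

/-- The mass of an eigenfunction near the origin, in terms of the scale `R`. -/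
theorem local_mass_le {n : ℕ} {c R M δ : ℝ} (hc : 0 ≤ c) (hR : 1 ≤ R) (hM : 0 ≤ M) (hδ : 0 < δ)
    (hcut : ∀ R : ℝ, 0 < R → ∃ χ : EuclideanSpace ℝ (Fin (2 * n)) → ℝ,
      ContDiff ℝ ∞ χ ∧ HasCompactSupport χ ∧
      (∀ x, 0 ≤ χ x) ∧ (∀ x, χ x ≤ 1) ∧ (∀ x, ‖x‖ ≤ R / 2 → χ x = 1) ∧
      (∀ x, R < ‖x‖ → χ x = 0 ∧ ∀ j, partialDeriv j χ x = 0 ∧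
        partialDeriv j (partialDeriv j χ) x = 0) ∧
      (∀ j x, |partialDeriv j χ x| ≤ c / R) ∧
      ∀ j x, |partialDeriv j (partialDeriv j χ) x| ≤ c / R ^ 2)
    {A : Fin (2 * n) → EuclideanSpace ℝ (Fin (2 * n)) → ℝ}
    {q : EuclideanSpace ℝ (Fin (2 * n)) → ℝ} {u : EuclideanSpace ℝ (Fin (2 * n)) → ℂ}
    (hA : ∀ j, ContDiff ℝ ∞ (A j)) (hqc : Continuous q) (hu : ContDiff ℝ ∞ u)
    (hB : ∀ j k x, ‖fderiv ℝ (fun y => magneticField A y j k) x‖ ≤ 1 / R ^ 3)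
    (hqM : ∀ x, |q x| ≤ M) (hq : ∀ x, |q x - q 0| ≤ 1 / R ^ 3 * ‖x‖)
    (hrank : (magneticField A 0).rank = 2 * n)
    (hgap : ∀ a : Fin n → ℝ, IsFrequencies (magneticField A 0) a → ∀ k : Fin n → ℕ,
      δ ≤ |∑ j, (2 * (k j : ℝ) + 1) * a j - q 0|)
    (heq : ∀ x, magneticLaplacian A u x = (q x : ℂ) * u x) :
    δ ^ 2 * ∫ x in Metric.closedBall 0 (R / 2), ‖u x‖ ^ 2
      ≤ 2 * (((2 * n : ℕ) + 1) * ((2 * n : ℕ) ^ 2 + 3 * (2 * n : ℕ) + 2 * c * (2 * n : ℕ)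
          + 3 * c + 2)) ^ 2 / R ^ 2 * ((2 * M + 4 * (2 * n : ℕ) * c ^ 2)
          * (∫ x in Metric.closedBall 0 (2 * R), ‖u x‖ ^ 2)
        + ∫ x in Metric.closedBall 0 (2 * R), ‖u x‖ ^ 2) := by
  have hR0 : 0 < R := by linarith
  obtain ⟨χ, hχ, hχc, hχ0, hχ1, hχone, hχout, hχ', hχ''⟩ := hcut R hR0
  -- The second cutoff, at scale `2R`, is one on the ball of radius `R`, where the error of `χ`
  -- lives. Caccioppoli's inequality for it produces the outer ball of radius `2R`.
  obtain ⟨η, hη, hηc, hη0, hη1, hηone, hηout, hη', -⟩ := hcut (2 * R) (by positivity)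
  obtain ⟨r, w, hw, hr, hr0, hr', hwn, hDwn, hTw⟩ :=
    exists_gauge_transform hA (by positivity) hB hu heq
  have hvs : ContDiff ℝ 2 (fun x => (χ x : ℂ) * w x) :=
    (Complex.ofRealCLM.contDiff.comp (contDiff_infty.1 hχ 2)).mul hw
  have hvc : HasCompactSupport (fun x => (χ x : ℂ) * w x) := by
    have := (hχc.comp_left (g := fun t : ℝ => (t : ℂ)) (by simp)).mul_right (f' := w)
    exact this
  have hmodel := landau_gap_of_frequencies (transpose_magneticField A 0) hrank hδ hgap hvs hvc
  have hpt := norm_magneticLaplacian_cutoff_le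
    (fun j => contDiff_linearPotential (magneticField A 0) j) hr hχ hw hc hR hr0 hr' hq hχ0 hχ1
    hχout hχ' hχ'' hTw
  simp only [hDwn, hwn] at hpt
  have hucont : Continuous fun x => ‖u x‖ ^ 2 := hu.continuous.norm.pow 2
  have hDcont : Continuous fun x => ∑ j, ‖covariantDeriv A 1 j u x‖ ^ 2 :=
    continuous_finsetSum _ fun j _ =>
      (contDiff_covariantDeriv (n := ∞) hu (by simp) j (hA j)).continuous.norm.pow 2
  have hI0 : ∫ x in Metric.closedBall 0 (R / 2), ‖u x‖ ^ 2 ≤ ∫ x, ‖(χ x : ℂ) * w x‖ ^ 2 := by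
    refine setIntegral_le_integral_of_le_on (fun x => by positivity) (hvs.continuous.norm.pow 2)
      ?_ (fun x => by positivity) (fun x hx => le_of_eq ?_)
    · have := hvc.norm.comp_left (g := fun t : ℝ => t ^ 2) (by simp)
      exact this
    · rw [hχone x hx, Complex.ofReal_one, one_mul, hwn]
  have hI1 := integral_le_setIntegral_of_le_indicator (fun x => by positivity)
      (continuous_const.mul (hDcont.add hucont)) hpt
  simp only [Pi.mul_apply, Pi.add_apply] at hI1
  rw [integral_const_mul, integral_add (integrableOn_closedBall hDcont R)
    (integrableOn_closedBall hucont R)] at hI1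
  have hI2 := integral_covariantDeriv_closedBall_le hA hqc hM hqM hu heq hη hηc hη0 hη1
      (fun x hx => hηone x (by linarith)) (fun x hx => ⟨(hηout x hx).1, fun j =>
        ((hηout x hx).2 j).1⟩) (fun j x => (hη' j x).trans (div_le_self hc (by linarith)))
  have hI4 : ∫ x in Metric.closedBall 0 R, ‖u x‖ ^ 2
      ≤ ∫ x in Metric.closedBall 0 (2 * R), ‖u x‖ ^ 2 :=
    setIntegral_mono_set (integrableOn_closedBall hucont _)
      (Filter.Eventually.of_forall fun x => by positivity)
      (Metric.closedBall_subset_closedBall (by linarith)).eventuallyLE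
  refine (mul_le_mul_of_nonneg_left hI0 (sq_nonneg δ)).trans (hmodel.trans (hI1.trans ?_))
  exact mul_le_mul_of_nonneg_left (add_le_add hI2 hI4) (by positivity)

/-- Eigenfunctions of an operator with slowly varying coefficients are small, compared with their
neighborhood, at points where the eigenvalue keeps away from the Landau levels. -/
theorem local_decay (n : ℕ) {M δ ε : ℝ} (hM : 0 ≤ M) (hδ : 0 < δ) (hε : 0 < ε) :
    ∃ R κ : ℝ, 1 ≤ R ∧ 0 < κ ∧
      ∀ (A : Fin (2 * n) → EuclideanSpace ℝ (Fin (2 * n)) → ℝ)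
        (q : EuclideanSpace ℝ (Fin (2 * n)) → ℝ) (u : EuclideanSpace ℝ (Fin (2 * n)) → ℂ),
        (∀ j, ContDiff ℝ ∞ (A j)) → Continuous q → ContDiff ℝ ∞ u →
        (∀ j k x, ‖fderiv ℝ (fun y => magneticField A y j k) x‖ ≤ κ) →
        (∀ x, |q x| ≤ M) → (∀ x, |q x - q 0| ≤ κ * ‖x‖) →
        (magneticField A 0).rank = 2 * n →
        (∀ a : Fin n → ℝ, IsFrequencies (magneticField A 0) a → ∀ k : Fin n → ℕ,
          δ ≤ |∑ j, (2 * (k j : ℝ) + 1) * a j - q 0|) →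
        (∀ x, magneticLaplacian A u x = (q x : ℂ) * u x) →
        ∫ x in Metric.closedBall 0 (R / 2), ‖u x‖ ^ 2
          ≤ ε * ∫ x in Metric.closedBall 0 (2 * R), ‖u x‖ ^ 2 := by
  obtain ⟨c, hc, hcut⟩ := exists_cutoff (2 * n)
  obtain ⟨K1, hK1⟩ : ∃ K1 : ℝ, K1 = 2 * (((2 * n : ℕ) + 1) * ((2 * n : ℕ) ^ 2 + 3 * (2 * n : ℕ)
    + 2 * c * (2 * n : ℕ) + 3 * c + 2)) ^ 2 := ⟨_, rfl⟩
  obtain ⟨K2, hK2⟩ : ∃ K2 : ℝ, K2 = 2 * M + 4 * (2 * n : ℕ) * c ^ 2 := ⟨_, rfl⟩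
  have hK10 : 0 ≤ K1 := by rw [hK1]; positivity
  have hK20 : 0 ≤ K2 := by rw [hK2]; positivity
  -- `K1` comes from the localization error and `K2` from Caccioppoli's inequality, neither
  -- depending on `R`. The choice gives `K1 (K2 + 1) / R² ≤ ε δ²` by way of `R - 1 ≤ R²`.
  obtain ⟨R, hRdef⟩ : ∃ R : ℝ, R = 1 + K1 * (K2 + 1) / (ε * δ ^ 2) := ⟨_, rfl⟩
  have hR1 : 1 ≤ R := by
    have : 0 ≤ K1 * (K2 + 1) / (ε * δ ^ 2) := by positivity
    linarith
  have hR0 : 0 < R := by linarith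
  have hRK : K1 * (K2 + 1) / R ^ 2 ≤ ε * δ ^ 2 := by
    rw [div_le_iff₀ (by positivity)]
    have h1 : K1 * (K2 + 1) = ε * δ ^ 2 * (R - 1) := by
      rw [hRdef]; field_simp; ring
    rw [h1]
    have : R - 1 ≤ R ^ 2 := by nlinarith
    gcongr
  refine ⟨R, 1 / R ^ 3, hR1, by positivity, ?_⟩
  intro A q u hA hqc hu hB hqM hq hrank hgap heq
  have h := local_mass_le hc hR1 hM hδ hcut hA hqc hu hB hqM hq hrank hgap heq
  rw [← hK1, ← hK2] at h
  have hJ0 : 0 ≤ ∫ x in Metric.closedBall 0 (2 * R), ‖u x‖ ^ 2 :=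
    integral_nonneg fun x => by positivity
  refine le_of_mul_le_mul_left (h.trans ?_) (show 0 < δ ^ 2 by positivity)
  have := mul_le_mul_of_nonneg_right hRK hJ0
  refine le_trans (le_of_eq ?_) (this.trans (le_of_eq ?_)) <;> ring

end LocalEstimate


/-! ### Passage to the length scale ħ^{1/2} -/

section Rescaling

open MeasureTheory

variable {d : ℕ}

theorem fderiv_comp_affine {F : Type*} [NormedAddCommGroup F] [NormedSpace ℝ F]
    (f : EuclideanSpace ℝ (Fin d) → F) (z : EuclideanSpace ℝ (Fin d)) (s : ℝ)
    (y : EuclideanSpace ℝ (Fin d)) :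
    fderiv ℝ (fun y => f (z + s • y)) y = s • fderiv ℝ f (z + s • y) := by
  have h := fderiv_comp_smul (𝕜 := ℝ) (f := fun y => f (z + y)) (x := y) s
  rw [fderiv_comp_add_left] at h
  exact h

theorem partialDeriv_comp_affine {F : Type*} [NormedAddCommGroup F] [NormedSpace ℝ F]
    (f : EuclideanSpace ℝ (Fin d) → F) (z : EuclideanSpace ℝ (Fin d)) (s : ℝ) (j : Fin d)
    (y : EuclideanSpace ℝ (Fin d)) :
    partialDeriv j (fun y => f (z + s • y)) y = s • partialDeriv j f (z + s • y) := by
  rw [partialDeriv, fderiv_comp_affine]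
  rfl

/-- The magnetic potential seen from the point `z` at the length scale `s`. -/
def rescaledPotential (A : Fin d → EuclideanSpace ℝ (Fin d) → ℝ) (z : EuclideanSpace ℝ (Fin d))
    (s : ℝ) (j : Fin d) (y : EuclideanSpace ℝ (Fin d)) : ℝ :=
  s⁻¹ * A j (z + s • y)

variable {A : Fin d → EuclideanSpace ℝ (Fin d) → ℝ} {z : EuclideanSpace ℝ (Fin d)} {s : ℝ}

theorem contDiff_rescaledPotential (hA : ∀ j, ContDiff ℝ ∞ (A j)) (j : Fin d) :
    ContDiff ℝ ∞ (rescaledPotential A z s j) :=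
  contDiff_const.mul ((hA j).comp (by fun_prop))

/-- The factor `s⁻¹` in the potential cancels the chain-rule factor: the field keeps its size, and
only its gradient gains a factor `s`. -/
theorem magneticField_rescaledPotential (hA : ∀ j, ContDiff ℝ ∞ (A j)) (hs : s ≠ 0)
    (y : EuclideanSpace ℝ (Fin d)) :
    magneticField (rescaledPotential A z s) y = magneticField A (z + s • y) := by
  have h : ∀ j k, partialDeriv j (rescaledPotential A z s k) y
      = partialDeriv j (A k) (z + s • y) := by
    intro j k
    have h1 : DifferentiableAt ℝ (fun y => A k (z + s • y)) y :=
      ((hA k).differentiable (by simp) _).comp y (by fun_prop)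
    have h2 := partialDeriv_comp_affine (A k) z s j y
    unfold rescaledPotential
    rw [partialDeriv, fderiv_const_mul h1, smul_apply]
    rw [partialDeriv] at h2
    rw [h2, smul_smul, inv_mul_cancel₀ hs, one_smul]
  ext j k
  simp [magneticField, h]

theorem covariantDeriv_rescaledPotential (hs : s ≠ 0) (f : EuclideanSpace ℝ (Fin d) → ℂ)
    (j : Fin d) (y : EuclideanSpace ℝ (Fin d)) :
    covariantDeriv (rescaledPotential A z s) 1 j (fun y => f (z + s • y)) y
      = (s : ℂ)⁻¹ * covariantDeriv A (s ^ 2) j f (z + s • y) := by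
  rw [covariantDeriv, covariantDeriv, partialDeriv_comp_affine, rescaledPotential]
  have : (s : ℂ) ≠ 0 := by exact_mod_cast hs
  rw [Complex.real_smul]
  push_cast
  field_simp

theorem covariantDeriv_const_mul {ħ : ℝ} {f : EuclideanSpace ℝ (Fin d) → ℂ}
    {x : EuclideanSpace ℝ (Fin d)} (hf : DifferentiableAt ℝ f x) (c : ℂ) (j : Fin d) :
    covariantDeriv A ħ j (fun y => c * f y) x = c * covariantDeriv A ħ j f x := by
  rw [covariantDeriv, covariantDeriv, partialDeriv, partialDeriv, fderiv_const_mul hf,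
    smul_apply, smul_eq_mul]
  ring

theorem differentiable_covariantDeriv {ħ : ℝ} (hA : ∀ j, ContDiff ℝ ∞ (A j))
    {u : EuclideanSpace ℝ (Fin d) → ℂ} (hu : ContDiff ℝ ∞ u) (j : Fin d) :
    Differentiable ℝ (covariantDeriv A ħ j u) := by
  have h1 : Differentiable ℝ (partialDeriv j u) :=
    (contDiff_partialDeriv_top hu j).differentiable (by simp)
  have h2 : Differentiable ℝ fun x => (A j x : ℂ) :=
    (Complex.ofRealCLM.contDiff.comp (hA j)).differentiable (by simp)
  exact (h1.const_mul _).sub (h2.mul (hu.differentiable (by simp)))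

/-- Eigenfunctions on the length scale of `ħ ^ (1 / 2)`. -/
theorem magneticLaplacian_rescaledPotential (hA : ∀ j, ContDiff ℝ ∞ (A j)) (hs : s ≠ 0)
    {u : EuclideanSpace ℝ (Fin d) → ℂ} (hu : ContDiff ℝ ∞ u)
    {V : EuclideanSpace ℝ (Fin d) → ℝ} {lam : ℝ}
    (heq : ∀ x, schrodinger A V (s ^ 2) u x = (lam : ℂ) * u x) (y : EuclideanSpace ℝ (Fin d)) :
    magneticLaplacian (rescaledPotential A z s) (fun y => u (z + s • y)) y
      = ((lam / s ^ 2 - V (z + s • y) : ℝ) : ℂ) * u (z + s • y) := by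
  have hsc : (s : ℂ) ≠ 0 := by exact_mod_cast hs
  have h1 : ∀ j, covariantDeriv (rescaledPotential A z s) 1 j
      (covariantDeriv (rescaledPotential A z s) 1 j (fun y => u (z + s • y))) y
      = (s : ℂ)⁻¹ * ((s : ℂ)⁻¹
        * covariantDeriv A (s ^ 2) j (covariantDeriv A (s ^ 2) j u) (z + s • y)) := by
    intro j
    rw [funext (covariantDeriv_rescaledPotential hs u j)]
    have := covariantDeriv_rescaledPotential (A := A) (z := z) hs
      (fun x => (s : ℂ)⁻¹ * covariantDeriv A (s ^ 2) j u x) j y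
    rw [this, covariantDeriv_const_mul (differentiable_covariantDeriv hA hu j _)]
  have h2 := heq (z + s • y)
  rw [schrodinger] at h2
  rw [magneticLaplacian, Finset.sum_congr rfl fun j _ => h1 j, ← Finset.mul_sum, ← Finset.mul_sum,
    eq_sub_of_add_eq h2]
  push_cast
  field_simp

/-- The Jacobian factor does not depend on the radius, so it cancels when the masses of two balls
are compared. -/
theorem setIntegral_comp_affine {f : EuclideanSpace ℝ (Fin d) → ℝ}
    (z : EuclideanSpace ℝ (Fin d)) (hs : 0 < s) {ρ : ℝ} (hρ : 0 ≤ ρ) :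
    ∫ y in Metric.closedBall 0 ρ, f (z + s • y)
      = (s ^ d)⁻¹ * ∫ x in Metric.closedBall z (s * ρ), f x := by
  have h1 := Measure.setIntegral_comp_smul_of_pos (volume : Measure (EuclideanSpace ℝ (Fin d)))
    (fun x => f (z + x)) (Metric.closedBall 0 ρ) hs
  have h2 := (measurePreserving_add_left (volume : Measure (EuclideanSpace ℝ (Fin d)))
    z).setIntegral_preimage_emb (measurableEmbedding_addLeft z) f (Metric.closedBall z (s * ρ))
  rw [h1, ← h2]
  rw [smul_closedBall _ _ hρ, smul_zero, Real.norm_eq_abs, abs_of_pos hs, preimage_add_closedBall,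
    sub_self, finrank_euclideanSpace_fin, smul_eq_mul]

end Rescaling

/-! ### Local decay off the resonant set, uniformly in the center -/

section SemiclassicalDecay

open MeasureTheory

theorem IsSmoothBounded.exists_bound {d : ℕ} {f : EuclideanSpace ℝ (Fin d) → ℝ}
    (hf : IsSmoothBounded f) : ∃ M : ℝ, 0 ≤ M ∧ ∀ x, |f x| ≤ M := by
  obtain ⟨M, hM⟩ := hf.2 0
  refine ⟨M, (norm_nonneg _).trans (hM 0), fun x => ?_⟩
  have := hM x
  rwa [norm_iteratedFDeriv_zero, Real.norm_eq_abs] at this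

theorem IsSmoothBounded.exists_fderiv_bound {d : ℕ} {f : EuclideanSpace ℝ (Fin d) → ℝ}
    (hf : IsSmoothBounded f) : ∃ M : ℝ, 0 ≤ M ∧ ∀ x, ‖fderiv ℝ f x‖ ≤ M := by
  obtain ⟨M, hM⟩ := hf.2 1
  refine ⟨M, (norm_nonneg _).trans (hM 0), fun x => ?_⟩
  have := hM x
  rwa [norm_iteratedFDeriv_one] at this

/-- Away from the resonant set, the energy keeps away from the Landau levels. -/
theorem le_abs_landauLevel_sub {n : ℕ} {A : Fin (2 * n) → EuclideanSpace ℝ (Fin (2 * n)) → ℝ}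
    {V : EuclideanSpace ℝ (Fin (2 * n)) → ℝ} {a b a₁ b₁ μ : ℝ}
    {z : EuclideanSpace ℝ (Fin (2 * n))} (hz : z ∉ resonantSet A V a b)
    (hμa : a₁ ≤ μ) (hμb : μ ≤ b₁) {α : Fin n → ℝ} (hα : IsFrequencies (magneticField A z) α)
    (k : Fin n → ℕ) :
    min (a₁ - a) (b - b₁) ≤ |∑ j, (2 * (k j : ℝ) + 1) * α j - (μ - V z)| := by
  have h : ∑ j, (2 * (k j : ℝ) + 1) * α j + V z ∉ Set.Icc a b := fun h =>
    hz ⟨_, ⟨α, hα, k, rfl⟩, h⟩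
  rw [Set.mem_Icc, not_and_or, not_le, not_le] at h
  rcases h with h | h
  · refine (min_le_left _ _).trans ?_
    rw [abs_sub_comm]
    exact le_trans (by linarith) (le_abs_self _)
  · exact (min_le_right _ _).trans (le_trans (by linarith) (le_abs_self _))

/-- Off the resonant set, the mass of an eigenfunction in a ball of radius of order `ħ ^ (1 / 2)` is
small compared with its mass in a larger ball. -/
theorem semiclassical_decay {n : ℕ} {A : Fin (2 * n) → EuclideanSpace ℝ (Fin (2 * n)) → ℝ}
    {V : EuclideanSpace ℝ (Fin (2 * n)) → ℝ} (hA : ∀ j, ContDiff ℝ ∞ (A j))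
    (hB : ∀ j k, IsSmoothBounded (fun x => magneticField A x j k)) (hV : IsSmoothBounded V)
    (hrank : ∀ x, (magneticField A x).rank = 2 * n) {a b a₁ b₁ ε : ℝ} (ha : a < a₁) (hb : b₁ < b)
    (hε : 0 < ε) :
    ∃ R s₀ : ℝ, 0 < R ∧ 0 < s₀ ∧ ∀ s : ℝ, 0 < s → s ≤ s₀ →
      ∀ lam : ℝ, lam ∈ Set.Icc (s ^ 2 * a₁) (s ^ 2 * b₁) →
      ∀ u : EuclideanSpace ℝ (Fin (2 * n)) → ℂ, ContDiff ℝ ∞ u →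
        (∀ x, schrodinger A V (s ^ 2) u x = (lam : ℂ) * u x) →
        ∀ z ∉ resonantSet A V a b,
          ∫ x in Metric.closedBall z (s * R), ‖u x‖ ^ 2
            ≤ ε * ∫ x in Metric.closedBall z (4 * (s * R)), ‖u x‖ ^ 2 := by
  obtain ⟨MV, hMV0, hMV⟩ := hV.exists_bound
  obtain ⟨LV, hLV0, hLV⟩ := hV.exists_fderiv_bound
  choose LB hLB0 hLB using fun j k => (hB j k).exists_fderiv_bound
  -- The two constants are independent of the center: the rescaled potential `μ - V` is bounded by
  -- `max |a₁| |b₁| + MV`, and `min (a₁ - a) (b - b₁)` bounds from below the distance from `μ ∈ [a₁,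
  -- b₁]` to anything outside `[a, b]`.
  obtain ⟨R, κ, hR, hκ, hdec⟩ := local_decay n (M := max |a₁| |b₁| + MV)
    (δ := min (a₁ - a) (b - b₁)) (by positivity) (lt_min (by linarith) (by linarith)) hε
  obtain ⟨L, hL⟩ : ∃ L : ℝ, L = LV + ∑ j, ∑ k, LB j k := ⟨_, rfl⟩
  have hS0 : 0 ≤ ∑ j, ∑ k, LB j k :=
    Finset.sum_nonneg fun j _ => Finset.sum_nonneg fun k _ => hLB0 j k
  have hL0 : 0 ≤ L := by rw [hL]; positivity
  have hLVL : LV ≤ L := by rw [hL]; linarith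
  have hLBL : ∀ j k, LB j k ≤ L := by
    intro j k
    have h1 : LB j k ≤ ∑ k, LB j k :=
      Finset.single_le_sum (f := fun k => LB j k) (fun k _ => hLB0 j k) (Finset.mem_univ k)
    have h2 : ∑ k, LB j k ≤ ∑ j, ∑ k, LB j k :=
      Finset.single_le_sum (f := fun j => ∑ k, LB j k)
        (fun j _ => Finset.sum_nonneg fun k _ => hLB0 j k) (Finset.mem_univ j)
    rw [hL]; linarith
  -- With inner radius `R / 2`, the outer radius `2R` is four times as large. The bound on `s` gives
  -- `s L ≤ κ`; the `+ 1` keeps the quotient meaningful when `L = 0`.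
  refine ⟨R / 2, κ / (L + 1), by positivity, by positivity, ?_⟩
  intro s hs hss lam hlam u hu heq z hz
  have hsL : s * L ≤ κ := by
    rw [le_div_iff₀ (by positivity)] at hss
    nlinarith
  obtain ⟨μ, hμ⟩ : ∃ μ : ℝ, μ = lam / s ^ 2 := ⟨_, rfl⟩
  have hμa : a₁ ≤ μ := by
    rw [hμ, le_div_iff₀ (by positivity), mul_comm]; exact hlam.1
  have hμb : μ ≤ b₁ := by
    rw [hμ, div_le_iff₀ (by positivity), mul_comm b₁]; exact hlam.2
  have hVlip : ∀ x y, |V x - V y| ≤ LV * ‖x - y‖ := fun x y =>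
    Convex.norm_image_sub_le_of_norm_fderiv_le (𝕜 := ℝ)
      (fun x _ => hV.1.differentiable (by simp) x) (fun x _ => hLV x) convex_univ
      (Set.mem_univ y) (Set.mem_univ x)
  have key := hdec (rescaledPotential A z s) (fun y => μ - V (z + s • y))
    (fun y => u (z + s • y)) (contDiff_rescaledPotential hA)
    (continuous_const.sub (hV.1.continuous.comp (by fun_prop))) (hu.comp (by fun_prop))
    ?_ ?_ ?_ ?_ ?_ ?_
  · have h1 := setIntegral_comp_affine (f := fun x => ‖u x‖ ^ 2) z hs (ρ := R / 2) (by positivity)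
    have h2 := setIntegral_comp_affine (f := fun x => ‖u x‖ ^ 2) z hs (ρ := 2 * R) (by positivity)
    rw [h1, h2, mul_left_comm] at key
    have h3 := le_of_mul_le_mul_left key (by positivity)
    rwa [show 4 * (s * (R / 2)) = s * (2 * R) by ring]
  · intro j k x
    simp only [magneticField_rescaledPotential hA hs.ne']
    rw [fderiv_comp_affine (fun y => magneticField A y j k), norm_smul, Real.norm_eq_abs,
      abs_of_pos hs]
    calc s * _ ≤ s * L := by gcongr; exact (hLB j k _).trans (hLBL j k)
      _ ≤ κ := hsL
  · intro x
    refine (abs_sub _ _).trans (add_le_add ?_ (hMV _))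
    exact abs_le_max_abs_abs hμa hμb
  · intro x
    rw [smul_zero, add_zero, sub_sub_sub_cancel_left]
    refine (hVlip _ _).trans ?_
    rw [show z - (z + s • x) = -(s • x) by abel, norm_neg, norm_smul, Real.norm_eq_abs,
      abs_of_pos hs, ← mul_assoc]
    gcongr
    calc LV * s ≤ L * s := by gcongr
      _ ≤ κ := by linarith
  · rw [magneticField_rescaledPotential hA hs.ne']
    exact hrank _
  · intro α hα k
    rw [magneticField_rescaledPotential hA hs.ne', smul_zero, add_zero] at hα
    simp only [smul_zero, add_zero]
    exact le_abs_landauLevel_sub hz hμa hμb hα k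
  · intro x
    rw [hμ]
    exact magneticLaplacian_rescaledPotential hA hs.ne' hu heq x

end SemiclassicalDecay


/-! ### From local smallness to exponential decay -/

section WeightedEstimate

open MeasureTheory

variable {d : ℕ}

/-- The kernel `W z * f x` restricted to the pairs of points at distance at most `r`. -/
def nearKernel (f W : EuclideanSpace ℝ (Fin d) → ℝ≥0∞) (r : ℝ) :
    EuclideanSpace ℝ (Fin d) × EuclideanSpace ℝ (Fin d) → ℝ≥0∞ :=
  {p | dist p.1 p.2 ≤ r}.indicator fun p => W p.1 * f p.2

theorem measurable_nearKernel {f W : EuclideanSpace ℝ (Fin d) → ℝ≥0∞}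
    (hf : Measurable f) (hW : Measurable W) (r : ℝ) : Measurable (nearKernel f W r) :=
  ((hW.comp measurable_fst).mul (hf.comp measurable_snd)).indicator
    (isClosed_le (by fun_prop) continuous_const).measurableSet

theorem mul_setLIntegral_closedBall_eq {f W : EuclideanSpace ℝ (Fin d) → ℝ≥0∞}
    (hf : Measurable f) (r : ℝ) (z : EuclideanSpace ℝ (Fin d)) :
    W z * ∫⁻ x in Metric.closedBall z r, f x = ∫⁻ x, nearKernel f W r (z, x) := by
  rw [← lintegral_const_mul _ hf, ← lintegral_indicator measurableSet_closedBall]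
  refine lintegral_congr fun x => ?_
  simp only [nearKernel, Set.indicator, Metric.mem_closedBall, Set.mem_ofPred_eq, dist_comm x z]

theorem measurable_mul_setLIntegral_closedBall {f W : EuclideanSpace ℝ (Fin d) → ℝ≥0∞}
    (hf : Measurable f) (hW : Measurable W) (r : ℝ) :
    Measurable fun z => W z * ∫⁻ x in Metric.closedBall z r, f x := by
  simp only [mul_setLIntegral_closedBall_eq hf r]
  exact (measurable_nearKernel hf hW r).lintegral_prod_right'

/-- Tonelli for the symmetric relation `dist z x ≤ r`. -/
theorem lintegral_mul_setLIntegral_closedBall {f W : EuclideanSpace ℝ (Fin d) → ℝ≥0∞}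
    (hf : Measurable f) (hW : Measurable W) (r : ℝ) :
    ∫⁻ z, W z * ∫⁻ x in Metric.closedBall z r, f x
      = ∫⁻ x, f x * ∫⁻ z in Metric.closedBall x r, W z := by
  have h : ∀ x, f x * ∫⁻ z in Metric.closedBall x r, W z = ∫⁻ z, nearKernel f W r (z, x) := by
    intro x
    rw [← lintegral_const_mul _ hW, ← lintegral_indicator measurableSet_closedBall]
    refine lintegral_congr fun z => ?_
    simp only [nearKernel, Set.indicator, Metric.mem_closedBall, Set.mem_ofPred_eq, mul_comm (f x)]
  rw [lintegral_congr (mul_setLIntegral_closedBall_eq hf r), lintegral_congr h]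
  exact lintegral_lintegral_swap (measurable_nearKernel hf hW r).aemeasurable

/-- If the mass of `f` in small balls is absorbed by its mass in larger balls, up to a term without
weight, then the weighted integral of `f` is controlled by its integral. -/
theorem lintegral_weight_le {f W : EuclideanSpace ℝ (Fin d) → ℝ≥0∞}
    (hf : Measurable f) (hW : Measurable W) {r : ℝ} (hr : 0 < r)
    (hvar : ∀ x z, dist x z ≤ 4 * r → W x ≤ 2 * W z)
    (hdec : ∀ z, W z * ∫⁻ x in Metric.closedBall z r, f x
      ≤ ENNReal.ofReal (1 / (8 * 4 ^ d)) * (W z * ∫⁻ x in Metric.closedBall z (4 * r), f x)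
        + ∫⁻ x in Metric.closedBall z r, f x)
    (hfin : ∫⁻ x, W x * f x ≠ ⊤) :
    ∫⁻ x, W x * f x ≤ 4 * ∫⁻ x, f x := by
  obtain ⟨v, hv⟩ : ∃ v, v = volume (Metric.closedBall (0 : EuclideanSpace ℝ (Fin d)) r) := ⟨_, rfl⟩
  have hv0 : v ≠ 0 := by
    rw [hv]; exact (Metric.measure_closedBall_pos volume 0 hr).ne'
  have hvt : v ≠ ⊤ := by rw [hv]; exact measure_closedBall_lt_top.ne
  have hv1 : ∀ x : EuclideanSpace ℝ (Fin d), volume (Metric.closedBall x r) = v := fun x => by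
    rw [hv, Measure.addHaar_closedBall_center]
  have hv4 : ∀ x : EuclideanSpace ℝ (Fin d), volume (Metric.closedBall x (4 * r)) = 4 ^ d * v := by
    intro x
    rw [Measure.addHaar_closedBall_mul _ _ (by norm_num) hr.le, hv, finrank_euclideanSpace_fin]
    congr 1
    rw [ENNReal.ofReal_pow (by norm_num)]
    norm_num
  have hW4 : Measurable fun z => W z * ∫⁻ x in Metric.closedBall z (4 * r), f x :=
    measurable_mul_setLIntegral_closedBall hf hW _
  -- The centers `z` whose ball contains `x` fill a ball of volume `v` about `x`, on which the
  -- weight is comparable to `W x` up to a factor 2; the upper bound over the larger balls works the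
  -- same way.
  have hlow : v * ∫⁻ x, W x * f x ≤ 2 * ∫⁻ z, W z * ∫⁻ x in Metric.closedBall z r, f x := by
    rw [lintegral_mul_setLIntegral_closedBall hf hW, ← lintegral_const_mul' _ _ hvt,
      ← lintegral_const_mul' _ _ (by norm_num)]
    refine lintegral_mono fun x => ?_
    calc v * (W x * f x) = f x * ∫⁻ z in Metric.closedBall x r, W x := by
          rw [setLIntegral_const, hv1]; ring
      _ ≤ f x * ∫⁻ z in Metric.closedBall x r, 2 * W z := by
          refine mul_le_mul' le_rfl ?_
          refine setLIntegral_mono' measurableSet_closedBall fun z hz => hvar x z ?_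
          rw [dist_comm]
          exact (Metric.mem_closedBall.1 hz).trans (by linarith)
      _ = _ := by rw [lintegral_const_mul _ hW]; ring
  have hup : ∫⁻ z, W z * ∫⁻ x in Metric.closedBall z (4 * r), f x
      ≤ 2 * (4 ^ d * v) * ∫⁻ x, W x * f x := by
    rw [lintegral_mul_setLIntegral_closedBall hf hW, ← lintegral_const_mul' _ _ (by finiteness)]
    refine lintegral_mono fun x => ?_
    calc f x * ∫⁻ z in Metric.closedBall x (4 * r), W z
        ≤ f x * ∫⁻ z in Metric.closedBall x (4 * r), 2 * W x := by
          refine mul_le_mul' le_rfl ?_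
          exact setLIntegral_mono' measurableSet_closedBall fun z hz => hvar z x hz
      _ = _ := by rw [setLIntegral_const, hv4]; ring
  have hone : ∫⁻ z, ∫⁻ x in Metric.closedBall z r, f x = v * ∫⁻ x, f x := by
    have h := lintegral_mul_setLIntegral_closedBall hf (W := fun _ => 1) measurable_const r
    simp only [one_mul, setLIntegral_const, hv1] at h
    rw [h, lintegral_mul_const _ hf, mul_comm]
  generalize (∫⁻ x, W x * f x) = I at hfin hlow hup ⊢
  generalize (∫⁻ x, f x) = N at hone ⊢
  -- The constant `1 / (8 * 4 ^ d)` is what makes the product `2 · ε · 2 · 4 ^ d` equal to one half.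
  have hsum : v * I ≤ v * (2⁻¹ * I + 2 * N) := by
    calc v * I ≤ 2 * ∫⁻ z, W z * ∫⁻ x in Metric.closedBall z r, f x := hlow
      _ ≤ 2 * ∫⁻ z, (ENNReal.ofReal (1 / (8 * 4 ^ d))
            * (W z * ∫⁻ x in Metric.closedBall z (4 * r), f x)
          + ∫⁻ x in Metric.closedBall z r, f x) := by
          gcongr with z
          exact hdec z
      _ = 2 * (ENNReal.ofReal (1 / (8 * 4 ^ d))
            * (∫⁻ z, W z * ∫⁻ x in Metric.closedBall z (4 * r), f x) + v * N) := by
          rw [lintegral_add_left (hW4.const_mul _), lintegral_const_mul _ hW4, hone]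
      _ ≤ 2 * (ENNReal.ofReal (1 / (8 * 4 ^ d)) * (2 * (4 ^ d * v) * I) + v * N) := by
          gcongr
      _ = v * (4 * (ENNReal.ofReal (1 / (8 * 4 ^ d)) * 4 ^ d) * I + 2 * N) := by ring
      _ = v * (2⁻¹ * I + 2 * N) := by
          congr 3
          rw [show (4 : ℝ≥0∞) = ENNReal.ofReal 4 by norm_num,
            show (2 : ℝ≥0∞)⁻¹ = ENNReal.ofReal (2⁻¹) by
              rw [ENNReal.ofReal_inv_of_pos (by norm_num)]; norm_num,
            ← ENNReal.ofReal_pow (by norm_num), ← ENNReal.ofReal_mul (by positivity),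
            ← ENNReal.ofReal_mul (by positivity)]
          congr 1
          field_simp
          norm_num
  have h2 : I ≤ 2⁻¹ * I + 2 * N := (ENNReal.mul_le_mul_iff_right hv0 hvt).1 hsum
  have h3 : I = 2⁻¹ * I + 2⁻¹ * I := by
    rw [← add_mul, ENNReal.inv_two_add_inv_two, one_mul]
  -- Absorbing `I / 2` into the left side is legitimate only because `I` is finite.
  have h4 : 2⁻¹ * I ≤ 2 * N :=
    (ENNReal.add_le_add_iff_left (by finiteness)).1 (h3.symm.le.trans h2)
  calc I = 2 * (2⁻¹ * I) := by
        rw [← mul_assoc, ENNReal.mul_inv_cancel (by norm_num) (by norm_num), one_mul]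
    _ ≤ 2 * (2 * N) := by gcongr
    _ = 4 * N := by rw [← mul_assoc]; norm_num

/-- The distance to `K`, truncated at height `m`. -/
def truncDist (K : Set (EuclideanSpace ℝ (Fin d))) (m : ℕ) (x : EuclideanSpace ℝ (Fin d)) : ℝ :=
  (min (Metric.infEDist x K) m).toReal

theorem measurable_truncDist (K : Set (EuclideanSpace ℝ (Fin d))) (m : ℕ) :
    Measurable (truncDist K m) :=
  ((Metric.continuous_infEDist.min continuous_const).measurable).ennreal_toReal

theorem truncDist_le_add_dist (K : Set (EuclideanSpace ℝ (Fin d))) (m : ℕ)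
    (x z : EuclideanSpace ℝ (Fin d)) : truncDist K m x ≤ truncDist K m z + dist x z := by
  have h : min (Metric.infEDist x K) m ≤ min (Metric.infEDist z K) m + edist x z := by
    rw [min_add]
    exact min_le_min Metric.infEDist_le_infEDist_add_edist le_self_add
  have h1 : min (Metric.infEDist z K) (m : ℝ≥0∞) ≠ ⊤ :=
    ne_top_of_le_ne_top (ENNReal.natCast_ne_top m) (min_le_right _ _)
  rw [dist_edist, truncDist, truncDist, ← ENNReal.toReal_add h1 (edist_ne_top x z)]
  exact ENNReal.toReal_mono (by simp [h1, edist_ne_top]) h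

theorem truncDist_le (K : Set (EuclideanSpace ℝ (Fin d))) (m : ℕ) (x : EuclideanSpace ℝ (Fin d)) :
    truncDist K m x ≤ m := by
  rw [truncDist, ← ENNReal.toReal_natCast m]
  exact ENNReal.toReal_mono (ENNReal.natCast_ne_top m) (min_le_right _ _)

theorem truncDist_mono (K : Set (EuclideanSpace ℝ (Fin d))) (x : EuclideanSpace ℝ (Fin d)) :
    Monotone fun m => truncDist K m x := fun m m' h =>
  ENNReal.toReal_mono (ne_top_of_le_ne_top (ENNReal.natCast_ne_top m') (min_le_right _ _))
    (min_le_min le_rfl (by exact_mod_cast h))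

/-- At finite distance the truncation becomes inactive for large `m`. At infinite distance, that is
for empty `K`, the truncated distance is `m` and the supremum is infinite. -/
theorem expWeight_le_iSup (K : Set (EuclideanSpace ℝ (Fin d))) {c ħ : ℝ} (hc : 0 < c) (hħ : 0 < ħ)
    (x : EuclideanSpace ℝ (Fin d)) :
    expWeight c ħ K x
      ≤ ⨆ m, ENNReal.ofReal (Real.exp (2 * c / Real.sqrt ħ * truncDist K m x)) := by
  have hg : 0 < 2 * c / Real.sqrt ħ := by have := Real.sqrt_pos.2 hħ; positivity
  by_cases h : Metric.infEDist x K = ⊤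
  · have h1 : Filter.Tendsto
        (fun m : ℕ => ENNReal.ofReal (Real.exp (2 * c / Real.sqrt ħ * truncDist K m x)))
        Filter.atTop (nhds ⊤) := by
      refine ENNReal.tendsto_ofReal_atTop.comp (Real.tendsto_exp_atTop.comp ?_)
      have : (fun m => truncDist K m x) = fun m : ℕ => (m : ℝ) := by
        ext m
        simp [truncDist, h]
      simp only [congrFun this]
      exact tendsto_natCast_atTop_atTop.const_mul_atTop hg
    have h2 := le_of_tendsto' h1 fun m => le_iSup (fun m : ℕ =>
      ENNReal.ofReal (Real.exp (2 * c / Real.sqrt ħ * truncDist K m x))) m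
    exact le_top.trans h2
  · obtain ⟨m, hm⟩ := exists_nat_ge (Metric.infEDist x K).toReal
    refine le_trans (le_of_eq ?_) (le_iSup _ m)
    have h1 : Metric.infEDist x K ≤ m := by
      rw [← ENNReal.ofReal_toReal h]
      exact ENNReal.ofReal_le_of_le_toReal (by simpa using hm)
    rw [truncDist, min_eq_left h1, expWeight, ← EReal.exp_coe, EReal.coe_mul,
      EReal.coe_ennreal_toReal h]

theorem exp_half_le_two : Real.exp (1 / 2) ≤ 2 := by
  have h1 : Real.exp (1 / 2) ^ 2 = Real.exp 1 := by
    rw [← Real.exp_nat_mul]; norm_num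
  have h2 := Real.exp_one_lt_d9
  nlinarith [Real.exp_pos (1 / 2)]

/-- Exponential decay away from `K` of a function whose mass in small balls centered off `K` is
absorbed by its mass in larger balls. -/
theorem lintegral_expWeight_le {f : EuclideanSpace ℝ (Fin d) → ℝ≥0∞} (hf : Measurable f)
    (hfin : ∫⁻ x, f x ≠ ⊤) (K : Set (EuclideanSpace ℝ (Fin d))) {ħ R : ℝ} (hħ : 0 < ħ) (hR : 0 < R)
    (hdec : ∀ z ∉ K, ∫⁻ x in Metric.closedBall z (Real.sqrt ħ * R), f x
      ≤ ENNReal.ofReal (1 / (8 * 4 ^ d))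
        * ∫⁻ x in Metric.closedBall z (4 * (Real.sqrt ħ * R)), f x) :
    ∫⁻ x, expWeight (1 / (16 * R)) ħ K x * f x ≤ 4 * ∫⁻ x, f x := by
  have hs := Real.sqrt_pos.2 hħ
  obtain ⟨g, hg⟩ : ∃ g : ℝ, g = 2 * (1 / (16 * R)) / Real.sqrt ħ := ⟨_, rfl⟩
  have hg0 : 0 < g := by rw [hg]; positivity
  -- The rate `1 / (16 R)` lets the exponent vary by at most `1 / 2` over the larger balls, and `exp
  -- (1 / 2) ≤ 2`.
  have hgr : g * (4 * (Real.sqrt ħ * R)) = 1 / 2 := by rw [hg]; field_simp; norm_num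
  have hWm : ∀ m, Measurable fun x => ENNReal.ofReal (Real.exp (g * truncDist K m x)) := fun m =>
    (Real.measurable_exp.comp ((measurable_truncDist K m).const_mul g)).ennreal_ofReal
  have hm : ∀ m : ℕ, ∫⁻ x, ENNReal.ofReal (Real.exp (g * truncDist K m x)) * f x
      ≤ 4 * ∫⁻ x, f x := by
    intro m
    refine lintegral_weight_le hf (hWm m) (r := Real.sqrt ħ * R) (by positivity) ?_ ?_ ?_
    · intro x z hxz
      rw [show (2 : ℝ≥0∞) = ENNReal.ofReal 2 by norm_num, ← ENNReal.ofReal_mul (by norm_num)]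
      refine ENNReal.ofReal_le_ofReal ?_
      calc Real.exp (g * truncDist K m x)
          ≤ Real.exp (1 / 2 + g * truncDist K m z) := by
            rw [Real.exp_le_exp, ← hgr, ← mul_add]
            gcongr
            linarith [truncDist_le_add_dist K m x z]
        _ = Real.exp (1 / 2) * Real.exp (g * truncDist K m z) := Real.exp_add _ _
        _ ≤ _ := by gcongr; exact exp_half_le_two
    · intro z
      -- On `K` the weight is `1`, so the unweighted term alone suffices; off `K` the assumed
      -- smallness applies.
      by_cases hz : z ∈ K
      · rw [truncDist, Metric.infEDist_zero_of_mem hz]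
        simp
      · refine le_add_right ?_
        rw [mul_left_comm]
        exact mul_le_mul' le_rfl (hdec z hz)
    -- The truncated weight is bounded by `exp (g m)`: this finiteness is the purpose of the
    -- truncation.
    · refine ne_top_of_le_ne_top (ENNReal.mul_ne_top ENNReal.ofReal_ne_top hfin)
        ((lintegral_mono fun x => mul_le_mul' (ENNReal.ofReal_le_ofReal (Real.exp_le_exp.2
          (mul_le_mul_of_nonneg_left (truncDist_le K m x) hg0.le))) le_rfl).trans
          (lintegral_const_mul _ hf).le)
  calc ∫⁻ x, expWeight (1 / (16 * R)) ħ K x * f x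
      ≤ ∫⁻ x, ⨆ m, ENNReal.ofReal (Real.exp (g * truncDist K m x)) * f x := by
        refine lintegral_mono fun x => ?_
        rw [← ENNReal.iSup_mul, hg]
        exact mul_le_mul' (expWeight_le_iSup K (by positivity) hħ x) le_rfl
    _ = ⨆ m, ∫⁻ x, ENNReal.ofReal (Real.exp (g * truncDist K m x)) * f x := by
        refine lintegral_iSup (fun m => (hWm m).mul hf) fun m m' h x => ?_
        refine mul_le_mul' (ENNReal.ofReal_le_ofReal (Real.exp_le_exp.2
          (mul_le_mul_of_nonneg_left (truncDist_mono K x h) hg0.le))) le_rfl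
    _ ≤ 4 * ∫⁻ x, f x := iSup_le hm

theorem setLIntegral_enorm_sq_closedBall {u : EuclideanSpace ℝ (Fin d) → ℂ} (hu : Continuous u)
    (z : EuclideanSpace ℝ (Fin d)) (ρ : ℝ) :
    ∫⁻ x in Metric.closedBall z ρ, ‖u x‖ₑ ^ 2
      = ENNReal.ofReal (∫ x in Metric.closedBall z ρ, ‖u x‖ ^ 2) := by
  rw [ofReal_integral_eq_lintegral_ofReal (f := fun x => ‖u x‖ ^ 2)
    ((hu.norm.pow 2).continuousOn.integrableOn_compact (isCompact_closedBall z ρ))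
    (Filter.Eventually.of_forall fun x => by positivity)]
  refine lintegral_congr fun x => ?_
  rw [ENNReal.ofReal_pow (norm_nonneg _), ofReal_norm]

theorem eLpNorm_two_sq (u : EuclideanSpace ℝ (Fin d) → ℂ) :
    eLpNorm u 2 volume ^ 2 = ∫⁻ x, ‖u x‖ₑ ^ 2 := by
  have h := eLpNorm_nnreal_pow_eq_lintegral (μ := volume) (f := u) (p := 2) (by norm_num)
  simpa using h

end WeightedEstimate

end MagneticSchrodinger
end

/-! ### Conclusion -/

theorem theorem6 (n : ℕ)
    (A : Fin (2 * n) → EuclideanSpace ℝ (Fin (2 * n)) → ℝ)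
    (V : EuclideanSpace ℝ (Fin (2 * n)) → ℝ)
    (hA : ∀ j, ContDiff ℝ ∞ (A j))
    (hB : ∀ j k, MagneticSchrodinger.IsSmoothBounded
      (fun x => MagneticSchrodinger.magneticField A x j k))
    (hV : MagneticSchrodinger.IsSmoothBounded V)
    (hrank : ∀ x, (MagneticSchrodinger.magneticField A x).rank = 2 * n)
    (hinf : ∃ c₀ : ℝ, 0 < c₀ ∧ ∀ x, c₀ ≤ MagneticSchrodinger.fieldNorm A x)
    (a b : ℝ)
    (hK : IsCompact (MagneticSchrodinger.resonantSet A V a b))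
    (a₁ b₁ : ℝ) (ha : a < a₁) (hb : b₁ < b) :
    ∃ ħ₀ C c : ℝ, 0 < ħ₀ ∧ 0 < C ∧ 0 < c ∧
      ∀ ħ : ℝ, 0 < ħ → ħ ≤ ħ₀ →
      ∀ lam : ℝ, lam ∈ Set.Icc (ħ * a₁) (ħ * b₁) →
      ∀ u : EuclideanSpace ℝ (Fin (2 * n)) → ℂ,
        ContDiff ℝ ∞ u → MeasureTheory.MemLp u 2 MeasureTheory.volume →
        (∀ x, MagneticSchrodinger.schrodinger A V ħ u x = (lam : ℂ) * u x) →
        ∫⁻ x, MagneticSchrodinger.expWeight c ħ (MagneticSchrodinger.resonantSet A V a b) x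
            * ‖u x‖ₑ ^ 2
          ≤ ENNReal.ofReal C * MeasureTheory.eLpNorm u 2 MeasureTheory.volume ^ 2 := by
  -- `ε` is the smallness that the averaging argument requires in dimension `2n`.
  obtain ⟨R, s₀, hR, hs₀, hdec⟩ := MagneticSchrodinger.semiclassical_decay hA hB hV hrank ha hb
    (ε := 1 / (8 * 4 ^ (2 * n))) (by positivity)
  -- The length scale is `s = √ħ`, so `s ≤ s₀` becomes `ħ ≤ s₀²`; the constants `4` and `1 / (16 R)`
  -- are those of the weighted estimate.
  refine ⟨s₀ ^ 2, 4, 1 / (16 * R), by positivity, by norm_num, by positivity, ?_⟩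
  intro ħ hħ hħs lam hlam u hu hu2 heq
  have hs := Real.sqrt_pos.2 hħ
  have hsq : Real.sqrt ħ ^ 2 = ħ := Real.sq_sqrt hħ.le
  have hss : Real.sqrt ħ ≤ s₀ := (Real.sqrt_le_left hs₀.le).2 hħs
  have hfin : ∫⁻ x, ‖u x‖ₑ ^ 2 ≠ ⊤ := by
    rw [← MagneticSchrodinger.eLpNorm_two_sq]
    exact ENNReal.pow_ne_top hu2.eLpNorm_ne_top
  rw [MagneticSchrodinger.eLpNorm_two_sq, show ENNReal.ofReal 4 = 4 by norm_num]
  refine MagneticSchrodinger.lintegral_expWeight_le (hu.continuous.enorm.measurable.pow_const 2)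
    hfin _ hħ hR fun z hz => ?_
  rw [MagneticSchrodinger.setLIntegral_enorm_sq_closedBall hu.continuous,
    MagneticSchrodinger.setLIntegral_enorm_sq_closedBall hu.continuous,
    ← ENNReal.ofReal_mul (by positivity)]
  exact ENNReal.ofReal_le_ofReal (hdec _ hs hss lam (by rwa [hsq]) u hu (by rwa [hsq]) z hz)
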